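/- Let $M$ be a compact complex manifold of dimension $n$ with a smooth Hermitian metric $G$ on $T_M$, and let $E$ be a holomorphic vector bundle of rank $r$ on $M$. A smooth Hermitian metric $H$ on $E$ has, in a holomorphic frame $(e_\alpha)$ and holomorphic coordinates $(z_j)$, the matrix $h=(h_{\alpha\bar\beta})$, $h_{\alpha\bar\beta}=H(e_\alpha,e_\beta)$, and the curvature coefficients $$R_{j\bar k\alpha\bar\beta}=-\frac{\partial^2h_{\alpha\bar\beta}}{\partial z_j\partial\bar z_k}+\sum_{\gamma,\delta}h^{\gamma\bar\delta}\,\frac{\partial h_{\alpha\bar\delta}}{\partial z_j}\,\frac{\partial h_{\gamma\bar\beta}}{\partial\bar z_k}.$$ **Strong nefness.** $E$ is *strong Griffiths nef* if there are smooth Hermitian metrics $H_\varepsilon$ ($\varepsilon>0$) on $E$ with $\Theta_{H_\varepsilon}(u\otimes v,u\otimes v)=\sum R_{j\bar k\alpha\bar\beta}u^j\bar u^kv^\alpha\bar v^\beta\ge-\varepsilon\|u\|_G^2\|v\|_{H_\varepsilon}^2$ for all $u\in T_M$, $v\in E$, such that (i) for some $p>r$ the norms $\|H_\varepsilon^{-1}\|_{L^p(M)}$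 are bounded uniformly in $\varepsilon$, and (ii) the $H_\varepsilon$ are equicontinuous and uniformly bounded in $\varepsilon$. *Strong Nakano nef* is defined in the same way, with $\Theta_{H_\varepsilon}(u,u)=\sum R_{j\bar k\alpha\bar\beta}u^{j\alpha}\overline{u^{k\beta}}\ge-\varepsilon\|u\|^2_{G\otimes H_\varepsilon}$ for all $u\in T_M\otimes E$, and with some $p>1$ in (i). Norms, bounds and equicontinuity refer to the matrix entries in holomorphic charts and frames, on compact subsets of their domains. **Singular metrics.** A *singular Hermitian metric* on $E$ is here a continuous field $H$ of positive semidefinite Hermitian forms that is nondegenerate almost everywhere and has a locally integrable inverse. It has the *curvature current* $\Theta_H=i\,d'\big((d''H^{-1})H\big)$ if the distributional derivatives $d''H^{-1}$ are of order zero (so that the product with $H$ is defined) and the resulting current $\Theta_H$ is of order zero. For smooth sections $u,v$ put $\Theta_H(u,v)=\langle\Theta_Hu,v\rangle_H=\sum R_{j\bar k\alpha\bar\beta}u^\alpha\bar v^\beta\,i\,dz_j\wedge d\bar z_k$, where $R_{j\bar k}=h\,\Theta_{j\bar k}$ has order-zero distributions as entries; for smooth $H$ these are the coefficients above. The current $\Theta_H$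 is *Griffiths pseudoeffective* (a positive Hermitian matrix current) if it is Hermitian and $\Theta_H(u,u)$ is a positive $(1,1)$-current for every compactly supported smooth local section $u$ of $E$. It is *Nakano pseudoeffective* if it is Hermitian and $\sum R_{j\bar k\alpha\bar\beta}v^{j\alpha}\overline{v^{k\beta}}$ is a positive distribution for every compactly supported smooth local section $v=\sum v^{j\alpha}\frac{\partial}{\partial z_j}\otimes e_\alpha$ of $T_M\otimes E$. **Proposition.** Let $E$ be strong Griffiths nef, with metrics $(H_\varepsilon)_{\varepsilon>0}$ as in the definition. 1. $E$ is Griffiths pseudoeffective: there are $\varepsilon_1>\varepsilon_2>\dots>0$ with $\varepsilon_m\to0$ and a singular Hermitian metric $H$ on $E$ with a curvature current $\Theta_H$ such that, locally, $H_{\varepsilon_m}\to H$ uniformly, $H_{\varepsilon_m}^{-1}\to H^{-1}$ weakly (tested against compactly supported continuous functions), $\Theta_{H_{\varepsilon_m}}\to\Theta_H$ in the weak-$*$ sense (for the coefficients $R_{j\bar k\alpha\bar\beta}$), and $\Theta_H$ is Griffiths pseudoeffective. 2. $E\otimes\det E$ is strong Nakano nef and Nakano pseudoeffective: there are smooth Hermitian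 metrics $(H'_\varepsilon)_{\varepsilon>0}$ on it as in the definition of strong Nakano nefness, a sequence $\varepsilon_m\downarrow0$, and a singular Hermitian metric $H'$ on $E\otimes\det E$ with a curvature current such that $H'_{\varepsilon_m}\to H'$ in the same sense as in 1 (convergence of the metrics, of their inverses and of their curvatures), and $\Theta_{H'}$ is Nakano pseudoeffective. -/

import Mathlib

open Bundle Set Filter Topology MeasureTheory TopologicalSpace
open scoped Manifold ContDiff Distributions ComplexConjugate ComplexOrder

noncomputable section

namespace NefBundle

/-! ## Wirtinger derivatives and distributions of order zero on open subsets of `ℂⁿ` -/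

/-- `∂f/∂z_j`. -/
def dz {n : ℕ} (j : Fin n) (f : (Fin n → ℂ) → ℂ) (z : Fin n → ℂ) : ℂ :=
  (1 / 2) * (fderiv ℝ f z (Pi.single j 1) - Complex.I * fderiv ℝ f z (Pi.single j Complex.I))

/-- `∂f/∂z̄_k`. -/
def dzbar {n : ℕ} (k : Fin n) (f : (Fin n → ℂ) → ℂ) (z : Fin n → ℂ) : ℂ :=
  (1 / 2) * (fderiv ℝ f z (Pi.single k 1) + Complex.I * fderiv ℝ f z (Pi.single k Complex.I))

/-- A (complex) distribution of order zero on `Ω`: a continuous linear functional on the space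
`C⁰_c(Ω, ℂ)` of compactly supported continuous functions with its usual (LF) topology. -/
abbrev ZeroOrderDistribution {n : ℕ} (Ω : Opens (Fin n → ℂ)) : Type :=
  𝓓^{0}(Ω, ℂ) →L[ℂ] ℂ

open Classical in
/-- A function, seen as a continuous test function on `Ω`. (The value `0` is used if `f` is not
continuous with compact support inside `Ω`; this never happens below.) -/
def toTest {n : ℕ} (Ω : Opens (Fin n → ℂ)) (f : (Fin n → ℂ) → ℂ) : 𝓓^{0}(Ω, ℂ) :=
  if h : Continuous f ∧ HasCompactSupport f ∧ tsupport f ⊆ (Ω : Set (Fin n → ℂ)) then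
    { toFun := f
      contDiff' := contDiff_zero.2 h.1
      hasCompactSupport' := h.2.1
      tsupport_subset' := h.2.2 }
  else 0

/-- The value of a distribution of order zero on a continuous compactly supported function. -/
def pair {n : ℕ} {Ω : Opens (Fin n → ℂ)} (T : ZeroOrderDistribution Ω)
    (f : (Fin n → ℂ) → ℂ) : ℂ :=
  T (toTest Ω f)

/-! ## Chern curvature in a holomorphic frame -/

/-- The Chern curvature coefficients, with lowered index, of a smooth Hermitian metric with matrix
`h = (h_{α β̄})` in a holomorphic frame:
`R_{j k̄ α β̄} = - ∂²h_{α β̄}/∂z_j∂z̄_k + ∑ h^{γ δ̄} (∂h_{α δ̄}/∂z_j) (∂h_{γ β̄}/∂z̄_k)`,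
as the matrix `R_{j k̄}` with entries indexed by `α, β`. -/
def curvature {n r : ℕ} (h : (Fin n → ℂ) → Matrix (Fin r) (Fin r) ℂ) (j k : Fin n)
    (z : Fin n → ℂ) : Matrix (Fin r) (Fin r) ℂ :=
  - Matrix.of (fun α β => dz j (dzbar k (fun w => h w α β)) z)
    + Matrix.of (fun α β => dz j (fun w => h w α β) z) * (h z)⁻¹
      * Matrix.of (fun α β => dzbar k (fun w => h w α β) z)

/-- The curvature current `Θ = i ∂((∂̄ h⁻¹) h)` on `Ω ⊆ ℂⁿ` of a metric with continuous matrix `h`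
and locally integrable inverse `h⁻¹`, all derivatives being taken in the sense of distributions.

`dbarInv k α β` is the distribution `∂(h⁻¹)_{α β}/∂z̄_k`. It is required to be of order zero,
so that its product with the continuous functions `h_{γ δ}` is defined.
`coeff j k α β` is the coefficient of `i dz_j ∧ dz̄_k` in `Θ_{α β}`, that is,
`∂/∂z_j (∑_γ (∂(h⁻¹)_{α γ}/∂z̄_k) h_{γ β})`; it is required to be of order zero as well.
Both families are determined by `h`. -/
structure LocalCurvature {n r : ℕ} (Ω : Opens (Fin n → ℂ))
    (h : (Fin n → ℂ) → Matrix (Fin r) (Fin r) ℂ) where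
  dbarInv : Fin n → Fin r → Fin r → ZeroOrderDistribution Ω
  dbarInv_eq : ∀ k α β (ψ : 𝓓(Ω, ℂ)),
    pair (dbarInv k α β) ψ = - ∫ z in (Ω : Set (Fin n → ℂ)), (h z)⁻¹ α β * dzbar k ψ z
  coeff : Fin n → Fin n → Fin r → Fin r → ZeroOrderDistribution Ω
  coeff_eq : ∀ j k α β (ψ : 𝓓(Ω, ℂ)),
    pair (coeff j k α β) ψ = - ∑ γ, pair (dbarInv k α γ) (fun z => h z γ β * dz j ψ z)

/-- The coefficients `R_{j k̄ α β̄} = ∑_γ h_{α γ} Θ_{j k, γ β}` of the Hermitian form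
`(u, v) ↦ Θ(u, v) = ⟨Θ u, v⟩_h` defined by the curvature current, as distributions of order zero:
`Θ(u, v) = ∑ R_{j k̄ α β̄} u^α v̄^β i dz_j ∧ dz̄_k`. When `h` is smooth and invertible these are
the functions `curvature h j k · α β`. -/
def LocalCurvature.lowered {n r : ℕ} {Ω : Opens (Fin n → ℂ)}
    {h : (Fin n → ℂ) → Matrix (Fin r) (Fin r) ℂ} (C : LocalCurvature Ω h)
    (j k : Fin n) (α β : Fin r) (f : (Fin n → ℂ) → ℂ) : ℂ :=
  ∑ γ, pair (C.coeff j k γ β) (fun z => h z α γ * f z)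

/-- Hermitian symmetry of the curvature current. -/
def LocalCurvature.IsHermitian {n r : ℕ} {Ω : Opens (Fin n → ℂ)}
    {h : (Fin n → ℂ) → Matrix (Fin r) (Fin r) ℂ} (C : LocalCurvature Ω h) : Prop :=
  ∀ j k α β (f : 𝓓^{0}(Ω, ℂ)),
    conj (C.lowered j k α β f) = C.lowered k j β α (fun z => conj (f z))

/-- For every compactly supported smooth section `u`, the `(1,1)`-current
`Θ(u, u) = ∑ T_{j k} i dz_j ∧ dz̄_k` is positive: `∑ T_{j k} λ_j λ̄_k` is a positive distribution
for all smooth `λ = (λ_1, …, λ_n)`. (Taking for `λ` the cofactors of `n - 1` smooth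
`(1,0)`-forms `α_1, …, α_{n-1}`, this distribution is, up to a positive constant, the top degree
current `Θ(u, u) ∧ i α_1 ∧ ᾱ_1 ∧ ⋯ ∧ i α_{n-1} ∧ ᾱ_{n-1}`.) -/
def LocalCurvature.GriffithsNonneg {n r : ℕ} {Ω : Opens (Fin n → ℂ)}
    {h : (Fin n → ℂ) → Matrix (Fin r) (Fin r) ℂ} (C : LocalCurvature Ω h) : Prop :=
  ∀ (u : Fin r → 𝓓(Ω, ℂ)) (lam : Fin n → (Fin n → ℂ) → ℂ), (∀ j, ContDiff ℝ ∞ (lam j)) →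
    ∀ χ : 𝓓(Ω, ℝ), (∀ z, 0 ≤ χ z) →
      0 ≤ ∑ j, ∑ k, ∑ α, ∑ β, C.lowered j k α β
        (fun z => (χ z : ℂ) * (lam j z * conj (lam k z)) * (u α z * conj (u β z)))

/-- For every compactly supported smooth section `v = ∑ v^{j α} ∂/∂z_j ⊗ e_α` of `T_M ⊗ E`,
`Θ(v, v) = ∑ R_{j k̄ α β̄} v^{j α} conj (v^{k β})` is a positive distribution. -/
def LocalCurvature.NakanoNonneg {n r : ℕ} {Ω : Opens (Fin n → ℂ)}
    {h : (Fin n → ℂ) → Matrix (Fin r) (Fin r) ℂ} (C : LocalCurvature Ω h) : Prop :=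
  ∀ (v : Fin n → Fin r → 𝓓(Ω, ℂ)) (χ : 𝓓(Ω, ℝ)), (∀ z, 0 ≤ χ z) →
    0 ≤ ∑ j, ∑ k, ∑ α, ∑ β, C.lowered j k α β
      (fun z => (χ z : ℂ) * (v j α z * conj (v k β z)))

/-! ## Hermitian metrics on vector bundles over complex manifolds -/

/-- A field of positive semidefinite Hermitian forms on the fibres of `E`
(linear in the first variable, conjugate linear in the second one). -/
structure HermitianField {M : Type*} (E : M → Type*) [∀ x, AddCommGroup (E x)]
    [∀ x, Module ℂ (E x)] where
  form : ∀ x, E x →ₗ[ℂ] E x →ₗ⋆[ℂ] ℂ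
  conj_symm : ∀ x v w, conj (form x v w) = form x w v
  nonneg : ∀ x v, 0 ≤ (form x v v).re

section Bundle

variable {n r : ℕ} {M : Type*} [TopologicalSpace M] [ChartedSpace (Fin n → ℂ) M]
  [IsManifold 𝓘(ℂ, Fin n → ℂ) ω M]
  {E : M → Type*} [∀ x, AddCommGroup (E x)] [∀ x, Module ℂ (E x)]
  [∀ x, TopologicalSpace (E x)] [TopologicalSpace (TotalSpace (Fin r → ℂ) E)]
  [FiberBundle (Fin r → ℂ) E]

variable (n r E) in
/-- A holomorphic chart of `M` together with a holomorphic trivialization of `E`. -/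
structure Patch where
  chart : OpenPartialHomeomorph M (Fin n → ℂ)
  chart_mem : chart ∈ IsManifold.maximalAtlas 𝓘(ℂ, Fin n → ℂ) ω M
  triv : Trivialization (Fin r → ℂ) (π (Fin r → ℂ) E)
  triv_mem : MemTrivializationAtlas triv

/-- The open subset of `ℂⁿ` that corresponds, in the coordinates of the chart, to the points of
`M` at which both the chart and the trivialization are defined. -/
def Patch.domain (P : Patch n r E) : Opens (Fin n → ℂ) :=
  ⟨P.chart.target ∩ P.chart.symm ⁻¹' P.triv.baseSet,
    P.chart.symm.isOpen_inter_preimage P.triv.open_baseSet⟩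

namespace HermitianField

/-- The matrix `h_{α β̄} = H(e_α, e_β)` in the frame `(e_α)` of the trivialization, as a
function of the coordinates. -/
def matrix (H : HermitianField E) (P : Patch n r E) (z : Fin n → ℂ) :
    Matrix (Fin r) (Fin r) ℂ :=
  Matrix.of fun α β => H.form (P.chart.symm z)
    (P.triv.symm (P.chart.symm z) (Pi.single α 1)) (P.triv.symm (P.chart.symm z) (Pi.single β 1))

variable (n r) in
/-- A smooth Hermitian metric: positive definite, with `C^∞` coefficients. -/
def IsSmoothMetric (H : HermitianField E) : Prop :=
  (∀ x (v : E x), v ≠ 0 → 0 < (H.form x v v).re) ∧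
    ∀ (P : Patch n r E) α β, ContDiffOn ℝ ∞ (fun z => H.matrix P z α β) P.domain

variable (n r) in
/-- A singular Hermitian metric with continuous coefficients that is nondegenerate almost
everywhere and has a locally integrable inverse. -/
def IsSingularMetric (H : HermitianField E) : Prop :=
  ∀ P : Patch n r E,
    (∀ α β, ContinuousOn (fun z => H.matrix P z α β) P.domain) ∧
    (∀ᵐ z ∂(volume.restrict (P.domain : Set (Fin n → ℂ))), (H.matrix P z).det ≠ 0) ∧
    ∀ α β, LocallyIntegrableOn (fun z => (H.matrix P z)⁻¹ α β) P.domain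

variable (n r) in
/-- The coefficients of `Hs m` converge locally uniformly to those of `H₀`, and the coefficients
of the inverses converge weakly (tested against compactly supported continuous functions). -/
def ConvergesTo (Hs : ℕ → HermitianField E) (H₀ : HermitianField E) : Prop :=
  ∀ (P : Patch n r E) α β,
    TendstoLocallyUniformlyOn (fun m z => (Hs m).matrix P z α β) (fun z => H₀.matrix P z α β)
      atTop P.domain ∧
    ∀ ψ : 𝓓^{0}(P.domain, ℂ),
      Tendsto (fun m => ∫ z in (P.domain : Set (Fin n → ℂ)), ((Hs m).matrix P z)⁻¹ α β * ψ z)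
        atTop (𝓝 (∫ z in (P.domain : Set (Fin n → ℂ)), (H₀.matrix P z)⁻¹ α β * ψ z))

end HermitianField

variable (n r) in
/-- The curvature current `Θ_H = i ∂((∂̄ H⁻¹) H)` of a singular metric on `E`, given by its
(uniquely determined) expressions in all the holomorphic charts and frames. -/
structure CurvatureCurrent (H : HermitianField E) where
  loc : ∀ P : Patch n r E, LocalCurvature P.domain (H.matrix P)

namespace CurvatureCurrent

variable {H : HermitianField E}

/-- The curvature current is a positive Hermitian matrix current. -/
def IsGriffithsPseudoeffective (Θ : CurvatureCurrent n r H) : Prop :=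
  ∀ P, (Θ.loc P).IsHermitian ∧ (Θ.loc P).GriffithsNonneg

/-- The curvature current is Hermitian, and positive on sections of `T_M ⊗ E`. -/
def IsNakanoPseudoeffective (Θ : CurvatureCurrent n r H) : Prop :=
  ∀ P, (Θ.loc P).IsHermitian ∧ (Θ.loc P).NakanoNonneg

/-- The curvature forms of the smooth metrics `Hs m` converge to `Θ` in the weak-* sense. -/
def IsWeakLimit (Θ : CurvatureCurrent n r H) (Hs : ℕ → HermitianField E) : Prop :=
  ∀ (P : Patch n r E) j k α β (ψ : 𝓓(P.domain, ℂ)),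
    Tendsto (fun m => ∫ z in (P.domain : Set (Fin n → ℂ)),
      curvature ((Hs m).matrix P) j k z α β * ψ z) atTop
      (𝓝 ((Θ.loc P).lowered j k α β ψ))

end CurvatureCurrent

/-! ## Nefness -/

/-- The coefficients `g_{j k̄} = G(∂/∂z_j, ∂/∂z_k)` of a Hermitian metric on the (holomorphic)
tangent bundle in a holomorphic chart. -/
def tangentMatrix (G : HermitianField (fun x : M => TangentSpace 𝓘(ℂ, Fin n → ℂ) x))
    (φ : OpenPartialHomeomorph M (Fin n → ℂ)) (z : Fin n → ℂ) : Matrix (Fin n) (Fin n) ℂ :=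
  Matrix.of fun j k => G.form (φ.symm z)
    (mfderiv 𝓘(ℂ, Fin n → ℂ) 𝓘(ℂ, Fin n → ℂ) φ.symm z (Pi.single j (1 : ℂ) : Fin n → ℂ))
    (mfderiv 𝓘(ℂ, Fin n → ℂ) 𝓘(ℂ, Fin n → ℂ) φ.symm z (Pi.single k (1 : ℂ) : Fin n → ℂ))

/-- `Θ_H(u ⊗ v, u ⊗ v) ≥ -ε ‖u‖²_G ‖v‖²_H` for all `u ∈ T_M` and `v ∈ E`. -/
def GriffithsBound (G : HermitianField (fun x : M => TangentSpace 𝓘(ℂ, Fin n → ℂ) x))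
    (H : HermitianField E) (ε : ℝ) : Prop :=
  ∀ P : Patch n r E, ∀ z ∈ P.domain, ∀ (u : Fin n → ℂ) (v : Fin r → ℂ),
    -ε * (∑ j, ∑ k, tangentMatrix G P.chart z j k * (u j * conj (u k))).re
        * (∑ α, ∑ β, H.matrix P z α β * (v α * conj (v β))).re ≤
      (∑ j, ∑ k, ∑ α, ∑ β, curvature (H.matrix P) j k z α β
        * (u j * conj (u k)) * (v α * conj (v β))).re

/-- `Θ_H(u, u) ≥ -ε ‖u‖²_{G ⊗ H}` for all `u ∈ T_M ⊗ E`. -/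
def NakanoBound (G : HermitianField (fun x : M => TangentSpace 𝓘(ℂ, Fin n → ℂ) x))
    (H : HermitianField E) (ε : ℝ) : Prop :=
  ∀ P : Patch n r E, ∀ z ∈ P.domain, ∀ u : Fin n → Fin r → ℂ,
    -ε * (∑ j, ∑ k, ∑ α, ∑ β, tangentMatrix G P.chart z j k * H.matrix P z α β
        * (u j α * conj (u k β))).re ≤
      (∑ j, ∑ k, ∑ α, ∑ β, curvature (H.matrix P) j k z α β * (u j α * conj (u k β))).re

variable (n r) in
/-- `‖H_ε⁻¹‖_{L^p}` is bounded uniformly in `ε > 0` (in terms of the coefficients of `H_ε⁻¹`,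
over the compact subsets of every chart). -/
def InverseBoundedInLp (H : ℝ → HermitianField E) (p : ℝ) : Prop :=
  ∀ (P : Patch n r E) (K : Set (Fin n → ℂ)), IsCompact K → K ⊆ P.domain →
    ∃ C : NNReal, ∀ ε > 0, ∀ α β,
      eLpNorm (fun z => ((H ε).matrix P z)⁻¹ α β) (ENNReal.ofReal p) (volume.restrict K) ≤ C

variable (n r) in
/-- The `H_ε`, `ε > 0`, are equicontinuous and uniformly bounded (in terms of their coefficients,
the bound being over the compact subsets of every chart). -/
def EquicontinuousAndBounded (H : ℝ → HermitianField E) : Prop :=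
  ∀ P : Patch n r E,
    (∀ α β, EquicontinuousOn (fun (ε : Ioi (0 : ℝ)) z => (H ε).matrix P z α β) P.domain) ∧
    ∀ K : Set (Fin n → ℂ), IsCompact K → K ⊆ P.domain →
      ∃ C : ℝ, ∀ ε > 0, ∀ z ∈ K, ∀ α β, ‖(H ε).matrix P z α β‖ ≤ C

/-- The family `(H_ε)_{ε > 0}` of smooth metrics makes `E` a strong Griffiths nef bundle. -/
def IsStrongGriffithsNefFamily
    (G : HermitianField (fun x : M => TangentSpace 𝓘(ℂ, Fin n → ℂ) x))
    (H : ℝ → HermitianField E) : Prop :=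
  (∀ ε > 0, (H ε).IsSmoothMetric n r ∧ GriffithsBound (r := r) G (H ε) ε) ∧
    (∃ p : ℝ, (r : ℝ) < p ∧ InverseBoundedInLp n r H p) ∧
    EquicontinuousAndBounded n r H

/-- The family `(H_ε)_{ε > 0}` of smooth metrics makes `E` a strong Nakano nef bundle. -/
def IsStrongNakanoNefFamily
    (G : HermitianField (fun x : M => TangentSpace 𝓘(ℂ, Fin n → ℂ) x))
    (H : ℝ → HermitianField E) : Prop :=
  (∀ ε > 0, (H ε).IsSmoothMetric n r ∧ NakanoBound (r := r) G (H ε) ε) ∧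
    (∃ p : ℝ, 1 < p ∧ InverseBoundedInLp n r H p) ∧
    EquicontinuousAndBounded n r H

end Bundle

/-! ## The bundle `E ⊗ det E` -/

theorem contDiff_det {r : ℕ} :
    ContDiff ℂ ω (fun f : (Fin r → ℂ) →L[ℂ] (Fin r → ℂ) => f.det) := by
  have h : (fun f : (Fin r → ℂ) →L[ℂ] (Fin r → ℂ) => f.det) =
      fun f => ∑ σ : Equiv.Perm (Fin r), Equiv.Perm.sign σ • ∏ i, f (Pi.single i 1) (σ i) := by
    funext f
    rw [ContinuousLinearMap.det, ← LinearMap.det_toMatrix', Matrix.det_apply]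
    simp [LinearMap.toMatrix'_apply]
  rw [h]
  refine ContDiff.sum fun σ _ => ?_
  have : ContDiff ℂ ω (fun f : (Fin r → ℂ) →L[ℂ] (Fin r → ℂ) =>
      ∏ i, f (Pi.single i 1) (σ i)) := by
    fun_prop
  exact this.const_smul _

section Twist

variable {r : ℕ} {M : Type*} [TopologicalSpace M]
  (E : M → Type*) [∀ x, AddCommGroup (E x)] [∀ x, Module ℂ (E x)]
  [∀ x, TopologicalSpace (E x)] [TopologicalSpace (TotalSpace (Fin r → ℂ) E)]
  [FiberBundle (Fin r → ℂ) E] [VectorBundle ℂ (Fin r → ℂ) E]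

/-- The transition functions `det(g_{ij}) g_{ij}` of `E ⊗ det E`, where `g_{ij}` are those of
`E`. -/
def tensorDetCore :
    VectorBundleCore ℂ M (Fin r → ℂ) (trivializationAtlas (Fin r → ℂ) E) where
  baseSet i := i.1.baseSet
  isOpen_baseSet i := i.1.open_baseSet
  indexAt x := ⟨trivializationAt (Fin r → ℂ) E x, trivialization_mem_atlas _ E x⟩
  mem_baseSet_at x := mem_baseSet_trivializationAt _ E x
  coordChange i j x :=
    haveI : MemTrivializationAtlas i.1 := ⟨i.2⟩
    haveI : MemTrivializationAtlas j.1 := ⟨j.2⟩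
    (i.1.coordChangeL ℂ j.1 x : (Fin r → ℂ) →L[ℂ] (Fin r → ℂ)).det •
      (i.1.coordChangeL ℂ j.1 x : (Fin r → ℂ) →L[ℂ] (Fin r → ℂ))
  coordChange_self i x hx v := by
    have : MemTrivializationAtlas i.1 := ⟨i.2⟩
    have h : (i.1.coordChangeL ℂ i.1 x : (Fin r → ℂ) →L[ℂ] (Fin r → ℂ)) =
        ContinuousLinearMap.id ℂ (Fin r → ℂ) := by
      ext1 w
      have := i.1.coordChangeL_apply (R := ℂ) i.1 ⟨hx, hx⟩ w
      simpa [i.1.apply_mk_symm hx] using this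
    rw [h]
    simp [ContinuousLinearMap.det]
  continuousOn_coordChange i j := by
    have : MemTrivializationAtlas i.1 := ⟨i.2⟩
    have : MemTrivializationAtlas j.1 := ⟨j.2⟩
    have h := continuousOn_coordChange ℂ i.1 j.1
    exact (ContinuousLinearMap.continuous_det.comp_continuousOn h).smul h
  coordChange_comp i j k x hx v := by
    have : MemTrivializationAtlas i.1 := ⟨i.2⟩
    have : MemTrivializationAtlas j.1 := ⟨j.2⟩
    have : MemTrivializationAtlas k.1 := ⟨k.2⟩
    have h : (i.1.coordChangeL ℂ k.1 x : (Fin r → ℂ) →L[ℂ] (Fin r → ℂ)) =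
        (j.1.coordChangeL ℂ k.1 x : (Fin r → ℂ) →L[ℂ] (Fin r → ℂ)).comp
          (i.1.coordChangeL ℂ j.1 x : (Fin r → ℂ) →L[ℂ] (Fin r → ℂ)) := by
      ext1 w
      have h1 := i.1.coordChangeL_apply (R := ℂ) k.1 ⟨hx.1.1, hx.2⟩ w
      have h2 := i.1.coordChangeL_apply (R := ℂ) j.1 ⟨hx.1.1, hx.1.2⟩ w
      have h3 := j.1.coordChangeL_apply (R := ℂ) k.1 ⟨hx.1.2, hx.2⟩
        (i.1.coordChangeL ℂ j.1 x w)
      rw [h2, j.1.symm_apply_apply_mk hx.1.2] at h3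
      simpa [h2, h1] using h3.symm
    rw [h]
    simp only [ContinuousLinearMap.det, smul_apply, map_smul, smul_smul,
      ContinuousLinearMap.comp_apply]
    exact congrArg (fun c : ℂ => c • _)
      ((mul_comm _ _).trans (LinearMap.det_comp _ _).symm)

/-- `E ⊗ det E` is a holomorphic vector bundle. -/
instance {n : ℕ} [ChartedSpace (Fin n → ℂ) M]
    [ContMDiffVectorBundle ω (Fin r → ℂ) E 𝓘(ℂ, Fin n → ℂ)] :
    (tensorDetCore (r := r) E).IsContMDiff 𝓘(ℂ, Fin n → ℂ) ω where
  contMDiffOn_coordChange i j := by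
    have : MemTrivializationAtlas i.1 := ⟨i.2⟩
    have : MemTrivializationAtlas j.1 := ⟨j.2⟩
    have h := contMDiffOn_coordChangeL (IB := 𝓘(ℂ, Fin n → ℂ)) (n := ω) i.1 j.1
    exact (contDiff_det.contMDiff.comp_contMDiffOn h).smul h

/-- The fibres of the holomorphic vector bundle `E ⊗ det E`. -/
abbrev TensorDet : M → Type := (tensorDetCore (r := r) E).Fiber

end Twist

end NefBundle

end

noncomputable section

namespace NefBundle

/-! ## Wirtinger calculus for functions and matrices of functions -/

/-! In a chart and a frame, let h be the matrix of a metric. The argument is governed by the scalar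
function tr h⁻¹. Differentiating h⁻¹ twice gives ∂_j ∂̄_k h⁻¹ = h⁻¹ R_{jk̄} h⁻¹ + (∂̄_k h⁻¹) h (∂_j
h⁻¹), and the second term is a square once traced. Hence tr h⁻¹ is plurisubharmonic when the
curvature is Griffiths semipositive. A defect of size ε in the positivity is repaired locally by
adding a δ_{jk} h to R_{jk̄} with a = O(ε). Up to a positive factor, this is the effect of
multiplying h by exp(-a|z - p|²).

Two estimates follow. First, the sub-mean value inequality on polydiscs bounds tr h⁻¹ pointwise by
its integral, which the L^p bound controls. So the inverses are locally uniformly bounded, the limit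
metric is nondegenerate at every point, and the inverses converge locally uniformly
(`IsStrongGriffithsNefFamily.exists_norm_inv_le`, `IsNefSequence.tendsto_inv`). Second, integrating
∂_j ∂̄_j tr h⁻¹ + a tr h⁻¹ against a cutoff moves the derivatives to the cutoff and gives a uniform
bound. The integrand is a sum of two nonnegative terms. With the bounds on h and h⁻¹, one of them
controls h⁻¹ R and the other controls ∂̄ h⁻¹, so both are bounded in L¹_loc
(`IsNefSequence.exists_setIntegral_norm_le`).

Ascoli's theorem provides a subsequence along which the metrics converge locally uniformly. The
L¹_loc bounds make the distributional limits of ∂̄ h⁻¹ and of h⁻¹ R = ∂((∂̄ h⁻¹) h) have order zero,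
and products of weakly convergent densities with locally uniformly convergent functions pass to the
limit (`IsNefSequence.exists_localCurvature`). Hermitian symmetry and positivity survive because the
shift tends to zero.

On E ⊗ det E the metric det h · h has curvature det h · (R + tr(h⁻¹ R) h). By the Demailly-Skoda
argument, an average over vectors of fourth roots of unity, a Griffiths semipositive R makes this
Nakano semipositive (`GriffithsSemipos.nakano`). The defect ε becomes (r + 1) ε, so the family is
reparametrized. The twisted metrics inherit all the bounds, and the same limit argument applies to
them. -/

/-- The Wirtinger derivative `∂/∂x_j + c ∂/∂y_j`, up to the factor `1 / 2`. -/
def wirt {n : ℕ} (c : ℂ) (j : Fin n) (f : (Fin n → ℂ) → ℂ) (z : Fin n → ℂ) : ℂ :=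
  (1 / 2) * (fderiv ℝ f z (Pi.single j 1) + c * fderiv ℝ f z (Pi.single j Complex.I))

theorem fderiv_fderiv_apply {E F : Type*} [NormedAddCommGroup E] [NormedSpace ℝ E]
    [NormedAddCommGroup F] [NormedSpace ℝ F] {f : E → F} {z : E} (hf : ContDiffAt ℝ ∞ f z)
    (v w : E) : fderiv ℝ (fun y => fderiv ℝ f y v) z w = fderiv ℝ (fderiv ℝ f) z w v := by
  have h : DifferentiableAt ℝ (fderiv ℝ f) z :=
    (hf.fderiv_right (m := ∞) (by simp)).differentiableAt (by simp)
  rw [fderiv_clm_apply h (differentiableAt_const v)]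
  simp

section Wirt

variable {n : ℕ} {c : ℂ} {j k : Fin n} {f g : (Fin n → ℂ) → ℂ} {z : Fin n → ℂ}

/-- The parameter c puts ∂ (c = -i) and ∂̄ (c = i) under a single calculus, so that the product,
conjugation and commutation rules are proved once. -/
theorem dz_eq_wirt (j : Fin n) : dz j = wirt (-Complex.I) j := by
  funext f z
  simp only [dz, wirt]
  ring

theorem dzbar_eq_wirt (j : Fin n) : dzbar j = wirt Complex.I j := rfl

theorem wirt_congr (h : f =ᶠ[𝓝 z] g) : wirt c j f z = wirt c j g z := by
  simp only [wirt, h.fderiv_eq]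

theorem wirt_const (a : ℂ) : wirt c j (fun _ => a) z = 0 := by
  simp [wirt]

theorem wirt_add (hf : DifferentiableAt ℝ f z) (hg : DifferentiableAt ℝ g z) :
    wirt c j (fun w => f w + g w) z = wirt c j f z + wirt c j g z := by
  simp only [wirt, fderiv_fun_add hf hg, _root_.add_apply]
  ring

theorem wirt_neg : wirt c j (fun w => - f w) z = - wirt c j f z := by
  simp only [wirt, fderiv_fun_neg, _root_.neg_apply]
  ring

theorem wirt_mul (hf : DifferentiableAt ℝ f z) (hg : DifferentiableAt ℝ g z) :
    wirt c j (fun w => f w * g w) z = wirt c j f z * g z + f z * wirt c j g z := by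
  simp only [wirt, fderiv_fun_mul hf hg, _root_.add_apply,
    _root_.smul_apply, smul_eq_mul]
  ring

theorem wirt_sum {ι : Type*} (s : Finset ι) {F : ι → (Fin n → ℂ) → ℂ}
    (hF : ∀ i ∈ s, DifferentiableAt ℝ (F i) z) :
    wirt c j (fun w => ∑ i ∈ s, F i w) z = ∑ i ∈ s, wirt c j (F i) z := by
  simp only [wirt, fderiv_fun_sum hF, _root_.sum_apply, Finset.mul_sum,
    ← Finset.sum_add_distrib]

theorem fderiv_conj_apply (v : Fin n → ℂ) :
    fderiv ℝ (fun w => conj (f w)) z v = conj (fderiv ℝ f z v) := by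
  have := Complex.conjCLE.comp_fderiv (f := f) (x := z)
  exact DFunLike.congr_fun this v

theorem wirt_conj : wirt c j (fun w => conj (f w)) z = conj (wirt (conj c) j f z) := by
  simp only [wirt, fderiv_conj_apply, map_mul, map_add, Complex.conj_conj, map_div₀, map_one,
    map_ofNat]

theorem contDiffOn_wirt {Ω : Set (Fin n → ℂ)} (hΩ : IsOpen Ω) (hf : ContDiffOn ℝ ∞ f Ω) :
    ContDiffOn ℝ ∞ (wirt c j f) Ω := by
  have h : ContDiffOn ℝ ∞ (fderiv ℝ f) Ω := hf.fderiv_of_isOpen hΩ (by simp)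
  exact contDiffOn_const.mul ((h.clm_apply contDiffOn_const).add
    (contDiffOn_const.mul (h.clm_apply contDiffOn_const)))

theorem contDiff_wirt (hf : ContDiff ℝ ∞ f) : ContDiff ℝ ∞ (wirt c j f) :=
  contDiffOn_univ.1 (contDiffOn_wirt isOpen_univ hf.contDiffOn)

theorem wirt_of_notMem_tsupport (hz : z ∉ tsupport f) : wirt c j f z = 0 := by
  rw [wirt_congr (notMem_tsupport_iff_eventuallyEq.1 hz)]
  exact wirt_const 0

theorem tsupport_wirt_subset : tsupport (wirt c j f) ⊆ tsupport f :=
  closure_minimal (fun z hz => by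
    by_contra h
    exact hz (wirt_of_notMem_tsupport h)) (isClosed_tsupport f)

theorem fderiv_wirt (hf : ContDiffAt ℝ ∞ f z) (v : Fin n → ℂ) :
    fderiv ℝ (wirt c j f) z v = (1 / 2) * (fderiv ℝ (fderiv ℝ f) z v (Pi.single j 1)
      + c * fderiv ℝ (fderiv ℝ f) z v (Pi.single j Complex.I)) := by
  have h : DifferentiableAt ℝ (fderiv ℝ f) z :=
    (hf.fderiv_right (m := ∞) (by simp)).differentiableAt (by simp)
  have h1 (v : Fin n → ℂ) : DifferentiableAt ℝ (fun y => fderiv ℝ f y v) z :=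
    h.clm_apply (differentiableAt_const v)
  have : wirt c j f = fun y => (1 / 2 : ℂ) * (fderiv ℝ f y (Pi.single j 1)
    + c * fderiv ℝ f y (Pi.single j Complex.I)) := rfl
  rw [this, fderiv_const_mul ((h1 _).fun_add ((h1 _).const_mul c)), _root_.smul_apply,
    fderiv_fun_add (h1 _) ((h1 _).const_mul c), _root_.add_apply,
    fderiv_const_mul (h1 _), _root_.smul_apply, fderiv_fderiv_apply hf,
    fderiv_fderiv_apply hf]
  rfl

theorem fderiv_fderiv_symm (hf : ContDiffAt ℝ ∞ f z) (v w : Fin n → ℂ) :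
    fderiv ℝ (fderiv ℝ f) z v w = fderiv ℝ (fderiv ℝ f) z w v :=
  (hf.isSymmSndFDerivAt (by
    simpa using (WithTop.coe_le_coe.2 le_top :
      ((2 : ℕ∞) : WithTop ℕ∞) ≤ ((⊤ : ℕ∞) : WithTop ℕ∞)))).eq v w

theorem wirt_wirt (hf : ContDiffAt ℝ ∞ f z) (c' : ℂ) :
    wirt c' k (wirt c j f) z = (1 / 4) *
      (fderiv ℝ (fderiv ℝ f) z (Pi.single k 1) (Pi.single j 1)
      + c * fderiv ℝ (fderiv ℝ f) z (Pi.single k 1) (Pi.single j Complex.I)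
      + c' * fderiv ℝ (fderiv ℝ f) z (Pi.single k Complex.I) (Pi.single j 1)
      + c' * c * fderiv ℝ (fderiv ℝ f) z (Pi.single k Complex.I) (Pi.single j Complex.I)) := by
  rw [wirt, fderiv_wirt hf, fderiv_wirt hf]
  ring

theorem wirt_comm (hf : ContDiffAt ℝ ∞ f z) (c' : ℂ) :
    wirt c' k (wirt c j f) z = wirt c j (wirt c' k f) z := by
  rw [wirt_wirt hf, wirt_wirt hf, fderiv_fderiv_symm hf (Pi.single k 1) (Pi.single j 1),
    fderiv_fderiv_symm hf (Pi.single k 1) (Pi.single j Complex.I),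
    fderiv_fderiv_symm hf (Pi.single k Complex.I) (Pi.single j 1),
    fderiv_fderiv_symm hf (Pi.single k Complex.I) (Pi.single j Complex.I)]
  ring

end Wirt

/-- A matrix of functions whose entries are smooth on a set. -/
def SmoothMatrixOn {n r s : ℕ} (Ω : Set (Fin n → ℂ))
    (A : (Fin n → ℂ) → Matrix (Fin r) (Fin s) ℂ) : Prop :=
  ∀ α β, ContDiffOn ℝ ∞ (fun z => A z α β) Ω

/-- The entrywise Wirtinger derivative. -/
def mwirt {n r s : ℕ} (c : ℂ) (j : Fin n) (A : (Fin n → ℂ) → Matrix (Fin r) (Fin s) ℂ)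
    (z : Fin n → ℂ) : Matrix (Fin r) (Fin s) ℂ :=
  Matrix.of fun α β => wirt c j (fun w => A w α β) z

section MatrixWirt

variable {n r s t : ℕ} {Ω : Set (Fin n → ℂ)} {c : ℂ} {j k : Fin n} {z : Fin n → ℂ}
  {A : (Fin n → ℂ) → Matrix (Fin r) (Fin s) ℂ} {B : (Fin n → ℂ) → Matrix (Fin s) (Fin t) ℂ}
  {h : (Fin n → ℂ) → Matrix (Fin r) (Fin r) ℂ}

theorem SmoothMatrixOn.differentiableAt (hA : SmoothMatrixOn Ω A) (hΩ : IsOpen Ω) (hz : z ∈ Ω)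
    (α β) : DifferentiableAt ℝ (fun w => A w α β) z :=
  ((hA α β).contDiffAt (hΩ.mem_nhds hz)).differentiableAt (by simp)

theorem SmoothMatrixOn.mul (hA : SmoothMatrixOn Ω A) (hB : SmoothMatrixOn Ω B) :
    SmoothMatrixOn Ω (fun z => A z * B z) := fun α β => by
  simp only [Matrix.mul_apply]
  exact ContDiffOn.sum fun γ _ => (hA α γ).mul (hB γ β)

theorem SmoothMatrixOn.mwirt (hA : SmoothMatrixOn Ω A) (hΩ : IsOpen Ω) :
    SmoothMatrixOn Ω (mwirt c j A) := fun α β => contDiffOn_wirt hΩ (hA α β)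

theorem SmoothMatrixOn.trace (hA : SmoothMatrixOn Ω h) :
    ContDiffOn ℝ ∞ (fun z => (h z).trace) Ω := by
  simp only [Matrix.trace, Matrix.diag]
  exact ContDiffOn.sum fun γ _ => hA γ γ

theorem SmoothMatrixOn.det (hA : SmoothMatrixOn Ω h) :
    ContDiffOn ℝ ∞ (fun z => (h z).det) Ω := by
  simp only [Matrix.det_apply']
  exact ContDiffOn.sum fun σ _ => contDiffOn_const.mul (contDiffOn_prod fun i _ => hA _ _)

theorem SmoothMatrixOn.smul {f : (Fin n → ℂ) → ℂ} (hf : ContDiffOn ℝ ∞ f Ω)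
    (hA : SmoothMatrixOn Ω A) : SmoothMatrixOn Ω (fun z => f z • A z) :=
  fun α β => hf.mul (hA α β)

/-- Cramer's rule: the entries of the adjugate are determinants of matrices with one row replaced by
a constant vector. -/
theorem SmoothMatrixOn.inv (hA : SmoothMatrixOn Ω h) (hdet : ∀ z ∈ Ω, (h z).det ≠ 0) :
    SmoothMatrixOn Ω (fun z => (h z)⁻¹) := by
  have h1 : ContDiffOn ℝ ∞ (fun z => ((h z).det)⁻¹) Ω := hA.det.inv hdet
  have h2 : SmoothMatrixOn Ω (fun z => (h z).adjugate) := fun α β => by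
    simp only [Matrix.adjugate_apply]
    refine SmoothMatrixOn.det (h := fun z => (h z).updateRow β (Pi.single α 1)) fun γ δ => ?_
    by_cases hγ : γ = β
    · subst hγ
      simp only [Matrix.updateRow_self]
      exact contDiffOn_const
    · simp only [Matrix.updateRow_ne hγ]
      exact hA γ δ
  simp only [Matrix.inv_def, Ring.inverse_eq_inv']
  exact h2.smul h1

theorem mwirt_congr {A' : (Fin n → ℂ) → Matrix (Fin r) (Fin s) ℂ} (h : A =ᶠ[𝓝 z] A') :
    mwirt c j A z = mwirt c j A' z := by
  ext α β
  exact wirt_congr (h.mono fun w hw => by simp only [hw])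

theorem mwirt_mul (hΩ : IsOpen Ω) (hz : z ∈ Ω) (hA : SmoothMatrixOn Ω A)
    (hB : SmoothMatrixOn Ω B) :
    mwirt c j (fun w => A w * B w) z = mwirt c j A z * B z + A z * mwirt c j B z := by
  ext α β
  simp only [mwirt, Matrix.mul_apply, Matrix.of_apply, Matrix.add_apply]
  rw [wirt_sum _ fun γ _ => (hA.differentiableAt hΩ hz α γ).fun_mul (hB.differentiableAt hΩ hz γ β),
    ← Finset.sum_add_distrib]
  exact Finset.sum_congr rfl fun γ _ =>
    wirt_mul (hA.differentiableAt hΩ hz α γ) (hB.differentiableAt hΩ hz γ β)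

theorem mwirt_neg : mwirt c j (fun w => - A w) z = - mwirt c j A z := by
  ext α β
  exact wirt_neg

theorem mwirt_smul {f : (Fin n → ℂ) → ℂ} (hΩ : IsOpen Ω) (hz : z ∈ Ω) (hf : ContDiffOn ℝ ∞ f Ω)
    (hA : SmoothMatrixOn Ω A) :
    mwirt c j (fun w => f w • A w) z = wirt c j f z • A z + f z • mwirt c j A z := by
  ext α β
  exact wirt_mul ((hf.contDiffAt (hΩ.mem_nhds hz)).differentiableAt (by simp))
    (hA.differentiableAt hΩ hz α β)

theorem wirt_trace (hΩ : IsOpen Ω) (hz : z ∈ Ω) (hA : SmoothMatrixOn Ω h) :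
    wirt c j (fun w => (h w).trace) z = (mwirt c j h z).trace := by
  simp only [Matrix.trace, Matrix.diag, mwirt, Matrix.of_apply]
  exact wirt_sum _ fun γ _ => hA.differentiableAt hΩ hz γ γ

/-- Differentiate h⁻¹ h = 1 and solve for the derivative of h⁻¹. -/
theorem mwirt_inv (hΩ : IsOpen Ω) (hz : z ∈ Ω) (hA : SmoothMatrixOn Ω h)
    (hdet : ∀ z ∈ Ω, (h z).det ≠ 0) :
    mwirt c j (fun w => (h w)⁻¹) z = - ((h z)⁻¹ * mwirt c j h z * (h z)⁻¹) := by
  have hu (w) (hw : w ∈ Ω) : IsUnit (h w).det := (hdet w hw).isUnit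
  have h0 : mwirt c j (fun w => (h w)⁻¹ * h w) z = 0 := by
    rw [mwirt_congr (A' := fun _ => 1)]
    · ext α β
      exact wirt_const _
    · filter_upwards [hΩ.mem_nhds hz] with w hw
      exact Matrix.nonsing_inv_mul _ (hu w hw)
  rw [mwirt_mul hΩ hz (hA.inv hdet) hA] at h0
  have h1 := congrArg (fun X => X * (h z)⁻¹) (eq_neg_of_add_eq_zero_left h0)
  simpa [Matrix.mul_assoc, Matrix.mul_nonsing_inv _ (hu z hz)] using h1

end MatrixWirt


/-! ## Curvature identities -/

section CurvatureIdentities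

variable {n r s : ℕ} {Ω : Set (Fin n → ℂ)} {c : ℂ} {j k : Fin n} {z : Fin n → ℂ}
  {A : (Fin n → ℂ) → Matrix (Fin r) (Fin s) ℂ}
  {h : (Fin n → ℂ) → Matrix (Fin r) (Fin r) ℂ}

theorem curvature_eq : curvature h j k z = - mwirt (-Complex.I) j (mwirt Complex.I k h) z +
    mwirt (-Complex.I) j h z * (h z)⁻¹ * mwirt Complex.I k h z := by
  rw [curvature, dz_eq_wirt, dzbar_eq_wirt]
  rfl

theorem smoothMatrixOn_curvature (hΩ : IsOpen Ω) (hA : SmoothMatrixOn Ω h)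
    (hdet : ∀ z ∈ Ω, (h z).det ≠ 0) (j k : Fin n) :
    SmoothMatrixOn Ω (curvature h j k) := by
  have h1 : curvature h j k = fun z => - mwirt (-Complex.I) j (mwirt Complex.I k h) z +
    mwirt (-Complex.I) j h z * (h z)⁻¹ * mwirt Complex.I k h z := funext fun z => curvature_eq
  rw [h1]
  intro α β
  exact (((hA.mwirt hΩ).mwirt hΩ) α β).neg.add
    ((((hA.mwirt hΩ).mul (hA.inv hdet)).mul (hA.mwirt hΩ)) α β)

/-- `∂_j ∂̄_k h⁻¹ = h⁻¹ R_{jk} h⁻¹ + (∂̄_k h⁻¹) h (∂_j h⁻¹)`. -/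
theorem mwirt_mwirt_inv (hΩ : IsOpen Ω) (hz : z ∈ Ω) (hA : SmoothMatrixOn Ω h)
    (hdet : ∀ z ∈ Ω, (h z).det ≠ 0) :
    mwirt (-Complex.I) j (mwirt Complex.I k (fun w => (h w)⁻¹)) z =
      (h z)⁻¹ * curvature h j k z * (h z)⁻¹ +
      mwirt Complex.I k (fun w => (h w)⁻¹) z * h z * mwirt (-Complex.I) j (fun w => (h w)⁻¹) z := by
  have hu : IsUnit (h z).det := (hdet z hz).isUnit
  have h1 : mwirt Complex.I k (fun w => (h w)⁻¹) =ᶠ[𝓝 z]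
      fun w => - ((h w)⁻¹ * mwirt Complex.I k h w * (h w)⁻¹) := by
    filter_upwards [hΩ.mem_nhds hz] with w hw
    exact mwirt_inv hΩ hw hA hdet
  rw [mwirt_congr h1, mwirt_neg, mwirt_mul hΩ hz ((hA.inv hdet).mul (hA.mwirt hΩ)) (hA.inv hdet),
    mwirt_mul hΩ hz (hA.inv hdet) (hA.mwirt hΩ), mwirt_inv hΩ hz hA hdet,
    mwirt_inv hΩ hz hA hdet, curvature_eq]
  generalize mwirt (-Complex.I) j (mwirt Complex.I k h) z = X
  generalize mwirt (-Complex.I) j h z = Y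
  generalize mwirt Complex.I k h z = Z
  have e1 : (h z)⁻¹ * Z * (h z)⁻¹ * h z * ((h z)⁻¹ * Y * (h z)⁻¹) =
      (h z)⁻¹ * Z * (h z)⁻¹ * Y * (h z)⁻¹ := by
    simp only [Matrix.mul_assoc]
    rw [Matrix.mul_nonsing_inv_cancel_left _ _ hu]
  simp only [neg_mul, mul_neg, neg_neg]
  rw [e1]
  noncomm_ring

/-- `∂_j ((∂̄_k h⁻¹) h) = h⁻¹ R_{jk}`. -/
theorem mwirt_mwirt_inv_mul (hΩ : IsOpen Ω) (hz : z ∈ Ω) (hA : SmoothMatrixOn Ω h)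
    (hdet : ∀ z ∈ Ω, (h z).det ≠ 0) :
    mwirt (-Complex.I) j (fun w => mwirt Complex.I k (fun w => (h w)⁻¹) w * h w) z =
      (h z)⁻¹ * curvature h j k z := by
  have hu (w) (hw : w ∈ Ω) : IsUnit (h w).det := (hdet w hw).isUnit
  rw [mwirt_mul hΩ hz ((hA.inv hdet).mwirt hΩ) hA, mwirt_mwirt_inv hΩ hz hA hdet,
    mwirt_inv hΩ hz hA hdet, mwirt_inv hΩ hz hA hdet]
  simp only [add_mul, neg_mul, mul_neg, neg_neg, Matrix.mul_assoc,
    Matrix.nonsing_inv_mul _ (hu z hz), Matrix.mul_one]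
  abel

theorem mwirt_conjTranspose :
    mwirt c j (fun w => (A w).conjTranspose) z = (mwirt (conj c) j A z).conjTranspose := by
  ext α β
  exact wirt_conj

/-- `(∂_j h)ᴴ = ∂̄_j h` for a Hermitian matrix `h`. -/
theorem conjTranspose_mwirt (hΩ : IsOpen Ω) (hz : z ∈ Ω)
    (hherm : ∀ z ∈ Ω, (h z).conjTranspose = h z) :
    (mwirt c j h z).conjTranspose = mwirt (conj c) j h z := by
  have := mwirt_conjTranspose (c := conj c) (j := j) (A := h) (z := z)
  rw [Complex.conj_conj] at this
  rw [← this]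
  exact mwirt_congr (by filter_upwards [hΩ.mem_nhds hz] with w hw using hherm w hw)

theorem mwirt_comm (hΩ : IsOpen Ω) (hz : z ∈ Ω) (hA : SmoothMatrixOn Ω A) (c' : ℂ) :
    mwirt c' k (mwirt c j A) z = mwirt c j (mwirt c' k A) z := by
  ext α β
  exact wirt_comm ((hA α β).contDiffAt (hΩ.mem_nhds hz)) c'

/-- Conjugate transposition exchanges ∂ and ∂̄ on a Hermitian matrix, and the two derivatives
commute. -/
theorem conjTranspose_curvature (hΩ : IsOpen Ω) (hz : z ∈ Ω) (hA : SmoothMatrixOn Ω h)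
    (hherm : ∀ z ∈ Ω, (h z).conjTranspose = h z) :
    (curvature h j k z).conjTranspose = curvature h k j z := by
  have h1 : (mwirt (-Complex.I) j (mwirt Complex.I k h) z).conjTranspose =
      mwirt (-Complex.I) k (mwirt Complex.I j h) z := by
    have := mwirt_conjTranspose (c := Complex.I) (j := j) (A := mwirt Complex.I k h) (z := z)
    rw [Complex.conj_I] at this
    rw [← this, mwirt_comm hΩ hz hA]
    refine mwirt_congr ?_
    filter_upwards [hΩ.mem_nhds hz] with w hw
    rw [conjTranspose_mwirt hΩ hw hherm, Complex.conj_I]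
  rw [curvature_eq, curvature_eq, Matrix.conjTranspose_add, Matrix.conjTranspose_neg, h1,
    Matrix.conjTranspose_mul, Matrix.conjTranspose_mul, conjTranspose_mwirt hΩ hz hherm,
    conjTranspose_mwirt hΩ hz hherm, Matrix.conjTranspose_nonsing_inv, hherm z hz,
    map_neg, Complex.conj_I, neg_neg, Matrix.mul_assoc]

theorem wirt_prod {ι : Type*} [DecidableEq ι] (s : Finset ι) {F : ι → (Fin n → ℂ) → ℂ}
    (hF : ∀ i ∈ s, DifferentiableAt ℝ (F i) z) :
    wirt c j (fun w => ∏ i ∈ s, F i w) z =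
      ∑ i ∈ s, (∏ l ∈ s.erase i, F l z) * wirt c j (F i) z := by
  have := (HasFDerivAt.finsetProd (u := s) (g := F) (x := z)
    fun i hi => (hF i hi).hasFDerivAt).fderiv
  simp only [wirt, this, _root_.sum_apply, _root_.smul_apply, smul_eq_mul, Finset.mul_sum,
    ← Finset.sum_add_distrib]
  exact Finset.sum_congr rfl fun i _ => by ring

/-- Jacobi's formula. -/
theorem wirt_det (hΩ : IsOpen Ω) (hz : z ∈ Ω) (hA : SmoothMatrixOn Ω h)
    (hdet : ∀ z ∈ Ω, (h z).det ≠ 0) :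
    wirt c j (fun w => (h w).det) z = (h z).det * ((h z)⁻¹ * mwirt c j h z).trace := by
  have h1 : (h z).det * ((h z)⁻¹ * mwirt c j h z).trace =
      ((h z).adjugate * mwirt c j h z).trace := by
    rw [Matrix.inv_def, Ring.inverse_eq_inv', Matrix.smul_mul, Matrix.trace_smul, smul_eq_mul,
      mul_inv_cancel_left₀ (hdet z hz)]
  -- By Cramer's rule this trace is the sum of the determinants in which one column of h is replaced
  -- by its derivative, which is what the product rule gives in the Leibniz expansion.
  have h2 : ((h z).adjugate * mwirt c j h z).trace =
      ∑ i, ((h z).updateCol i (fun l => mwirt c j h z l i)).det := by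
    rw [Matrix.trace]
    refine Finset.sum_congr rfl fun i _ => ?_
    rw [← Matrix.cramer_apply, Matrix.cramer_eq_adjugate_mulVec]
    rfl
  have hd := fun α β => hA.differentiableAt hΩ hz α β
  have hp (σ : Equiv.Perm (Fin r)) : DifferentiableAt ℝ (fun w => ∏ i, h w (σ i) i) z :=
    ((contDiffOn_prod fun i _ => hA (σ i) i).contDiffAt (hΩ.mem_nhds hz)).differentiableAt (by simp)
  rw [h1, h2]
  simp only [Matrix.det_apply']
  rw [Finset.sum_comm, wirt_sum _ fun σ _ => (hp σ).const_mul _]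
  refine Finset.sum_congr rfl fun σ _ => ?_
  rw [wirt_mul (differentiableAt_const _) (hp σ), wirt_const, zero_mul, zero_add,
    wirt_prod _ fun i _ => hd (σ i) i,
    Finset.mul_sum]
  refine Finset.sum_congr rfl fun i _ => ?_
  rw [← Finset.prod_erase_mul _ _ (Finset.mem_univ i), Matrix.updateCol_self]
  congr 2
  refine Finset.prod_congr rfl fun l hl => ?_
  rw [Matrix.updateCol_ne (Finset.ne_of_mem_erase hl)]

/-- `∂_j ∂̄_k det h = (∂_j det h) (∂̄_k det h) / det h - det h · tr (h⁻¹ R_{jk})`. -/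
theorem wirt_wirt_det (hΩ : IsOpen Ω) (hz : z ∈ Ω) (hA : SmoothMatrixOn Ω h)
    (hdet : ∀ z ∈ Ω, (h z).det ≠ 0) :
    wirt (-Complex.I) j (wirt Complex.I k fun w => (h w).det) z =
      ((h z).det)⁻¹ * wirt (-Complex.I) j (fun w => (h w).det) z *
        wirt Complex.I k (fun w => (h w).det) z
      - (h z).det * ((h z)⁻¹ * curvature h j k z).trace := by
  have hs := ((hA.inv hdet).mwirt (c := Complex.I) (j := k) hΩ).mul hA
  -- The logarithmic derivative is written as -tr((∂̄_k h⁻¹) h) rather than tr(h⁻¹ ∂̄_k h), because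
  -- applying ∂_j to the former produces h⁻¹ R directly.
  have h1 : wirt Complex.I k (fun w => (h w).det) =ᶠ[𝓝 z] fun w => (h w).det *
      (- (mwirt Complex.I k (fun w => (h w)⁻¹) w * h w).trace) := by
    filter_upwards [hΩ.mem_nhds hz] with w hw
    rw [wirt_det hΩ hw hA hdet, mwirt_inv hΩ hw hA hdet, neg_mul, Matrix.trace_neg, neg_neg,
      Matrix.mul_assoc, Matrix.nonsing_inv_mul _ (hdet w hw).isUnit, Matrix.mul_one]
  have hd : DifferentiableAt ℝ (fun w => (h w).det) z :=
    (hA.det.contDiffAt (hΩ.mem_nhds hz)).differentiableAt (by simp)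
  have ht : DifferentiableAt ℝ
      (fun w => (mwirt Complex.I k (fun w => (h w)⁻¹) w * h w).trace) z :=
    (hs.trace.contDiffAt (hΩ.mem_nhds hz)).differentiableAt (by simp)
  rw [wirt_congr h1, wirt_mul hd ht.fun_neg, wirt_neg, wirt_trace hΩ hz hs,
    mwirt_mwirt_inv_mul hΩ hz hA hdet, h1.eq_of_nhds]
  field_simp [hdet z hz]
  ring

/-- The curvature of a conformal change of a metric. -/
theorem curvature_smul {f : (Fin n → ℂ) → ℂ} (hΩ : IsOpen Ω) (hz : z ∈ Ω)
    (hf : ContDiffOn ℝ ∞ f Ω) (hf0 : f z ≠ 0) (hA : SmoothMatrixOn Ω h)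
    (hdet : ∀ z ∈ Ω, (h z).det ≠ 0) :
    curvature (fun w => f w • h w) j k z = f z • curvature h j k z +
      ((f z)⁻¹ * wirt (-Complex.I) j f z * wirt Complex.I k f z -
        wirt (-Complex.I) j (wirt Complex.I k f) z) • h z := by
  have hu : IsUnit (h z).det := (hdet z hz).isUnit
  have h1 : mwirt Complex.I k (fun w => f w • h w) =ᶠ[𝓝 z] fun w =>
      wirt Complex.I k f w • h w + f w • mwirt Complex.I k h w := by
    filter_upwards [hΩ.mem_nhds hz] with w hw
    exact mwirt_smul hΩ hw hf hA
  have hs1 : SmoothMatrixOn Ω fun w => wirt Complex.I k f w • h w :=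
    .smul (contDiffOn_wirt hΩ hf) hA
  have hs2 : SmoothMatrixOn Ω fun w => f w • mwirt Complex.I k h w :=
    .smul hf (hA.mwirt hΩ)
  have h2 : mwirt (-Complex.I) j (fun w => wirt Complex.I k f w • h w +
      f w • mwirt Complex.I k h w) z = mwirt (-Complex.I) j (fun w =>
        wirt Complex.I k f w • h w) z +
        mwirt (-Complex.I) j (fun w => f w • mwirt Complex.I k h w) z := by
    ext α β
    exact wirt_add (hs1.differentiableAt hΩ hz α β) (hs2.differentiableAt hΩ hz α β)
  have hinv : (f z • h z)⁻¹ = (f z)⁻¹ • (h z)⁻¹ := by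
    refine Matrix.inv_eq_left_inv ?_
    rw [Matrix.smul_mul, Matrix.mul_smul, smul_smul, inv_mul_cancel₀ hf0, one_smul,
      Matrix.nonsing_inv_mul _ hu]
  rw [curvature_eq, mwirt_congr h1, h2, mwirt_smul hΩ hz (contDiffOn_wirt hΩ hf) hA,
    mwirt_smul hΩ hz hf (hA.mwirt hΩ), h1.eq_of_nhds, mwirt_smul hΩ hz hf hA, hinv,
    curvature_eq]
  generalize mwirt (-Complex.I) j (mwirt Complex.I k h) z = X
  generalize mwirt (-Complex.I) j h z = Y
  generalize mwirt Complex.I k h z = Z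
  generalize wirt (-Complex.I) j (wirt Complex.I k f) z = t
  generalize wirt (-Complex.I) j f z = a
  generalize wirt Complex.I k f z = b
  have e1 : Y * (h z)⁻¹ * h z = Y := Matrix.nonsing_inv_mul_cancel_right _ _ hu
  have e2 : h z * (h z)⁻¹ = 1 := Matrix.mul_nonsing_inv _ hu
  generalize f z = d at *
  simp only [add_mul, mul_add, Matrix.smul_mul, Matrix.mul_smul, smul_smul, e1, e2,
    Matrix.one_mul, smul_add]
  ext α β
  simp only [Matrix.add_apply, Matrix.smul_apply, Matrix.neg_apply, smul_eq_mul]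
  field_simp
  ring

/-- The curvature of the metric `det h · h` of `E ⊗ det E`. -/
theorem curvature_det_smul (hΩ : IsOpen Ω) (hz : z ∈ Ω) (hA : SmoothMatrixOn Ω h)
    (hdet : ∀ z ∈ Ω, (h z).det ≠ 0) :
    curvature (fun w => (h w).det • h w) j k z = (h z).det •
      (curvature h j k z + ((h z)⁻¹ * curvature h j k z).trace • h z) := by
  -- For the factor f = det h, the scalar f⁻¹ ∂f ∂̄f - ∂∂̄f is det h · tr(h⁻¹ R), the curvature of
  -- the determinant.
  rw [curvature_smul hΩ hz hA.det (hdet z hz) hA hdet, wirt_wirt_det hΩ hz hA hdet, sub_sub_cancel,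
    smul_add, smul_smul]

end CurvatureIdentities


/-! ## Linear algebra of curvature forms -/

section LinearAlgebra

variable {n r : ℕ}

/-- The group of vectors with entries in the fourth roots of unity. -/
abbrev PhaseGroup (r : ℕ) : Type := Fin r → rootsOfUnity 4 ℂ

instance : Fintype (PhaseGroup r) :=
  Fintype.ofFinite _

/-- The coordinate characters of `PhaseGroup r`. -/
def phase (α : Fin r) : PhaseGroup r →* ℂ :=
  (Units.coeHom ℂ).comp ((rootsOfUnity 4 ℂ).subtype.comp (Pi.evalMonoidHom _ α))

/-- The conjugate coordinate characters of `PhaseGroup r`. -/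
def phaseConj (α : Fin r) : PhaseGroup r →* ℂ :=
  ((starRingEnd ℂ : ℂ →+* ℂ) : ℂ →* ℂ).comp (phase α)

theorem phaseConj_apply (α : Fin r) (σ : PhaseGroup r) : phaseConj α σ = conj (phase α σ) := rfl

theorem phase_mul_phaseConj (α : Fin r) (σ : PhaseGroup r) : phase α σ * phaseConj α σ = 1 := by
  have h : ‖phase α σ‖ = 1 := Complex.norm_eq_one_of_mem_rootsOfUnity (σ α).2
  rw [phaseConj_apply, Complex.mul_conj, Complex.normSq_eq_norm_sq, h]
  simp

/-- The imaginary unit as a fourth root of unity. -/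
def rootI : rootsOfUnity 4 ℂ :=
  ⟨Units.mk0 Complex.I Complex.I_ne_zero, by
    rw [mem_rootsOfUnity]
    ext
    simp⟩

theorem phase_mulSingle (α ι : Fin r) :
    phase α (Pi.mulSingle ι rootI) = if α = ι then Complex.I else 1 := by
  simp only [phase, MonoidHom.comp_apply, Pi.evalMonoidHom_apply, Pi.mulSingle_apply]
  split_ifs <;> simp [rootI]

/-- Orthogonality of characters: the character is trivial exactly when the indices of the conjugated
factors match those of the others. Each coordinate occurs with an exponent between -2 and 2, and
fourth roots of unity detect all the nonzero ones; signs would not. -/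
theorem sum_phase (α β γ δ : Fin r) :
    ∑ σ : PhaseGroup r, phaseConj γ σ * phase δ σ * (phase α σ * phaseConj β σ) =
      if (γ = δ ∧ α = β) ∨ (γ = α ∧ δ = β) then (Fintype.card (PhaseGroup r) : ℂ) else 0 := by
  classical
  have h := sum_hom_units (phaseConj γ * phase δ * (phase α * phaseConj β))
  simp only [MonoidHom.mul_apply] at h
  rw [h]
  have hiff : (phaseConj γ * phase δ * (phase α * phaseConj β) = 1) ↔
      (γ = δ ∧ α = β) ∨ (γ = α ∧ δ = β) := by
    constructor
    · intro h1
      by_contra hc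
      push Not at hc
      -- Evaluation at the vector with a single entry i isolates the exponent of one coordinate. In
      -- each case below, some index has a nonzero exponent.
      have h2 (ι : Fin r) := DFunLike.congr_fun h1 (Pi.mulSingle ι rootI)
      simp only [MonoidHom.mul_apply, MonoidHom.one_apply, phaseConj_apply, phase_mulSingle] at h2
      by_cases hγδ : γ = δ
      · subst hγδ
        have hαβ := hc.1 rfl
        have := h2 α
        by_cases hγα : γ = α
        · subst hγα
          simp [Ne.symm hαβ, Complex.ext_iff] at this
        · simp [hγα, Ne.symm hαβ, Complex.ext_iff] at this
      · by_cases hγα : γ = α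
        · subst hγα
          have := h2 δ
          simp [hγδ, Ne.symm (hc.2 rfl), Complex.ext_iff] at this
        · have := h2 γ
          by_cases hβ : β = γ
          · subst hβ
            norm_num [Ne.symm hγδ, Ne.symm hγα, Complex.ext_iff] at this
          · simp [Ne.symm hγδ, Ne.symm hγα, hβ, Complex.ext_iff] at this
    · rintro (⟨rfl, rfl⟩ | ⟨rfl, rfl⟩) <;> refine MonoidHom.ext fun σ => ?_
      · have h1 := phase_mul_phaseConj γ σ
        have h2 := phase_mul_phaseConj α σ
        simp only [MonoidHom.mul_apply, MonoidHom.one_apply]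
        linear_combination (phase α σ * phaseConj α σ) * h1 + h2
      · have h1 := phase_mul_phaseConj γ σ
        have h2 := phase_mul_phaseConj δ σ
        simp only [MonoidHom.mul_apply, MonoidHom.one_apply]
        linear_combination (phase δ σ * phaseConj δ σ) * h1 + h2
  simp only [hiff, Nat.cast_ite, Nat.cast_zero]

/-- The two index patterns that survive in `sum_phase` overlap when all four indices coincide, hence
the subtracted term. -/
theorem sum_phase_quadratic (w x : Fin r → ℂ) (α β : Fin r) :
    ∑ σ : PhaseGroup r, (∑ γ, w γ * phaseConj γ σ) * conj (∑ δ, x δ * phaseConj δ σ) *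
      (phase α σ * conj (phase β σ)) = Fintype.card (PhaseGroup r) *
        ((if α = β then ∑ γ, w γ * conj (x γ) else 0) + w α * conj (x β) -
          (if α = β then w α * conj (x α) else 0)) := by
  have h1 (σ : PhaseGroup r) : (∑ γ, w γ * phaseConj γ σ) * conj (∑ δ, x δ * phaseConj δ σ) *
      (phase α σ * conj (phase β σ)) = ∑ γ, ∑ δ, w γ * conj (x δ) *
        (phaseConj γ σ * phase δ σ * (phase α σ * phaseConj β σ)) := by
    rw [map_sum, Finset.sum_mul_sum, Finset.sum_mul]
    refine Finset.sum_congr rfl fun γ _ => ?_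
    rw [Finset.sum_mul]
    refine Finset.sum_congr rfl fun δ _ => ?_
    rw [map_mul, phaseConj_apply δ, phaseConj_apply β, Complex.conj_conj]
    ring
  rw [Finset.sum_congr rfl fun σ _ => h1 σ, Finset.sum_comm]
  have h2 (γ : Fin r) : ∑ σ : PhaseGroup r, ∑ δ, w γ * conj (x δ) *
        (phaseConj γ σ * phase δ σ * (phase α σ * phaseConj β σ)) = ∑ δ, w γ * conj (x δ) *
        (if (γ = δ ∧ α = β) ∨ (γ = α ∧ δ = β) then (Fintype.card (PhaseGroup r) : ℂ) else 0) := by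
    rw [Finset.sum_comm]
    refine Finset.sum_congr rfl fun δ _ => ?_
    rw [← Finset.mul_sum, sum_phase]
  rw [Finset.sum_congr rfl fun γ _ => h2 γ]
  by_cases hαβ : α = β
  · subst hαβ
    have h3 (γ δ : Fin r) : ((γ = δ ∧ α = α) ∨ (γ = α ∧ δ = α)) ↔ γ = δ :=
      ⟨fun h => h.elim And.left fun h => h.1.trans h.2.symm, fun h => Or.inl ⟨h, rfl⟩⟩
    rw [Finset.sum_congr rfl fun γ _ => Finset.sum_congr rfl fun δ _ =>
      congrArg _ (if_congr (h3 γ δ) rfl rfl)]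
    simp only [mul_ite, mul_zero, Finset.sum_ite_eq, Finset.mem_univ, if_true,
      add_sub_cancel_right]
    rw [← Finset.sum_mul, mul_comm]
  · have h3 (γ δ : Fin r) : ((γ = δ ∧ α = β) ∨ (γ = α ∧ δ = β)) ↔ (δ = β ∧ γ = α) :=
      ⟨fun h => h.elim (fun h => absurd h.2 hαβ) And.symm, fun h => Or.inr h.symm⟩
    rw [Finset.sum_congr rfl fun γ _ => Finset.sum_congr rfl fun δ _ =>
      congrArg _ (if_congr (h3 γ δ) rfl rfl)]
    simp only [ite_and, hαβ, mul_ite, mul_zero, Finset.sum_ite_eq', Finset.mem_univ, if_true,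
      if_false, zero_add, sub_zero]
    rw [mul_comm]

variable {P : Fin n → Fin n → Matrix (Fin r) (Fin r) ℂ}

/-- A Griffiths semipositive form becomes Nakano semipositive after adding its trace
(with respect to the standard metric). -/
theorem nakano_add_trace_nonneg
    (hP : ∀ (u : Fin n → ℂ) (v : Fin r → ℂ), 0 ≤ (∑ j, ∑ k, ∑ α, ∑ β,
      P j k α β * (u j * conj (u k)) * (v α * conj (v β))).re) (w : Fin n → Fin r → ℂ) :
    0 ≤ (∑ j, ∑ k, (∑ α, ∑ β, P j k α β * (w j α * conj (w k β)) +
      (P j k).trace * ∑ γ, w j γ * conj (w k γ))).re := by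
  -- Average the Griffiths inequality over u_j = ∑_γ w_{jγ} σ̄_γ and v = σ. Orthogonality leaves the
  -- Nakano form plus the trace term, minus a diagonal sum.
  have hsum : ∑ σ : PhaseGroup r, ∑ j, ∑ k, ∑ α, ∑ β, P j k α β *
        ((∑ γ, w j γ * phaseConj γ σ) * conj (∑ δ, w k δ * phaseConj δ σ)) *
        (phase α σ * conj (phase β σ)) = Fintype.card (PhaseGroup r) *
      (∑ j, ∑ k, (∑ α, ∑ β, P j k α β * (w j α * conj (w k β)) +
        (P j k).trace * ∑ γ, w j γ * conj (w k γ)) -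
      ∑ j, ∑ k, ∑ α, P j k α α * (w j α * conj (w k α))) := by
    rw [← Finset.sum_sub_distrib, Finset.mul_sum, Finset.sum_comm]
    refine Finset.sum_congr rfl fun j _ => ?_
    rw [← Finset.sum_sub_distrib, Finset.mul_sum, Finset.sum_comm]
    refine Finset.sum_congr rfl fun k _ => ?_
    rw [Finset.sum_comm, Matrix.trace, Finset.sum_mul, ← Finset.sum_add_distrib,
      ← Finset.sum_sub_distrib, Finset.mul_sum]
    refine Finset.sum_congr rfl fun α _ => ?_
    rw [Finset.sum_comm]
    have h2 (β : Fin r) : ∑ σ : PhaseGroup r, P j k α β *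
        ((∑ γ, w j γ * phaseConj γ σ) * conj (∑ δ, w k δ * phaseConj δ σ)) *
        (phase α σ * conj (phase β σ)) = P j k α β * (Fintype.card (PhaseGroup r) *
        ((if α = β then ∑ γ, w j γ * conj (w k γ) else 0) + w j α * conj (w k β) -
          (if α = β then w j α * conj (w k α) else 0))) := by
      rw [← sum_phase_quadratic, Finset.mul_sum]
      exact Finset.sum_congr rfl fun σ _ => by ring
    rw [Finset.sum_congr rfl fun β _ => h2 β]
    simp only [mul_sub, mul_add, Finset.sum_add_distrib, Finset.sum_sub_distrib, mul_ite, mul_zero,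
      Finset.sum_ite_eq, Finset.mem_univ, if_true, Matrix.diag]
    have h3 : ∑ β, P j k α β * (Fintype.card (PhaseGroup r) * (w j α * conj (w k β))) =
        ∑ β, Fintype.card (PhaseGroup r) * (P j k α β * (w j α * conj (w k β))) :=
      Finset.sum_congr rfl fun β _ => by ring
    rw [h3, ← Finset.mul_sum]
    ring
  -- The diagonal sum can be added back: it consists of Griffiths values at v = e_α and u_j =
  -- w_{jα}.
  have hdiag : 0 ≤ (∑ j, ∑ k, ∑ α, P j k α α * (w j α * conj (w k α))).re := by
    have h2 : ∑ j, ∑ k, ∑ α, P j k α α * (w j α * conj (w k α)) =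
        ∑ α, ∑ j, ∑ k, P j k α α * (w j α * conj (w k α)) := by
      rw [Finset.sum_congr rfl fun j _ => Finset.sum_comm, Finset.sum_comm]
    rw [h2, Complex.re_sum]
    refine Finset.sum_nonneg fun α _ => ?_
    have := hP (fun j => w j α) (Pi.single α 1)
    simpa [Pi.single_apply, apply_ite] using this
  have hN : 0 < (Fintype.card (PhaseGroup r) : ℝ) := by exact_mod_cast Fintype.card_pos
  have h1 : 0 ≤ (∑ σ : PhaseGroup r, ∑ j, ∑ k, ∑ α, ∑ β, P j k α β *
        ((∑ γ, w j γ * phaseConj γ σ) * conj (∑ δ, w k δ * phaseConj δ σ)) *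
        (phase α σ * conj (phase β σ))).re := by
    rw [Complex.re_sum]
    exact Finset.sum_nonneg fun σ _ => hP _ _
  rw [hsum, ← Complex.ofReal_natCast, Complex.re_ofReal_mul, Complex.sub_re] at h1
  linarith [nonneg_of_mul_nonneg_right h1 hN]

/-- The sesquilinear form with matrix `M`. -/
def sesq {m : ℕ} (M : Matrix (Fin m) (Fin m) ℂ) (x y : Fin m → ℂ) : ℂ :=
  ∑ α, ∑ β, M α β * (x α * conj (y β))

/-! ### Sesquilinear forms given by matrices. -/

section Sesq

variable {m : ℕ} {M N : Matrix (Fin m) (Fin m) ℂ} {x y x' y' : Fin m → ℂ}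

theorem sesq_eq_dotProduct : sesq M x y = x ⬝ᵥ M.mulVec (star y) := by
  simp only [sesq, dotProduct, Matrix.mulVec, Finset.mul_sum, Pi.star_apply, RCLike.star_def]
  exact Finset.sum_congr rfl fun α _ => Finset.sum_congr rfl fun β _ => by ring

theorem sesq_add_left : sesq M (x + x') y = sesq M x y + sesq M x' y := by
  simp only [sesq_eq_dotProduct, add_dotProduct]

theorem sesq_add_right : sesq M x (y + y') = sesq M x y + sesq M x y' := by
  simp only [sesq_eq_dotProduct, star_add, Matrix.mulVec_add, dotProduct_add]

theorem sesq_smul_left (c : ℂ) : sesq M (c • x) y = c * sesq M x y := by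
  simp only [sesq_eq_dotProduct, smul_dotProduct, smul_eq_mul]

theorem sesq_smul_right (c : ℂ) : sesq M x (c • y) = conj c * sesq M x y := by
  simp only [sesq_eq_dotProduct, star_smul, Matrix.mulVec_smul, dotProduct_smul, smul_eq_mul,
    RCLike.star_def]

theorem sesq_single (α β : Fin m) : sesq M (Pi.single α 1) (Pi.single β 1) = M α β := by
  simp [sesq, Pi.single_apply, apply_ite]

theorem sesq_add (x y : Fin m → ℂ) : sesq (M + N) x y = sesq M x y + sesq N x y := by
  simp only [sesq, Matrix.add_apply, add_mul, Finset.sum_add_distrib]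

theorem sesq_smul (c : ℂ) (x y : Fin m → ℂ) : sesq (c • M) x y = c * sesq M x y := by
  simp only [sesq, Matrix.smul_apply, smul_eq_mul, Finset.mul_sum, mul_assoc]

theorem sesq_one (x y : Fin m → ℂ) : sesq 1 x y = ∑ γ, x γ * conj (y γ) := by
  simp [sesq, Matrix.one_apply]

theorem conj_sesq (x y : Fin m → ℂ) : conj (sesq M x y) = sesq M.conjTranspose y x := by
  simp only [sesq, map_sum, map_mul, Complex.conj_conj, Matrix.conjTranspose_apply, RCLike.star_def]
  rw [Finset.sum_comm]
  exact Finset.sum_congr rfl fun α _ => Finset.sum_congr rfl fun β _ => by ring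

theorem sesq_congruence (C : Matrix (Fin m) (Fin m) ℂ) (x y : Fin m → ℂ) :
    sesq (C * M * C.conjTranspose) x y = sesq M (Matrix.vecMul x C) (Matrix.vecMul y C) := by
  simp only [sesq_eq_dotProduct, Matrix.star_vecMul, ← Matrix.mulVec_mulVec,
    Matrix.dotProduct_mulVec x C]

theorem sesq_add_smul (c : ℂ) : sesq M (x + c • y) (x + c • y) = sesq M x x +
    conj c * sesq M x y + c * sesq M y x + c * conj c * sesq M y y := by
  simp only [sesq_add_left, sesq_add_right, sesq_smul_left, sesq_smul_right]
  ring

/-- Test positivity on e_j + c e_k, with the unimodular c for which the two cross terms add up to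
-2‖M j k‖. -/
theorem norm_apply_le_of_sesq_nonneg (hM : M.conjTranspose = M)
    (hpos : ∀ x, 0 ≤ (sesq M x x).re) (j k : Fin m) :
    ‖M j k‖ ≤ ((M j j).re + (M k k).re) / 2 := by
  obtain ⟨c, hc, hcM⟩ : ∃ c : ℂ, c * conj c = 1 ∧ conj c * M j k = -(‖M j k‖ : ℂ) := by
    by_cases h0 : M j k = 0
    · exact ⟨1, by simp [h0]⟩
    · have hn : (‖M j k‖ : ℂ) ≠ 0 := by exact_mod_cast norm_ne_zero_iff.2 h0
      have h1 : conj (M j k) * M j k = (‖M j k‖ : ℂ) ^ 2 := Complex.conj_mul' _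
      refine ⟨-(M j k / ‖M j k‖), ?_, ?_⟩
      · simp only [map_neg, map_div₀, Complex.conj_ofReal, neg_mul_neg]
        field_simp
        linear_combination h1
      · simp only [map_neg, map_div₀, Complex.conj_ofReal, neg_mul]
        field_simp
        linear_combination -h1
  have h1 := hpos (Pi.single j 1 + c • Pi.single k 1)
  have h2 : conj (M j k) = M k j := congrFun (congrFun hM k) j
  have h3 : c * M k j = -(‖M j k‖ : ℂ) := by
    have := congrArg conj hcM
    rwa [map_mul, Complex.conj_conj, h2, map_neg, Complex.conj_ofReal] at this
  rw [sesq_add_smul, sesq_single, sesq_single, sesq_single, sesq_single, hcM, h3, hc] at h1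
  simp at h1
  linarith

end Sesq

variable {h : Matrix (Fin r) (Fin r) ℂ}

theorem sum_griffiths_eq (P : Fin n → Fin n → Matrix (Fin r) (Fin r) ℂ) (u : Fin n → ℂ)
    (v : Fin r → ℂ) : ∑ j, ∑ k, ∑ α, ∑ β, P j k α β * (u j * conj (u k)) * (v α * conj (v β)) =
      sesq (Matrix.of fun j k => sesq (P j k) v v) u u := by
  simp only [sesq, Matrix.of_apply, Finset.sum_mul]
  refine Finset.sum_congr rfl fun j _ => Finset.sum_congr rfl fun k _ =>
    Finset.sum_congr rfl fun α _ => Finset.sum_congr rfl fun β _ => by ring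

/-- Nonnegativity on decomposable tensors. -/
def GriffithsSemipos (P : Fin n → Fin n → Matrix (Fin r) (Fin r) ℂ) : Prop :=
  ∀ u v, 0 ≤ (sesq (Matrix.of fun j k => sesq (P j k) v v) u u).re

theorem GriffithsSemipos.congruence (hP : GriffithsSemipos P) (C : Matrix (Fin r) (Fin r) ℂ) :
    GriffithsSemipos fun j k => C * P j k * C.conjTranspose := by
  intro u v
  simp only [sesq_congruence]
  exact hP u _

theorem GriffithsSemipos.apply_self_nonneg (hP : GriffithsSemipos P) (j : Fin n) (v : Fin r → ℂ) :
    0 ≤ (sesq (P j j) v v).re := by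
  have := hP (Pi.single j 1) v
  rwa [sesq_single, Matrix.of_apply] at this

theorem GriffithsSemipos.apply_nonneg (hP : GriffithsSemipos P) (j : Fin n) (α : Fin r) :
    0 ≤ (P j j α α).re := by
  have := hP.apply_self_nonneg j (Pi.single α 1)
  rwa [sesq_single] at this

/-- The coefficients of a Griffiths semipositive Hermitian form are controlled by its trace. -/
theorem GriffithsSemipos.norm_apply_le (hP : GriffithsSemipos P)
    (hherm : ∀ j k, (P j k).conjTranspose = P k j) (j k : Fin n) (α β : Fin r) :
    ‖P j k α β‖ ≤ 2 * ∑ j, (P j j).trace.re := by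
  have hle (j : Fin n) (α : Fin r) : (P j j α α).re ≤ ∑ j, (P j j).trace.re := by
    have h1 (j : Fin n) : (P j j).trace.re = ∑ α, (P j j α α).re := by
      rw [Matrix.trace, Complex.re_sum]
      rfl
    have h2 (j : Fin n) : 0 ≤ (P j j).trace.re := by
      rw [h1]
      exact Finset.sum_nonneg fun α _ => hP.apply_nonneg j α
    calc (P j j α α).re ≤ (P j j).trace.re := by
          rw [h1]
          exact Finset.single_le_sum (f := fun α => (P j j α α).re)
            (fun α _ => hP.apply_nonneg j α) (Finset.mem_univ α)
      _ ≤ _ := Finset.single_le_sum (f := fun j => (P j j).trace.re) (fun j _ => h2 j)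
          (Finset.mem_univ j)
  -- For fixed v the matrix P_{jk}(v, v) is positive semidefinite in (j, k), so its entries are
  -- bounded by its diagonal. The entry at (α, β) is recovered by polarization from v = e_α + c e_β
  -- with c⁴ = 1.
  let V (c : ℂ) : Fin r → ℂ := Pi.single α 1 + c • Pi.single β 1
  have hV (c : ℂ) : ‖sesq (P j k) (V c) (V c)‖ ≤
      ((sesq (P j j) (V c) (V c)).re + (sesq (P k k) (V c) (V c)).re) / 2 := by
    refine norm_apply_le_of_sesq_nonneg (M := Matrix.of fun j k => sesq (P j k) (V c) (V c)) ?_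
      (fun u => hP u (V c)) j k
    ext j k
    change conj (sesq (P k j) (V c) (V c)) = sesq (P j k) (V c) (V c)
    rw [conj_sesq, hherm]
  have hpol : 4 * P j k α β = sesq (P j k) (V 1) (V 1) + Complex.I * sesq (P j k) (V Complex.I)
      (V Complex.I) - sesq (P j k) (V (-1)) (V (-1)) -
      Complex.I * sesq (P j k) (V (-Complex.I)) (V (-Complex.I)) := by
    simp only [V, sesq_add_smul, sesq_single, map_one, map_neg, Complex.conj_I]
    linear_combination (2 * P j k α β - 2 * P j k β α) * Complex.I_sq
  -- In the sum over the four values of c the mixed terms cancel. What remains is bounded by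
  -- diagonal entries, each at most the full trace; this gives the factor 2.
  have hsum (j : Fin n) : (sesq (P j j) (V 1) (V 1)).re + (sesq (P j j) (V Complex.I)
      (V Complex.I)).re + (sesq (P j j) (V (-1)) (V (-1))).re +
      (sesq (P j j) (V (-Complex.I)) (V (-Complex.I))).re =
      4 * ((P j j α α).re + (P j j β β).re) := by
    simp only [V, sesq_add_smul, sesq_single, map_one, map_neg, Complex.conj_I, Complex.add_re,
      Complex.mul_re, Complex.neg_re, Complex.neg_im, Complex.I_re, Complex.I_im, Complex.one_re,
      Complex.one_im, Complex.mul_im]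
    ring
  have h4 : 4 * ‖P j k α β‖ ≤ ‖sesq (P j k) (V 1) (V 1)‖ + ‖sesq (P j k) (V Complex.I)
      (V Complex.I)‖ + ‖sesq (P j k) (V (-1)) (V (-1))‖ +
      ‖sesq (P j k) (V (-Complex.I)) (V (-Complex.I))‖ := by
    have : 4 * ‖P j k α β‖ = ‖4 * P j k α β‖ := by simp
    rw [this, hpol]
    refine (norm_sub_le _ _).trans (add_le_add ((norm_sub_le _ _).trans
      (add_le_add ((norm_add_le _ _).trans (add_le_add le_rfl ?_)) le_rfl)) ?_) <;> simp
  linarith [hV 1, hV Complex.I, hV (-1), hV (-Complex.I), hsum j, hsum k, hle j α, hle j β, hle k α,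
    hle k β]

open scoped MatrixOrder in
/-- A positive definite matrix `h` is of the form `C Cᴴ` with `C` invertible. -/
theorem exists_mul_conjTranspose_eq (hh : h.PosDef) :
    ∃ C : Matrix (Fin r) (Fin r) ℂ, IsUnit C.det ∧ h = C * C.conjTranspose := by
  obtain ⟨B, hB⟩ := CStarAlgebra.nonneg_iff_eq_star_mul_self.1 hh.posSemidef.nonneg
  rw [Matrix.star_eq_conjTranspose] at hB
  refine ⟨B.conjTranspose, ?_, by rw [Matrix.conjTranspose_conjTranspose, hB]⟩
  have h1 : IsUnit h.det := (Matrix.isUnit_iff_isUnit_det _).1 hh.isUnit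
  rw [hB, Matrix.det_mul] at h1
  exact isUnit_of_mul_isUnit_left h1

/-- Demailly-Skoda: a Griffiths semipositive form becomes Nakano semipositive after adding its
trace. -/
theorem GriffithsSemipos.nakano (hP : GriffithsSemipos P) (hh : h.PosDef)
    (w : Fin n → Fin r → ℂ) :
    0 ≤ (∑ j, ∑ k, sesq (P j k + (h⁻¹ * P j k).trace • h) (w j) (w k)).re := by
  obtain ⟨C, hC, rfl⟩ := exists_mul_conjTranspose_eq hh
  have hC' : IsUnit C.conjTranspose.det := by
    rw [Matrix.det_conjTranspose]
    exact hC.star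
  -- The change of frame by C⁻¹ turns h = C Cᴴ into the identity and the trace with respect to h
  -- into the ordinary trace.
  have h1 := nakano_add_trace_nonneg (P := fun j k => C⁻¹ * P j k * (C⁻¹).conjTranspose)
    (fun u v => by
      rw [sum_griffiths_eq]
      exact hP.congruence C⁻¹ u v) (fun j => Matrix.vecMul (w j) C)
  have e1 (j k : Fin n) : (∑ α, ∑ β, (C⁻¹ * P j k * (C⁻¹).conjTranspose) α β *
      (Matrix.vecMul (w j) C α * conj (Matrix.vecMul (w k) C β))) = sesq (P j k) (w j) (w k) := by
    change sesq (C⁻¹ * P j k * (C⁻¹).conjTranspose) _ _ = _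
    rw [← sesq_congruence, Matrix.conjTranspose_nonsing_inv, ← Matrix.mul_assoc,
      Matrix.mul_nonsing_inv_cancel_left _ _ hC, Matrix.nonsing_inv_mul_cancel_right _ _ hC']
  have e2 (j k : Fin n) : ∑ γ, Matrix.vecMul (w j) C γ * conj (Matrix.vecMul (w k) C γ) =
      sesq (C * C.conjTranspose) (w j) (w k) := by
    rw [← sesq_one, ← sesq_congruence, Matrix.mul_one]
  have e3 (j k : Fin n) : (C⁻¹ * P j k * (C⁻¹).conjTranspose).trace =
      ((C * C.conjTranspose)⁻¹ * P j k).trace := by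
    rw [Matrix.mul_assoc, Matrix.trace_mul_comm, Matrix.mul_assoc, Matrix.trace_mul_comm,
      Matrix.mul_inv_rev, Matrix.conjTranspose_nonsing_inv]
  simp only [e1, e2, e3] at h1
  simpa only [sesq_add, sesq_smul] using h1

/-- Cauchy-Schwarz for the entries of `D`, in terms of the trace of `D h Dᴴ`. -/
theorem norm_sq_apply_le_trace (hh : h.PosDef) (D : Matrix (Fin r) (Fin r) ℂ) (α β : Fin r) :
    ‖D α β‖ ^ 2 ≤ (D * h * D.conjTranspose).trace.re * (h⁻¹).trace.re := by
  obtain ⟨C, hC, rfl⟩ := exists_mul_conjTranspose_eq hh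
  -- Both traces are squared Hilbert-Schmidt norms, of D C and of C⁻¹; the bound is then
  -- Cauchy-Schwarz for D = (D C) C⁻¹.
  have htr (A : Matrix (Fin r) (Fin r) ℂ) :
      (A * A.conjTranspose).trace.re = ∑ α, ∑ γ, ‖A α γ‖ ^ 2 := by
    rw [Matrix.trace, Complex.re_sum]
    refine Finset.sum_congr rfl fun α _ => ?_
    rw [Matrix.diag, Matrix.mul_apply, Complex.re_sum]
    refine Finset.sum_congr rfl fun γ _ => ?_
    rw [Matrix.conjTranspose_apply, RCLike.star_def, Complex.mul_conj']
    exact_mod_cast rfl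
  have h1 : D * (C * C.conjTranspose) * D.conjTranspose = (D * C) * (D * C).conjTranspose := by
    simp only [Matrix.conjTranspose_mul, Matrix.mul_assoc]
  have h2 : ((C * C.conjTranspose)⁻¹).trace = (C⁻¹ * (C⁻¹).conjTranspose).trace := by
    rw [Matrix.mul_inv_rev, Matrix.trace_mul_comm, Matrix.conjTranspose_nonsing_inv]
  have h3 : D α β = ∑ γ, (D * C) α γ * C⁻¹ γ β := by
    rw [← Matrix.mul_apply, Matrix.mul_nonsing_inv_cancel_right _ _ hC]
  rw [h1, h2, htr, htr, h3]
  calc ‖∑ γ, (D * C) α γ * C⁻¹ γ β‖ ^ 2 ≤ (∑ γ, ‖(D * C) α γ‖ * ‖C⁻¹ γ β‖) ^ 2 := by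
        gcongr
        exact (norm_sum_le _ _).trans (Finset.sum_le_sum fun γ _ => (norm_mul_le _ _))
    _ ≤ (∑ γ, ‖(D * C) α γ‖ ^ 2) * ∑ γ, ‖C⁻¹ γ β‖ ^ 2 := Finset.sum_mul_sq_le_sq_mul_sq _ _ _
    _ ≤ _ := by
        refine mul_le_mul ?_ (Finset.sum_le_sum fun γ _ => ?_) (by positivity) (by positivity)
        · exact Finset.single_le_sum (f := fun α => ∑ γ, ‖(D * C) α γ‖ ^ 2)
            (fun α _ => by positivity) (Finset.mem_univ α)
        · exact Finset.single_le_sum (f := fun β => ‖C⁻¹ γ β‖ ^ 2)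
            (fun α _ => by positivity) (Finset.mem_univ β)

theorem trace_mul_conjTranspose_nonneg (hh : h.PosDef) (D : Matrix (Fin r) (Fin r) ℂ) :
    0 ≤ (D * h * D.conjTranspose).trace.re :=
  (Complex.le_def.1 (hh.posSemidef.mul_mul_conjTranspose_same D).trace_nonneg).1

end LinearAlgebra


/-! ## The sub-mean value property -/

section SubMeanValue

variable {φ : ℂ → ℝ}

/-- The point `e^{iθ}` of the unit circle. -/
def circ (θ : ℝ) : ℂ := Complex.exp (θ * Complex.I)

theorem continuous_circ : Continuous circ := by
  unfold circ
  fun_prop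

theorem norm_circ (θ : ℝ) : ‖circ θ‖ = 1 := Complex.norm_exp_ofReal_mul_I θ

theorem hasDerivAt_circ (θ : ℝ) : HasDerivAt circ (Complex.I * circ θ) θ := by
  have := ((Complex.ofRealCLM.hasDerivAt (x := θ)).mul_const Complex.I).cexp
  refine this.congr_deriv ?_
  rw [Complex.ofRealCLM_apply, Complex.ofRealCLM_apply, Complex.ofReal_one, one_mul, mul_comm]
  rfl

theorem circ_periodic : circ (2 * Real.pi) = circ 0 := by
  simp [circ]

theorem ContDiff.differentiable_fderiv_of_infty (hφ : ContDiff ℝ ∞ φ) :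
    Differentiable ℝ (fderiv ℝ φ) :=
  (hφ.fderiv_right (m := ∞) (by simp)).differentiable (by simp)

/-- The trace of a bilinear form is invariant under the rotation that takes (1, i) to (e^{iθ}, i
e^{iθ}). -/
theorem sesquilinear_laplacian (B : ℂ →L[ℝ] ℂ →L[ℝ] ℝ) (θ : ℝ) :
    B (circ θ) (circ θ) + B (Complex.I * circ θ) (Complex.I * circ θ) =
      B 1 1 + B Complex.I Complex.I := by
  have h1 : circ θ = Real.cos θ • (1 : ℂ) + Real.sin θ • Complex.I := by
    rw [circ, Complex.exp_mul_I]
    simp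
  have h2 : Complex.I * circ θ = (-Real.sin θ) • (1 : ℂ) + Real.cos θ • Complex.I := by
    rw [h1]
    apply Complex.ext <;> simp
  rw [h2, h1]
  simp only [map_add, map_smul, _root_.add_apply, _root_.smul_apply, smul_eq_mul]
  linear_combination (B 1 1 + B Complex.I Complex.I) * Real.sin_sq_add_cos_sq θ

/-- In polar coordinates ρΔφ = ∂_ρ(ρ ∂_ρ φ) + ρ⁻¹ ∂_θ² φ. The last term is the θ-derivative of a
periodic function, so it integrates to zero; writing it through `fderiv` avoids dividing by ρ. -/
theorem integral_angular_eq (hφ : ContDiff ℝ ∞ φ) (ρ : ℝ) :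
    ∫ θ in (0 : ℝ)..(2 * Real.pi), (fderiv ℝ φ (ρ * circ θ) (circ θ) +
      fderiv ℝ (fderiv ℝ φ) (ρ * circ θ) (ρ * circ θ) (circ θ)) =
    ρ * ∫ θ in (0 : ℝ)..(2 * Real.pi), (fderiv ℝ (fderiv ℝ φ) (ρ * circ θ) 1 1 +
      fderiv ℝ (fderiv ℝ φ) (ρ * circ θ) Complex.I Complex.I) := by
  have hc1 : Continuous (fderiv ℝ φ) := hφ.continuous_fderiv (by simp)
  have hc2 : Continuous (fderiv ℝ (fderiv ℝ φ)) :=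
    (hφ.fderiv_right (m := ∞) (by simp)).continuous_fderiv (by simp)
  have hcirc := continuous_circ
  have hd (θ : ℝ) : HasDerivAt (fun θ => fderiv ℝ φ (ρ * circ θ) (Complex.I * circ θ))
      (ρ * fderiv ℝ (fderiv ℝ φ) (ρ * circ θ) (Complex.I * circ θ) (Complex.I * circ θ)
        - fderiv ℝ φ (ρ * circ θ) (circ θ)) θ := by
    have h1 : HasDerivAt (fun θ => (ρ : ℂ) * circ θ) (ρ * (Complex.I * circ θ)) θ :=
      (hasDerivAt_circ θ).const_mul _
    have h2 := ((ContDiff.differentiable_fderiv_of_infty hφ _).hasFDerivAt.comp_hasDerivAt θ h1)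
    have h3 := h2.clm_apply ((hasDerivAt_circ θ).const_mul Complex.I)
    refine h3.congr_deriv ?_
    have e1 : Complex.I * (Complex.I * circ θ) = - circ θ := by
      rw [← mul_assoc, Complex.I_mul_I, neg_one_mul]
    rw [e1, ← Complex.real_smul (z := Complex.I * circ θ), map_smul, map_neg, ← sub_eq_add_neg]
    rfl
  have hcd : Continuous fun θ => ρ * fderiv ℝ (fderiv ℝ φ) (ρ * circ θ) (Complex.I * circ θ)
      (Complex.I * circ θ) - fderiv ℝ φ (ρ * circ θ) (circ θ) := by
    fun_prop
  have h0 := intervalIntegral.integral_eq_sub_of_hasDerivAt (fun θ _ => hd θ)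
    (hcd.intervalIntegrable 0 (2 * Real.pi))
  rw [circ_periodic, sub_self] at h0
  have hcf : Continuous fun θ => fderiv ℝ φ (ρ * circ θ) (circ θ) +
      fderiv ℝ (fderiv ℝ φ) (ρ * circ θ) (ρ * circ θ) (circ θ) := by
    fun_prop
  rw [← intervalIntegral.integral_const_mul]
  refine (add_zero _).symm.trans ((congrArg _ h0.symm).trans ?_)
  rw [← intervalIntegral.integral_add (hcf.intervalIntegrable _ _) (hcd.intervalIntegrable _ _)]
  refine intervalIntegral.integral_congr fun θ _ => ?_
  rw [← sesquilinear_laplacian (fderiv ℝ (fderiv ℝ φ) (ρ * circ θ)) θ, ← Complex.real_smul (x := ρ)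
    (z := circ θ), map_smul]
  simp only [_root_.smul_apply, smul_eq_mul]
  ring

/-- The radial derivative of the circle averages of a subharmonic function is nonnegative. -/
theorem integral_radial_nonneg (hφ : ContDiff ℝ ∞ φ)
    (hsub : ∀ w, ‖w‖ ≤ 1 → 0 ≤ fderiv ℝ (fderiv ℝ φ) w 1 1 +
      fderiv ℝ (fderiv ℝ φ) w Complex.I Complex.I) {R : ℝ} (hR0 : 0 < R) (hR1 : R ≤ 1) :
    0 ≤ ∫ θ in (0 : ℝ)..(2 * Real.pi), fderiv ℝ φ (R * circ θ) (circ θ) := by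
  have hc1 : Continuous (fderiv ℝ φ) := hφ.continuous_fderiv (by simp)
  have hc2 : Continuous (fderiv ℝ (fderiv ℝ φ)) :=
    (hφ.fderiv_right (m := ∞) (by simp)).continuous_fderiv (by simp)
  have hcirc := continuous_circ
  have hd (θ ρ : ℝ) : HasDerivAt (fun ρ : ℝ => ρ * fderiv ℝ φ (ρ * circ θ) (circ θ))
      (fderiv ℝ φ (ρ * circ θ) (circ θ) +
        fderiv ℝ (fderiv ℝ φ) (ρ * circ θ) (ρ * circ θ) (circ θ)) ρ := by
    have h1 : HasDerivAt (fun ρ : ℝ => (ρ : ℂ) * circ θ) (1 * circ θ) ρ :=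
      (Complex.ofRealCLM.hasDerivAt (x := ρ)).mul_const _
    have h2 := ((ContDiff.differentiable_fderiv_of_infty hφ _).hasFDerivAt.comp_hasDerivAt ρ h1)
    have h3 := (hasDerivAt_id ρ).mul (h2.clm_apply (hasDerivAt_const ρ (circ θ)))
    refine h3.congr_deriv ?_
    rw [← Complex.real_smul (x := ρ) (z := circ θ), map_smul]
    simp
  have hF : Continuous (Function.uncurry fun ρ θ : ℝ => fderiv ℝ φ (ρ * circ θ) (circ θ) +
      fderiv ℝ (fderiv ℝ φ) (ρ * circ θ) (ρ * circ θ) (circ θ)) := by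
    unfold Function.uncurry
    fun_prop
  -- The inner integrand is ∂_ρ(ρ ∂_ρ φ); integrating it in ρ leaves no boundary term at ρ = 0.
  have hint : R * ∫ θ in (0 : ℝ)..(2 * Real.pi), fderiv ℝ φ (R * circ θ) (circ θ) =
      ∫ ρ in (0 : ℝ)..R, ∫ θ in (0 : ℝ)..(2 * Real.pi), (fderiv ℝ φ (ρ * circ θ) (circ θ) +
        fderiv ℝ (fderiv ℝ φ) (ρ * circ θ) (ρ * circ θ) (circ θ)) := by
    rw [intervalIntegral_intervalIntegral_swap, ← intervalIntegral.integral_const_mul]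
    · refine intervalIntegral.integral_congr fun θ _ => ?_
      rw [intervalIntegral.integral_eq_sub_of_hasDerivAt (fun ρ _ => hd θ ρ)
        ((hF.comp (continuous_id.prodMk continuous_const)).intervalIntegrable _ _)]
      simp
    · exact ((hF.continuousOn.integrableOn_compact (isCompact_uIcc.prod isCompact_uIcc)).mono_set
        (prod_mono uIoc_subset_uIcc uIoc_subset_uIcc))
  refine nonneg_of_mul_nonneg_right (a := R) ?_ hR0
  rw [hint]
  refine intervalIntegral.integral_nonneg hR0.le fun ρ hρ => ?_
  rw [integral_angular_eq hφ]
  refine mul_nonneg hρ.1 (intervalIntegral.integral_nonneg (by positivity) fun θ _ => hsub _ ?_)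
  rw [norm_mul, norm_circ, mul_one, Complex.norm_real, Real.norm_of_nonneg hρ.1]
  exact hρ.2.trans hR1

/-- The sub-mean value property of smooth subharmonic functions. -/
theorem sub_mean_value (hφ : ContDiff ℝ ∞ φ)
    (hsub : ∀ w, ‖w‖ ≤ 1 → 0 ≤ fderiv ℝ (fderiv ℝ φ) w 1 1 +
      fderiv ℝ (fderiv ℝ φ) w Complex.I Complex.I) :
    2 * Real.pi * φ 0 ≤ ∫ θ in (0 : ℝ)..(2 * Real.pi), φ (circ θ) := by
  have hc1 : Continuous (fderiv ℝ φ) := hφ.continuous_fderiv (by simp)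
  have hcirc := continuous_circ
  have hd (θ ρ : ℝ) : HasDerivAt (fun ρ : ℝ => φ (ρ * circ θ))
      (fderiv ℝ φ (ρ * circ θ) (circ θ)) ρ := by
    have h1 : HasDerivAt (fun ρ : ℝ => (ρ : ℂ) * circ θ) (1 * circ θ) ρ :=
      (Complex.ofRealCLM.hasDerivAt (x := ρ)).mul_const _
    rw [one_mul] at h1
    exact (hφ.differentiable (by simp) _).hasFDerivAt.comp_hasDerivAt ρ h1
  have hF : Continuous (Function.uncurry fun ρ θ : ℝ => fderiv ℝ φ (ρ * circ θ) (circ θ)) := by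
    unfold Function.uncurry
    fun_prop
  have hφc : Continuous fun θ => φ (circ θ) := hφ.continuous.comp hcirc
  have hint : (∫ θ in (0 : ℝ)..(2 * Real.pi), φ (circ θ)) - 2 * Real.pi * φ 0 =
      ∫ ρ in (0 : ℝ)..1, ∫ θ in (0 : ℝ)..(2 * Real.pi), fderiv ℝ φ (ρ * circ θ) (circ θ) := by
    have h1 : 2 * Real.pi * φ 0 = ∫ _ in (0 : ℝ)..(2 * Real.pi), φ 0 := by simp
    rw [intervalIntegral_intervalIntegral_swap, h1, ← intervalIntegral.integral_sub
      (hφc.intervalIntegrable _ _) (by simp)]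
    · refine intervalIntegral.integral_congr fun θ _ => ?_
      rw [intervalIntegral.integral_eq_sub_of_hasDerivAt (fun ρ _ => hd θ ρ)
        ((hF.comp (continuous_id.prodMk continuous_const)).intervalIntegrable _ _)]
      simp
    · exact ((hF.continuousOn.integrableOn_compact (isCompact_uIcc.prod isCompact_uIcc)).mono_set
        (prod_mono uIoc_subset_uIcc uIoc_subset_uIcc))
  have h2 : 0 ≤ ∫ ρ in (0 : ℝ)..1, ∫ θ in (0 : ℝ)..(2 * Real.pi),
      fderiv ℝ φ (ρ * circ θ) (circ θ) := by
    rw [intervalIntegral.integral_of_le zero_le_one]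
    exact setIntegral_nonneg measurableSet_Ioc fun ρ hρ => integral_radial_nonneg hφ hsub hρ.1 hρ.2
  linarith

theorem fderiv_fderiv_line {n : ℕ} {f : (Fin n → ℂ) → ℝ} (hf : ContDiff ℝ ∞ f)
    (z₀ ζ : Fin n → ℂ) (w u v : ℂ) :
    fderiv ℝ (fderiv ℝ fun w : ℂ => f (z₀ + w • ζ)) w u v =
      fderiv ℝ (fderiv ℝ f) (z₀ + w • ζ) (u • ζ) (v • ζ) := by
  have hg (w : ℂ) : HasFDerivAt (fun w : ℂ => z₀ + w • ζ)
      ((ContinuousLinearMap.id ℝ ℂ).smulRight ζ) w :=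
    ((ContinuousLinearMap.id ℝ ℂ).smulRight ζ).hasFDerivAt.const_add z₀
  have hφ : ContDiff ℝ ∞ fun w : ℂ => f (z₀ + w • ζ) := by fun_prop
  have h1 (v : ℂ) : (fun y => fderiv ℝ (fun w : ℂ => f (z₀ + w • ζ)) y v) =
      fun y => fderiv ℝ f (z₀ + y • ζ) (v • ζ) := by
    funext y
    exact DFunLike.congr_fun
      (((hf.differentiable (by simp) _).hasFDerivAt.comp y (hg y)).fderiv) v
  have hd : Differentiable ℝ fun z => fderiv ℝ f z (v • ζ) :=
    ((hf.fderiv_right (m := ∞) (by simp)).differentiable (by simp)).clm_apply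
      (differentiable_const _)
  rw [← fderiv_fderiv_apply hφ.contDiffAt, h1, ← fderiv_fderiv_apply hf.contDiffAt]
  exact DFunLike.congr_fun (((hd _).hasFDerivAt.comp w (hg w)).fderiv) u

theorem measurePreserving_add_smul {n : ℕ} (z₀ : Fin n → ℂ) {c : ℂ} (hc : ‖c‖ = 1) :
    MeasurePreserving (fun ζ : Fin n → ℂ => z₀ + c • ζ) := by
  have h1 : MeasurePreserving (fun z : ℂ => c * z) :=
    (rotation ⟨c, mem_sphere_zero_iff_norm.2 hc⟩).measurePreserving
  exact (measurePreserving_add_left volume z₀).comp (volume_preserving_pi fun _ : Fin n => h1)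

/-- The sub-mean value property on polydiscs of smooth plurisubharmonic functions. -/
theorem sub_mean_value_closedBall {n : ℕ} {f : (Fin n → ℂ) → ℝ} (hf : ContDiff ℝ ∞ f)
    (z₀ : Fin n → ℂ) {ρ : ℝ}
    (hsub : ∀ z ∈ Metric.closedBall z₀ ρ, ∀ ζ, 0 ≤ fderiv ℝ (fderiv ℝ f) z ζ ζ +
      fderiv ℝ (fderiv ℝ f) z (Complex.I • ζ) (Complex.I • ζ)) :
    volume.real (Metric.closedBall z₀ ρ) * f z₀ ≤ ∫ z in Metric.closedBall z₀ ρ, f z := by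
  have hcirc := continuous_circ
  have hfc := hf.continuous
  -- Apply the one-variable inequality on the complex line w ↦ z₀ + w ζ, whose closed unit disc
  -- stays in the polydisc.
  have h1 : ∀ ζ ∈ Metric.closedBall (0 : Fin n → ℂ) ρ,
      2 * Real.pi * f z₀ ≤ ∫ θ in (0 : ℝ)..(2 * Real.pi), f (z₀ + circ θ • ζ) := by
    intro ζ hζ
    have hφ : ContDiff ℝ ∞ fun w : ℂ => f (z₀ + w • ζ) := by fun_prop
    have := sub_mean_value hφ fun w hw => by
      rw [fderiv_fderiv_line hf, fderiv_fderiv_line hf, one_smul]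
      refine hsub _ ?_ ζ
      rw [mem_closedBall_iff_norm, add_sub_cancel_left, norm_smul]
      rw [mem_closedBall_zero_iff] at hζ
      exact (mul_le_of_le_one_left (norm_nonneg _) hw).trans hζ
    simpa using this
  -- The polydisc and Lebesgue measure are invariant under ζ ↦ e^{iθ} ζ, so averaging over ζ makes
  -- the circle integral independent of θ.
  have h2 (θ : ℝ) : ∫ ζ in Metric.closedBall (0 : Fin n → ℂ) ρ, f (z₀ + circ θ • ζ) =
      ∫ z in Metric.closedBall z₀ ρ, f z := by
    have hpre : (fun ζ : Fin n → ℂ => z₀ + circ θ • ζ) ⁻¹' Metric.closedBall z₀ ρ =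
        Metric.closedBall 0 ρ := by
      ext ζ
      simp [norm_smul, norm_circ]
    have hne : circ θ ≠ 0 := by
      rw [← norm_ne_zero_iff, norm_circ]
      exact one_ne_zero
    have hemb : MeasurableEmbedding (fun ζ : Fin n → ℂ => z₀ + circ θ • ζ) :=
      ((Homeomorph.smulOfNeZero (circ θ) hne).trans (Homeomorph.addLeft z₀)).measurableEmbedding
    rw [← hpre]
    exact (measurePreserving_add_smul z₀ (norm_circ θ)).setIntegral_preimage_emb hemb f _
  have hvol : volume.real (Metric.closedBall (0 : Fin n → ℂ) ρ) =
      volume.real (Metric.closedBall z₀ ρ) := by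
    simp only [Measure.real, ← Measure.addHaar_closedBall_center volume z₀ ρ]
  have hF : Continuous (Function.uncurry fun (θ : ℝ) (ζ : Fin n → ℂ) => f (z₀ + circ θ • ζ)) := by
    unfold Function.uncurry
    fun_prop
  have hK : IsCompact (Metric.closedBall (0 : Fin n → ℂ) ρ) := isCompact_closedBall _ _
  have h3 : ∫ ζ in Metric.closedBall (0 : Fin n → ℂ) ρ,
      ∫ θ in (0 : ℝ)..(2 * Real.pi), f (z₀ + circ θ • ζ) =
      2 * Real.pi * ∫ z in Metric.closedBall z₀ ρ, f z := by
    rw [← intervalIntegral_integral_swap]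
    · simp only [h2]
      simp
    · rw [Measure.prod_restrict]
      exact (hF.continuousOn.integrableOn_compact (isCompact_uIcc.prod hK)).mono_set
        (prod_mono uIoc_subset_uIcc subset_rfl)
  have h4 : ∫ _ in Metric.closedBall (0 : Fin n → ℂ) ρ, 2 * Real.pi * f z₀ ≤
      ∫ ζ in Metric.closedBall (0 : Fin n → ℂ) ρ,
        ∫ θ in (0 : ℝ)..(2 * Real.pi), f (z₀ + circ θ • ζ) := by
    refine setIntegral_mono_on (integrableOn_const hK.measure_lt_top.ne) ?_
      Metric.isClosed_closedBall.measurableSet h1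
    exact (intervalIntegral.continuous_parametric_intervalIntegral_of_continuous'
      (f := fun (ζ : Fin n → ℂ) (θ : ℝ) => f (z₀ + circ θ • ζ))
      (hF.comp continuous_swap) _ _).continuousOn.integrableOn_compact hK
  rw [h3, setIntegral_const, hvol, smul_eq_mul] at h4
  have := Real.pi_pos
  nlinarith

end SubMeanValue


/-! ## Test functions, integration by parts and limits of order zero -/

section TestFunctions

variable {n : ℕ} {Ω : Opens (Fin n → ℂ)}

/-- A continuous function with compact support in `Ω`. -/
def IsTest (Ω : Opens (Fin n → ℂ)) (f : (Fin n → ℂ) → ℂ) : Prop :=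
  Continuous f ∧ HasCompactSupport f ∧ tsupport f ⊆ (Ω : Set (Fin n → ℂ))

theorem isTest_coe {m : ℕ∞} (f : 𝓓^{m}(Ω, ℂ)) : IsTest Ω f :=
  ⟨f.continuous, f.hasCompactSupport, f.tsupport_subset⟩

theorem coe_toTest {f : (Fin n → ℂ) → ℂ} (hf : IsTest Ω f) : ⇑(toTest Ω f) = f := by
  rw [toTest, dif_pos (show Continuous f ∧ HasCompactSupport f ∧ tsupport f ⊆ (Ω : Set _) from hf)]
  rfl

theorem IsTest.wirt {f : (Fin n → ℂ) → ℂ} (hf : IsTest Ω f) (hs : ContDiff ℝ ∞ f) (c : ℂ)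
    (j : Fin n) : IsTest Ω (wirt c j f) :=
  ⟨(contDiff_wirt hs).continuous, hf.2.1.mono' (subset_tsupport _ |>.trans tsupport_wirt_subset),
    tsupport_wirt_subset.trans hf.2.2⟩

theorem IsTest.mul_continuousOn {f : (Fin n → ℂ) → ℂ} (hf : IsTest Ω f) {g : (Fin n → ℂ) → ℂ}
    (hg : ContinuousOn g Ω) : IsTest Ω (fun z => g z * f z) := by
  have hsub : tsupport (fun z => g z * f z) ⊆ tsupport f := tsupport_mul_subset_right
  exact ⟨(hg.mul hf.1.continuousOn).continuous_of_tsupport_subset Ω.isOpen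
    (hsub.trans hf.2.2), hf.2.1.mul_left, hsub.trans hf.2.2⟩

theorem IsTest.continuousOn_mul {f : (Fin n → ℂ) → ℂ} (hf : IsTest Ω f) {g : (Fin n → ℂ) → ℂ}
    (hg : ContinuousOn g Ω) : IsTest Ω (fun z => f z * g z) := by
  simpa only [mul_comm] using hf.mul_continuousOn hg

theorem IsTest.integrable {f : (Fin n → ℂ) → ℂ} (hf : IsTest Ω f) : Integrable f :=
  hf.1.integrable_of_hasCompactSupport hf.2.1

theorem IsTest.setIntegral_eq {f : (Fin n → ℂ) → ℂ} (hf : IsTest Ω f) :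
    ∫ z in (Ω : Set (Fin n → ℂ)), f z = ∫ z, f z :=
  setIntegral_eq_integral_of_forall_compl_eq_zero fun _ hz =>
    image_eq_zero_of_notMem_tsupport fun h => hz (hf.2.2 h)

theorem exists_cutoff {K : Set (Fin n → ℂ)} (hK : IsCompact K) (hKΩ : K ⊆ Ω) :
    ∃ χ : (Fin n → ℂ) → ℝ, ContDiff ℝ ∞ χ ∧ HasCompactSupport χ ∧
      tsupport χ ⊆ (Ω : Set (Fin n → ℂ)) ∧ (∀ z, χ z ∈ Icc (0 : ℝ) 1) ∧ ∀ᶠ z in 𝓝ˢ K, χ z = 1 := by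
  obtain ⟨K', hK', hKK', hK'Ω⟩ := exists_compact_between hK Ω.isOpen hKΩ
  obtain ⟨χ, h1, h0, h01⟩ := exists_contMDiffMap_one_nhds_of_subset_interior
    (𝓘(ℝ, Fin n → ℂ)) (n := ⊤) hK.isClosed hKK'
  have hsub : tsupport χ ⊆ K' := closure_minimal (fun z hz => by
    by_contra h
    exact hz (h0 z h)) hK'.isClosed
  exact ⟨χ, χ.contMDiff.contDiff, hK'.of_isClosed_subset (isClosed_tsupport _) hsub,
    hsub.trans hK'Ω, h01, h1⟩

theorem isTest_fderiv_apply {ψ : (Fin n → ℂ) → ℂ} (hψ : IsTest Ω ψ) (hs : ContDiff ℝ ∞ ψ)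
    (v : Fin n → ℂ) : IsTest Ω (fun z => fderiv ℝ ψ z v) :=
  ⟨(hs.continuous_fderiv (by simp)).clm_apply continuous_const,
    hψ.2.1.fderiv_apply ℝ v, (tsupport_fderiv_apply_subset ℝ v).trans hψ.2.2⟩

/-- Integration by parts against a test function. -/
theorem setIntegral_wirt_mul {F ψ : (Fin n → ℂ) → ℂ} (hF : ContDiffOn ℝ ∞ F Ω)
    (hψ : IsTest Ω ψ) (hs : ContDiff ℝ ∞ ψ) (c : ℂ) (j : Fin n) :
    ∫ z in (Ω : Set (Fin n → ℂ)), wirt c j F z * ψ z =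
      - ∫ z in (Ω : Set (Fin n → ℂ)), F z * wirt c j ψ z := by
  have hF' (v : Fin n → ℂ) : ContinuousOn (fun z => fderiv ℝ F z v) Ω :=
    (hF.continuousOn_fderiv_of_isOpen Ω.isOpen (by simp)).clm_apply continuousOn_const
  have h1 (v : Fin n → ℂ) : ∫ z, F z * fderiv ℝ ψ z v = - ∫ z, fderiv ℝ F z v * ψ z :=
    integral_mul_fderiv_eq_neg_fderiv_mul_of_integrable (hψ.mul_continuousOn (hF' v)).integrable
      ((isTest_fderiv_apply hψ hs v).mul_continuousOn hF.continuousOn).integrable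
      (hψ.mul_continuousOn hF.continuousOn).integrable
      (fun z hz => (hF.contDiffAt (Ω.isOpen.mem_nhds (hψ.2.2 hz))).differentiableAt (by simp))
      (fun z _ => hs.differentiable (by simp) z)
  have hF'' := (contDiffOn_wirt (c := c) (j := j) Ω.isOpen hF).continuousOn
  rw [(hψ.mul_continuousOn hF'').setIntegral_eq,
    ((hψ.wirt hs c j).mul_continuousOn hF.continuousOn).setIntegral_eq]
  have e1 : (fun z => wirt c j F z * ψ z) = fun z => (1 / 2 : ℂ) *
      (fderiv ℝ F z (Pi.single j 1) * ψ z) + (c / 2) *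
        (fderiv ℝ F z (Pi.single j Complex.I) * ψ z) := by
    funext z
    rw [wirt]
    ring
  have e2 : (fun z => F z * wirt c j ψ z) = fun z => (1 / 2 : ℂ) *
      (F z * fderiv ℝ ψ z (Pi.single j 1)) + (c / 2) *
        (F z * fderiv ℝ ψ z (Pi.single j Complex.I)) := by
    funext z
    rw [wirt]
    ring
  rw [e1, e2, integral_add, integral_add, integral_const_mul, integral_const_mul,
    integral_const_mul, integral_const_mul, h1, h1]
  · ring
  · exact ((isTest_fderiv_apply hψ hs _).mul_continuousOn hF.continuousOn).integrable.const_mul _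
  · exact ((isTest_fderiv_apply hψ hs _).mul_continuousOn hF.continuousOn).integrable.const_mul _
  · exact (hψ.mul_continuousOn (hF' _)).integrable.const_mul _
  · exact (hψ.mul_continuousOn (hF' _)).integrable.const_mul _

/-- The integral of a product is controlled on the support of one of the factors. -/
theorem norm_setIntegral_mul_le {D f : (Fin n → ℂ) → ℂ} (hD : ContinuousOn D Ω) (hf : IsTest Ω f)
    {K : Set (Fin n → ℂ)} (hK : IsCompact K) (hKΩ : K ⊆ Ω) (hfK : ∀ z ∉ K, f z = 0)
    {δ : ℝ} (hfδ : ∀ z, ‖f z‖ ≤ δ) :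
    ‖∫ z in (Ω : Set (Fin n → ℂ)), D z * f z‖ ≤ δ * ∫ z in K, ‖D z‖ := by
  have h1 : ∫ z in (Ω : Set (Fin n → ℂ)), D z * f z = ∫ z in K, D z * f z := by
    rw [(hf.mul_continuousOn hD).setIntegral_eq]
    exact (setIntegral_eq_integral_of_forall_compl_eq_zero fun z hz => by simp [hfK z hz]).symm
  have hDK : IntegrableOn (fun z => ‖D z‖) K := (hD.mono hKΩ).norm.integrableOn_compact hK
  rw [h1, ← integral_const_mul]
  refine norm_integral_le_of_norm_le (hDK.const_mul δ) (Eventually.of_forall fun z => ?_)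
  rw [norm_mul, mul_comm]
  exact mul_le_mul_of_nonneg_right (hfδ z) (norm_nonneg _)

/-- The approximant lives on the support of f, so the L¹ bound on this one compact set serves for
both. -/
theorem exists_smooth_approx {f : (Fin n → ℂ) → ℂ} (hf : IsTest Ω f) {δ : ℝ} (hδ : 0 < δ) :
    ∃ ψ : 𝓓(Ω, ℂ), (∀ z, ‖f z - ψ z‖ ≤ δ) ∧ ∀ z ∉ tsupport f, ψ z = 0 := by
  obtain ⟨g, hg, hgf, hsupp⟩ := hf.1.exists_contDiff_approx ⊤ (continuous_const (y := δ))
    fun _ => hδ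
  have hsub : tsupport g ⊆ tsupport f := closure_mono hsupp
  refine ⟨⟨g, hg, hf.2.1.mono hsupp, hsub.trans hf.2.2⟩, fun z => ?_, fun z hz => ?_⟩
  · rw [← dist_eq_norm, dist_comm]
    exact (hgf z).le
  · exact image_eq_zero_of_notMem_tsupport fun h => hz (hsub h)

variable {D : ℕ → (Fin n → ℂ) → ℂ}

/-- Densities that are bounded in `L¹_loc` and converge as distributions converge weakly to a
distribution of order zero. -/
theorem exists_zeroOrderDistribution_limit (hD : ∀ m, ContinuousOn (D m) Ω)
    (hb : ∀ K : Set (Fin n → ℂ), IsCompact K → K ⊆ Ω → ∃ C : ℝ, ∀ m, ∫ z in K, ‖D m z‖ ≤ C)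
    (hconv : ∀ ψ : 𝓓(Ω, ℂ), ∃ l, Tendsto (fun m => ∫ z in (Ω : Set (Fin n → ℂ)), D m z * ψ z)
      atTop (𝓝 l)) :
    ∃ T : ZeroOrderDistribution Ω, ∀ f, IsTest Ω f →
      Tendsto (fun m => ∫ z in (Ω : Set (Fin n → ℂ)), D m z * f z) atTop (𝓝 (pair T f)) := by
  have hsub {f g : (Fin n → ℂ) → ℂ} (hf : IsTest Ω f) (hg : IsTest Ω g) (m : ℕ) :
      (∫ z in (Ω : Set (Fin n → ℂ)), D m z * f z) - ∫ z in (Ω : Set (Fin n → ℂ)), D m z * g z =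
      ∫ z in (Ω : Set (Fin n → ℂ)), D m z * (f z - g z) := by
    simp only [mul_sub]
    exact (integral_sub (hf.mul_continuousOn (hD m)).integrable.integrableOn
      (hg.mul_continuousOn (hD m)).integrable.integrableOn).symm
  have hlim (f : 𝓓^{0}(Ω, ℂ)) : ∃ l, Tendsto
      (fun m => ∫ z in (Ω : Set (Fin n → ℂ)), D m z * f z) atTop (𝓝 l) := by
    have hf := isTest_coe f
    obtain ⟨C, hC⟩ := hb (tsupport f) hf.2.1 hf.2.2
    -- The L¹ bound makes the functionals equicontinuous in the sup norm, so convergence on smooth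
    -- functions gives the Cauchy property on continuous ones, by an η/3 argument.
    refine cauchySeq_tendsto_of_complete (Metric.cauchySeq_iff.2 fun η hη => ?_)
    have hC0 : 0 ≤ C := (integral_nonneg fun _ => norm_nonneg _).trans (hC 0)
    obtain ⟨δ, hδ, hδC⟩ : ∃ δ > 0, δ * C < η / 3 :=
      ⟨η / (3 * (C + 1)), by positivity, by
        rw [div_mul_eq_mul_div, div_lt_div_iff₀ (by positivity) (by positivity)]
        nlinarith⟩
    obtain ⟨ψ, hψ, hψ0⟩ := exists_smooth_approx hf hδ
    obtain ⟨l, hl⟩ := hconv ψ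
    obtain ⟨N, hN⟩ := Metric.cauchySeq_iff.1 hl.cauchySeq (η / 3) (by positivity)
    have hψt := isTest_coe ψ
    have happ (m : ℕ) : dist (∫ z in (Ω : Set (Fin n → ℂ)), D m z * f z)
        (∫ z in (Ω : Set (Fin n → ℂ)), D m z * ψ z) < η / 3 := by
      rw [dist_eq_norm, hsub hf hψt]
      refine (norm_setIntegral_mul_le (hD m) (f := fun z => f z - ψ z) ?_ hf.2.1 hf.2.2
        (fun z hz => ?_) hψ).trans_lt ((mul_le_mul_of_nonneg_left (hC m) hδ.le).trans_lt hδC)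
      · have h1 : tsupport (fun z => f z - ψ z) ⊆ tsupport f := closure_minimal (fun z hz => by
          by_contra h
          exact hz (by simp [hψ0 z h, image_eq_zero_of_notMem_tsupport h])) (isClosed_tsupport _)
        exact ⟨hf.1.sub hψt.1, hf.2.1.of_isClosed_subset (isClosed_tsupport _) h1,
          h1.trans hf.2.2⟩
      · rw [hψ0 z hz, image_eq_zero_of_notMem_tsupport hz, sub_zero]
    refine ⟨N, fun a ha b hb => ?_⟩
    have h1 := happ a
    have h2 := happ b
    rw [dist_comm] at h2
    have h3 := dist_triangle4 (∫ z in (Ω : Set (Fin n → ℂ)), D a z * f z)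
      (∫ z in (Ω : Set (Fin n → ℂ)), D a z * ψ z) (∫ z in (Ω : Set (Fin n → ℂ)), D b z * ψ z)
      (∫ z in (Ω : Set (Fin n → ℂ)), D b z * f z)
    linarith [hN a ha b hb]
  choose T hT using hlim
  have hT_norm (f : 𝓓^{0}(Ω, ℂ)) {K : Set (Fin n → ℂ)} (hK : IsCompact K) (hKΩ : K ⊆ Ω)
      (hfK : ∀ z ∉ K, f z = 0) {C : ℝ} (hC : ∀ m, ∫ z in K, ‖D m z‖ ≤ C) {δ : ℝ}
      (hfδ : ∀ z, ‖f z‖ ≤ δ) : ‖T f‖ ≤ δ * C :=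
    le_of_tendsto (hT f).norm (Eventually.of_forall fun m =>
      (norm_setIntegral_mul_le (hD m) (isTest_coe f) hK hKΩ hfK hfδ).trans
        (mul_le_mul_of_nonneg_left (hC m) ((norm_nonneg _).trans (hfδ 0))))
  have hadd (f g : 𝓓^{0}(Ω, ℂ)) : T (f + g) = T f + T g := by
    refine tendsto_nhds_unique (hT (f + g)) (((hT f).add (hT g)).congr fun m => ?_)
    rw [← integral_add]
    · simp only [_root_.add_apply, mul_add]
    · exact ((isTest_coe f).mul_continuousOn (hD m)).integrable.integrableOn
    · exact ((isTest_coe g).mul_continuousOn (hD m)).integrable.integrableOn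
  have hsmul (c : ℂ) (f : 𝓓^{0}(Ω, ℂ)) : T (c • f) = c • T f := by
    refine tendsto_nhds_unique (hT (c • f)) (((hT f).const_smul c).congr fun m => ?_)
    rw [smul_eq_mul, ← integral_const_mul]
    refine integral_congr_ae (Eventually.of_forall fun z => ?_)
    simp only [_root_.smul_apply, smul_eq_mul]
    ring
  -- Continuity for the LF topology is checked on each space of functions supported in a fixed
  -- compact set, where |T f| ≤ ‖f‖_∞ C.
  refine ⟨TestFunction.mkCLM ℂ T hadd hsmul fun K hK => ?_, fun f hf => ?_⟩
  · obtain ⟨C, hC⟩ := hb K K.isCompact hK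
    let l : 𝓓^{0}_{K}(Fin n → ℂ, ℂ) →ₗ[ℂ] ℂ :=
      { toFun := fun f => T (TestFunction.ofSupportedIn hK f)
        map_add' := fun f g => hadd (TestFunction.ofSupportedIn hK f)
          (TestFunction.ofSupportedIn hK g)
        map_smul' := fun c f => hsmul c (TestFunction.ofSupportedIn hK f) }
    have hl (f : 𝓓^{0}_{K}(Fin n → ℂ, ℂ)) : ‖l f‖ ≤
        ‖ContDiffMapSupportedIn.toBoundedContinuousFunctionCLM ℂ f‖ * C :=
      hT_norm (TestFunction.ofSupportedIn hK f) K.isCompact hK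
        (fun z hz => ContDiffMapSupportedIn.zero_on_compl f hz) hC
        (fun z => BoundedContinuousFunction.norm_coe_le_norm
          (ContDiffMapSupportedIn.toBoundedContinuousFunctionCLM ℂ f) z)
    refine continuous_of_continuousAt_zero l ?_
    rw [ContinuousAt, map_zero]
    refine squeeze_zero_norm hl ?_
    have h1 : Continuous fun f : 𝓓^{0}_{K}(Fin n → ℂ, ℂ) =>
        ‖ContDiffMapSupportedIn.toBoundedContinuousFunctionCLM ℂ f‖ * C := by fun_prop
    have h2 := h1.tendsto 0
    rwa [map_zero, norm_zero, zero_mul] at h2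
  · have := hT (toTest Ω f)
    rwa [coe_toTest hf] at this

/-- Weak convergence tested against a uniformly convergent sequence of functions. -/
theorem tendsto_setIntegral_mul {f : ℕ → (Fin n → ℂ) → ℂ} {f₀ : (Fin n → ℂ) → ℂ} {l : ℂ}
    (hD : ∀ m, ContinuousOn (D m) Ω)
    (hb : ∀ K : Set (Fin n → ℂ), IsCompact K → K ⊆ Ω → ∃ C : ℝ, ∀ m, ∫ z in K, ‖D m z‖ ≤ C)
    (hf : ∀ m, IsTest Ω (f m)) (hf₀ : IsTest Ω f₀)
    {K : Set (Fin n → ℂ)} (hK : IsCompact K) (hKΩ : K ⊆ Ω) (hfK : ∀ m, ∀ z ∉ K, f m z = 0)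
    (hfK₀ : ∀ z ∉ K, f₀ z = 0) (hlim : TendstoUniformlyOn f f₀ atTop K)
    (hl : Tendsto (fun m => ∫ z in (Ω : Set (Fin n → ℂ)), D m z * f₀ z) atTop (𝓝 l)) :
    Tendsto (fun m => ∫ z in (Ω : Set (Fin n → ℂ)), D m z * f m z) atTop (𝓝 l) := by
  obtain ⟨C, hC⟩ := hb K hK hKΩ
  have hC0 : 0 ≤ C := (integral_nonneg fun _ => norm_nonneg _).trans (hC 0)
  have h0 : Tendsto (fun m => ∫ z in (Ω : Set (Fin n → ℂ)), D m z * (f m z - f₀ z)) atTop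
      (𝓝 0) := by
    refine Metric.tendsto_nhds.2 fun η hη => ?_
    obtain ⟨δ, hδ, hδC⟩ : ∃ δ > 0, δ * C < η :=
      ⟨η / (C + 1), by positivity, by
        rw [div_mul_eq_mul_div, div_lt_iff₀ (by positivity)]
        nlinarith⟩
    filter_upwards [Metric.tendstoUniformlyOn_iff.1 hlim δ hδ] with m hm
    rw [dist_zero_right]
    refine (norm_setIntegral_mul_le (hD m) (f := fun z => f m z - f₀ z) ?_ hK hKΩ
      (fun z hz => by rw [hfK m z hz, hfK₀ z hz, sub_zero]) (δ := δ) fun z => ?_).trans_lt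
        ((mul_le_mul_of_nonneg_left (hC m) hδ.le).trans_lt hδC)
    · have h1 : tsupport (fun z => f m z - f₀ z) ⊆ K := closure_minimal (fun z hz => by
        by_contra h
        exact hz (by simp [hfK m z h, hfK₀ z h])) hK.isClosed
      exact ⟨(hf m).1.sub hf₀.1, hK.of_isClosed_subset (isClosed_tsupport _) h1, h1.trans hKΩ⟩
    · by_cases hz : z ∈ K
      · have := hm z hz
        rw [dist_comm, dist_eq_norm] at this
        exact this.le
      · rw [hfK m z hz, hfK₀ z hz, sub_zero, norm_zero]
        exact hδ.le
  have := h0.add hl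
  rw [zero_add] at this
  refine this.congr fun m => ?_
  rw [← integral_add]
  · simp only [mul_sub, sub_add_cancel]
  · simp only [mul_sub]
    exact (((hf m).mul_continuousOn (hD m)).integrable.sub
      (hf₀.mul_continuousOn (hD m)).integrable).integrableOn
  · exact (hf₀.mul_continuousOn (hD m)).integrable.integrableOn

end TestFunctions


/-! ## Local `L¹` bounds for the curvature and for the derivatives of the dual metric -/

section LocalBounds

variable {n r : ℕ} {Ω : Opens (Fin n → ℂ)} {h : (Fin n → ℂ) → Matrix (Fin r) (Fin r) ℂ} {a : ℝ}
  {z : Fin n → ℂ}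

/-- The curvature coefficients, shifted by `a` times the standard metric tensor `h`. -/
def shiftedCurvature (h : (Fin n → ℂ) → Matrix (Fin r) (Fin r) ℂ) (a : ℝ) (z : Fin n → ℂ)
    (j k : Fin n) : Matrix (Fin r) (Fin r) ℂ :=
  curvature h j k z + (if j = k then (a : ℂ) else 0) • h z

/-- The function `∂_j ∂̄_j tr h⁻¹ + a tr h⁻¹`. -/
def dualLaplacian (h : (Fin n → ℂ) → Matrix (Fin r) (Fin r) ℂ) (a : ℝ) (j : Fin n)
    (z : Fin n → ℂ) : ℝ :=
  (wirt (-Complex.I) j (wirt Complex.I j fun w => ((h w)⁻¹).trace) z).re +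
    a * ((h z)⁻¹).trace.re

/-- A smooth, positive definite matrix on an open set. -/
structure IsMetricOn (Ω : Set (Fin n → ℂ)) (h : (Fin n → ℂ) → Matrix (Fin r) (Fin r) ℂ) :
    Prop where
  smooth : SmoothMatrixOn Ω h
  posDef : ∀ z ∈ Ω, (h z).PosDef

variable (H : IsMetricOn (Ω : Set (Fin n → ℂ)) h)

include H

theorem IsMetricOn.isUnit_det (hz : z ∈ Ω) : IsUnit (h z).det :=
  (Matrix.isUnit_iff_isUnit_det _).1 (H.posDef z hz).isUnit

theorem IsMetricOn.det_ne_zero (z) (hz : z ∈ (Ω : Set (Fin n → ℂ))) : (h z).det ≠ 0 :=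
  (H.isUnit_det hz).ne_zero

theorem IsMetricOn.conjTranspose (z) (hz : z ∈ (Ω : Set (Fin n → ℂ))) :
    (h z).conjTranspose = h z :=
  (H.posDef z hz).isHermitian

theorem IsMetricOn.conjTranspose_inv (z) (hz : z ∈ (Ω : Set (Fin n → ℂ))) :
    ((h z)⁻¹).conjTranspose = (h z)⁻¹ :=
  (H.posDef z hz).inv.isHermitian

theorem IsMetricOn.smooth_inv : SmoothMatrixOn (Ω : Set (Fin n → ℂ)) fun z => (h z)⁻¹ :=
  H.smooth.inv H.det_ne_zero

theorem IsMetricOn.trace_inv_nonneg (hz : z ∈ Ω) : 0 ≤ ((h z)⁻¹).trace.re :=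
  (Complex.le_def.1 (H.posDef z hz).inv.posSemidef.trace_nonneg).1

theorem IsMetricOn.conjTranspose_mwirt_inv (hz : z ∈ Ω) (j : Fin n) :
    (mwirt Complex.I j (fun w => (h w)⁻¹) z).conjTranspose =
      mwirt (-Complex.I) j (fun w => (h w)⁻¹) z := by
  rw [conjTranspose_mwirt Ω.isOpen hz H.conjTranspose_inv, Complex.conj_I]

/-- This is the trace of the formula for ∂_j ∂̄_j h⁻¹; the shift in the curvature accounts for the
term a tr h⁻¹. Under Griffiths semipositivity both summands are nonnegative, so a bound on the left
side bounds each of them. -/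
theorem IsMetricOn.dualLaplacian_eq (hz : z ∈ Ω) (j : Fin n) :
    dualLaplacian h a j z = ((h z)⁻¹ * shiftedCurvature h a z j j * (h z)⁻¹).trace.re +
      (mwirt Complex.I j (fun w => (h w)⁻¹) z * h z *
        (mwirt Complex.I j (fun w => (h w)⁻¹) z).conjTranspose).trace.re := by
  have h1 : wirt Complex.I j (fun w => ((h w)⁻¹).trace) =ᶠ[𝓝 z]
      fun w => (mwirt Complex.I j (fun w => (h w)⁻¹) w).trace := by
    filter_upwards [Ω.isOpen.mem_nhds hz] with w hw
    exact wirt_trace Ω.isOpen hw H.smooth_inv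
  rw [dualLaplacian, wirt_congr h1, wirt_trace Ω.isOpen hz (H.smooth_inv.mwirt Ω.isOpen),
    mwirt_mwirt_inv Ω.isOpen hz H.smooth H.det_ne_zero, H.conjTranspose_mwirt_inv hz,
    shiftedCurvature, if_pos rfl, mul_add, add_mul, Matrix.mul_smul,
    Matrix.nonsing_inv_mul _ (H.isUnit_det hz), Matrix.smul_mul, Matrix.one_mul,
    Matrix.trace_add, Matrix.trace_add, Matrix.trace_smul, Complex.add_re, Complex.add_re,
    smul_eq_mul, Complex.re_ofReal_mul]
  ring

variable (hG : GriffithsSemipos (shiftedCurvature h a z))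

include hG

theorem IsMetricOn.griffiths_inv (hz : z ∈ Ω) :
    GriffithsSemipos fun j k => (h z)⁻¹ * shiftedCurvature h a z j k * (h z)⁻¹ := by
  have := hG.congruence (h z)⁻¹
  rwa [H.conjTranspose_inv z hz] at this

theorem IsMetricOn.trace_curvature_nonneg (hz : z ∈ Ω) (j : Fin n) :
    0 ≤ ((h z)⁻¹ * shiftedCurvature h a z j j * (h z)⁻¹).trace.re := by
  rw [Matrix.trace, Complex.re_sum]
  exact Finset.sum_nonneg fun α _ => (H.griffiths_inv hG hz).apply_nonneg j α

theorem IsMetricOn.dualLaplacian_nonneg (hz : z ∈ Ω) (j : Fin n) : 0 ≤ dualLaplacian h a j z := by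
  rw [H.dualLaplacian_eq hz]
  exact add_nonneg (H.trace_curvature_nonneg hG hz j)
    (trace_mul_conjTranspose_nonneg (H.posDef z hz) _)

/-- Cauchy-Schwarz bounds the square of the entry by the product on the right. The inequality x ≤ 1
+ x² then removes the square root, so that the bound can be integrated with tr h⁻¹ bounded. -/
theorem IsMetricOn.norm_mwirt_inv_le (hz : z ∈ Ω) (j : Fin n) (α β : Fin r) :
    ‖mwirt Complex.I j (fun w => (h w)⁻¹) z α β‖ ≤
      1 + dualLaplacian h a j z * ((h z)⁻¹).trace.re := by
  have h1 := norm_sq_apply_le_trace (H.posDef z hz) (mwirt Complex.I j (fun w => (h w)⁻¹) z) α β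
  have h2 : (mwirt Complex.I j (fun w => (h w)⁻¹) z * h z *
      (mwirt Complex.I j (fun w => (h w)⁻¹) z).conjTranspose).trace.re ≤
      dualLaplacian h a j z := by
    rw [H.dualLaplacian_eq hz]
    linarith [H.trace_curvature_nonneg hG hz j]
  have h3 := mul_le_mul_of_nonneg_right h2 (H.trace_inv_nonneg hz)
  nlinarith [sq_nonneg (‖mwirt Complex.I j (fun w => (h w)⁻¹) z α β‖ - 1)]

/-- Write h⁻¹ R as (h⁻¹ R' h⁻¹) h minus a multiple of the identity, with R' the shifted curvature.
The form in parentheses is Griffiths semipositive, so its entries are at most twice its trace, which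
`dualLaplacian` dominates. Multiplication by h costs r B. -/
theorem IsMetricOn.norm_inv_mul_curvature_le (hz : z ∈ Ω) (ha : 0 ≤ a) (j k : Fin n)
    (α β : Fin r) {B : ℝ} (hB : ∀ α β, ‖h z α β‖ ≤ B) :
    ‖((h z)⁻¹ * curvature h j k z) α β‖ ≤
      a + 2 * r * B * ∑ j, dualLaplacian h a j z := by
  have hherm (j k : Fin n) : ((h z)⁻¹ * shiftedCurvature h a z j k * (h z)⁻¹).conjTranspose =
      (h z)⁻¹ * shiftedCurvature h a z k j * (h z)⁻¹ := by
    rw [Matrix.conjTranspose_mul, Matrix.conjTranspose_mul, H.conjTranspose_inv z hz,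
      shiftedCurvature, shiftedCurvature, Matrix.conjTranspose_add, Matrix.conjTranspose_smul,
      conjTranspose_curvature Ω.isOpen hz H.smooth H.conjTranspose, H.conjTranspose z hz,
      Matrix.mul_assoc]
    congr 4
    by_cases hjk : j = k
    · simp [hjk]
    · simp [hjk, Ne.symm hjk]
  have hX (α γ : Fin r) : ‖((h z)⁻¹ * shiftedCurvature h a z j k * (h z)⁻¹) α γ‖ ≤
      2 * ∑ j, dualLaplacian h a j z := by
    refine ((H.griffiths_inv hG hz).norm_apply_le hherm j k α γ).trans ?_
    refine mul_le_mul_of_nonneg_left (Finset.sum_le_sum fun j _ => ?_) zero_le_two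
    rw [H.dualLaplacian_eq hz]
    linarith [trace_mul_conjTranspose_nonneg (H.posDef z hz)
      (mwirt Complex.I j (fun w => (h w)⁻¹) z)]
  have h1 : (h z)⁻¹ * curvature h j k z =
      ((h z)⁻¹ * shiftedCurvature h a z j k * (h z)⁻¹) * h z -
        (if j = k then (a : ℂ) else 0) • (1 : Matrix (Fin r) (Fin r) ℂ) := by
    rw [Matrix.nonsing_inv_mul_cancel_right _ _ (H.isUnit_det hz), shiftedCurvature, mul_add,
      Matrix.mul_smul, Matrix.nonsing_inv_mul _ (H.isUnit_det hz), add_sub_cancel_right]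
  have h2 : ‖((if j = k then (a : ℂ) else 0) • (1 : Matrix (Fin r) (Fin r) ℂ)) α β‖ ≤ a := by
    rw [Matrix.smul_apply, Matrix.one_apply]
    split_ifs <;> simp [abs_of_nonneg ha, ha]
  rw [h1, Matrix.sub_apply, Matrix.mul_apply]
  refine (norm_sub_le _ _).trans ?_
  rw [add_comm]
  refine add_le_add h2 ((norm_sum_le _ _).trans ?_)
  calc ∑ γ, ‖((h z)⁻¹ * shiftedCurvature h a z j k * (h z)⁻¹) α γ * h z γ β‖
      ≤ ∑ _γ : Fin r, (2 * ∑ j, dualLaplacian h a j z) * B := by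
        refine Finset.sum_le_sum fun γ _ => ?_
        rw [norm_mul]
        exact mul_le_mul (hX α γ) (hB γ β) (norm_nonneg _) ((norm_nonneg _).trans (hX α γ))
    _ = 2 * r * B * ∑ j, dualLaplacian h a j z := by
        rw [Finset.sum_const, Finset.card_univ, Fintype.card_fin, nsmul_eq_mul]
        ring

omit hG in
theorem IsMetricOn.continuousOn_dualLaplacian (j : Fin n) :
    ContinuousOn (dualLaplacian h a j) Ω := by
  have h1 := H.smooth_inv.trace
  exact (Complex.continuous_re.comp_continuousOn (contDiffOn_wirt Ω.isOpen
    (contDiffOn_wirt Ω.isOpen h1)).continuousOn).add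
    (continuousOn_const.mul (Complex.continuous_re.comp_continuousOn h1.continuousOn))

end LocalBounds


/-! ### Uniform integral bound for the Laplacian of the trace of the dual metric. -/

section LocalIntegrals

variable {n r : ℕ} {Ω : Opens (Fin n → ℂ)}

/-- Insert a cutoff and integrate by parts twice: only tr h⁻¹ remains, paired with derivatives of
the cutoff. The constant depends on the cutoff alone, hence is uniform along a sequence of metrics.
-/
theorem exists_setIntegral_dualLaplacian_le {K : Set (Fin n → ℂ)} (hK : IsCompact K)
    (hKΩ : K ⊆ Ω) :
    ∃ K' : Set (Fin n → ℂ), IsCompact K' ∧ K ⊆ K' ∧ K' ⊆ Ω ∧ ∃ C : ℝ, 0 ≤ C ∧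
      ∀ (h : (Fin n → ℂ) → Matrix (Fin r) (Fin r) ℂ) (a B : ℝ), IsMetricOn (Ω : Set _) h → 0 ≤ a →
        (∀ z ∈ K', ‖((h z)⁻¹).trace‖ ≤ B) →
        (∀ z ∈ K', GriffithsSemipos (shiftedCurvature h a z)) →
        ∀ j, ∫ z in K, dualLaplacian h a j z ≤ C * (1 + a) * B := by
  obtain ⟨χ, hχs, hχc, hχΩ, hχ01, hχ1⟩ := exists_cutoff hK hKΩ
  let χ' : (Fin n → ℂ) → ℂ := fun z => χ z
  have hsupp : tsupport χ' = tsupport χ := by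
    rw [tsupport, tsupport]
    congr 1
    ext z
    simp [χ']
  have hχ's : ContDiff ℝ ∞ χ' := Complex.ofRealCLM.contDiff.comp hχs
  have hχ't : IsTest Ω χ' := ⟨hχ's.continuous, by rwa [HasCompactSupport, hsupp], by rwa [hsupp]⟩
  have hK1 (z) (hz : z ∈ K) : χ z = 1 := hχ1.self_of_nhdsSet z hz
  have hKK' : K ⊆ tsupport χ := fun z hz => subset_tsupport _ (by simp [hK1 z hz])
  let ψ (j : Fin n) : (Fin n → ℂ) → ℂ := wirt Complex.I j (wirt (-Complex.I) j χ')
  have hψt (j : Fin n) : IsTest Ω (ψ j) := (hχ't.wirt hχ's _ _).wirt (contDiff_wirt hχ's) _ _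
  have hψsub (j : Fin n) : tsupport (ψ j) ⊆ tsupport χ :=
    tsupport_wirt_subset.trans (tsupport_wirt_subset.trans hsupp.subset)
  choose δ hδ using fun j => (hψt j).2.1.exists_bound_of_continuous (hψt j).1
  have hδ0 (j : Fin n) : 0 ≤ δ j := (norm_nonneg _).trans (hδ j 0)
  have hδsum (j : Fin n) : δ j ≤ ∑ j, δ j := Finset.single_le_sum (fun j _ => hδ0 j)
    (Finset.mem_univ j)
  have hδsum0 : 0 ≤ ∑ j, δ j := Finset.sum_nonneg fun j _ => hδ0 j
  let V : ℝ := volume.real (tsupport χ)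
  have hV : 0 ≤ V := measureReal_nonneg
  refine ⟨tsupport χ, hχc, hKK', hχΩ, (∑ j, δ j + 1) * V, by positivity, ?_⟩
  intro h a B H ha hB hG j
  have ht := H.smooth_inv.trace
  have htB : ∫ z in tsupport χ, ‖((h z)⁻¹).trace‖ ≤ B * V := by
    have := setIntegral_mono_on (μ := volume) (s := tsupport χ)
      ((ht.continuousOn.mono hχΩ).norm.integrableOn_compact hχc)
      (integrableOn_const hχc.measure_lt_top.ne) (isClosed_tsupport χ).measurableSet hB
    rwa [setIntegral_const, smul_eq_mul, mul_comm] at this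
  have hq := H.continuousOn_dualLaplacian (a := a) j
  have hχq : ContinuousOn (fun z => dualLaplacian h a j z * χ z) (tsupport χ) :=
    (hq.mono hχΩ).mul hχs.continuous.continuousOn
  -- Enlarging the domain requires nonnegativity on the whole support of the cutoff, which is why
  -- the semipositivity is assumed on K'.
  have h1 : ∫ z in K, dualLaplacian h a j z ≤ ∫ z in tsupport χ, dualLaplacian h a j z * χ z := by
    have e1 : ∫ z in K, dualLaplacian h a j z = ∫ z in K, dualLaplacian h a j z * χ z :=
      setIntegral_congr_fun hK.isClosed.measurableSet fun z hz => by simp [hK1 z hz]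
    rw [e1]
    refine setIntegral_mono_set (hχq.integrableOn_compact hχc) ?_ (ae_of_all _ hKK')
    exact (ae_restrict_iff' (isClosed_tsupport χ).measurableSet).2 (ae_of_all _ fun z hz =>
      mul_nonneg (H.dualLaplacian_nonneg (hG z hz) (hχΩ hz) j) (hχ01 z).1)
  let q' : (Fin n → ℂ) → ℂ := fun z =>
    wirt (-Complex.I) j (wirt Complex.I j fun w => ((h w)⁻¹).trace) z * χ' z +
      a * (((h z)⁻¹).trace * χ' z)
  have hw := contDiffOn_wirt (c := Complex.I) (j := j) Ω.isOpen ht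
  have hww := contDiffOn_wirt (c := -Complex.I) (j := j) Ω.isOpen hw
  have hi1 := (hχ't.mul_continuousOn hww.continuousOn).integrable
  have hi2 := (hχ't.mul_continuousOn ht.continuousOn).integrable
  have h2 : ∫ z in tsupport χ, dualLaplacian h a j z * χ z =
      (∫ z in (Ω : Set (Fin n → ℂ)), q' z).re := by
    have e2 : ∫ z in (Ω : Set (Fin n → ℂ)), q' z = ∫ z in tsupport χ, q' z := by
      rw [setIntegral_eq_integral_of_forall_compl_eq_zero,
        setIntegral_eq_integral_of_forall_compl_eq_zero]
      · intro z hz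
        simp [q', χ', image_eq_zero_of_notMem_tsupport hz]
      · intro z hz
        simp [q', χ', image_eq_zero_of_notMem_tsupport fun h => hz (hχΩ h)]
    have e3 : IntegrableOn q' (tsupport χ) := (hi1.add (hi2.const_mul _)).integrableOn
    have e4 := integral_re e3
    simp only [RCLike.re_eq_complex_re] at e4
    rw [e2, ← e4]
    refine integral_congr_ae (ae_of_all _ fun z => ?_)
    simp [q', χ', dualLaplacian]
    ring
  have h3 : ∫ z in (Ω : Set (Fin n → ℂ)), q' z =
      (∫ z in (Ω : Set (Fin n → ℂ)), ((h z)⁻¹).trace * ψ j z) +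
        a * ∫ z in (Ω : Set (Fin n → ℂ)), ((h z)⁻¹).trace * χ' z := by
    rw [integral_add hi1.integrableOn (hi2.const_mul _).integrableOn, integral_const_mul,
      setIntegral_wirt_mul hw hχ't hχ's, setIntegral_wirt_mul ht (hχ't.wirt hχ's _ _)
        (contDiff_wirt hχ's), neg_neg]
  have h4 : ‖∫ z in (Ω : Set (Fin n → ℂ)), ((h z)⁻¹).trace * ψ j z‖ ≤ δ j * (B * V) :=
    (norm_setIntegral_mul_le ht.continuousOn (hψt j) hχc hχΩ (fun z hz =>
      image_eq_zero_of_notMem_tsupport fun h => hz (hψsub j h)) (hδ j)).trans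
      (mul_le_mul_of_nonneg_left htB (hδ0 j))
  have h5 : ‖∫ z in (Ω : Set (Fin n → ℂ)), ((h z)⁻¹).trace * χ' z‖ ≤ 1 * (B * V) := by
    refine (norm_setIntegral_mul_le ht.continuousOn hχ't hχc hχΩ (fun z hz => ?_)
      fun z => ?_).trans (mul_le_mul_of_nonneg_left htB zero_le_one)
    · simp [χ', image_eq_zero_of_notMem_tsupport hz]
    · simpa [χ', abs_of_nonneg (hχ01 z).1] using (hχ01 z).2
  have hBV : 0 ≤ B * V := (integral_nonneg fun _ => norm_nonneg _).trans htB
  calc ∫ z in K, dualLaplacian h a j z ≤ (∫ z in (Ω : Set (Fin n → ℂ)), q' z).re := h1.trans h2.le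
    _ ≤ ‖∫ z in (Ω : Set (Fin n → ℂ)), q' z‖ := Complex.re_le_norm _
    _ ≤ δ j * (B * V) + a * (1 * (B * V)) := by
        rw [h3]
        refine (norm_add_le _ _).trans (add_le_add h4 ?_)
        rw [norm_mul, Complex.norm_real, Real.norm_of_nonneg ha]
        exact mul_le_mul_of_nonneg_left h5 ha
    _ ≤ (∑ j, δ j + 1) * V * (1 + a) * B := by
        have e1 := mul_le_mul_of_nonneg_right (hδsum j) hBV
        have e2 : 0 ≤ (∑ j, δ j) * (a * (B * V)) := by positivity
        nlinarith

end LocalIntegrals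


/-! ## Local uniform bounds for the dual metrics -/

section GaussianWeight

variable {n : ℕ} {p z : Fin n → ℂ} {c : ℂ} {j k : Fin n}

theorem wirt_coord (i : Fin n) :
    wirt c j (fun z => z i - p i) z = if i = j then (1 + c * Complex.I) / 2 else 0 := by
  have h1 (v : Fin n → ℂ) : fderiv ℝ (fun z : Fin n → ℂ => z i - p i) z v = v i := by
    rw [fderiv_sub_const]
    exact DFunLike.congr_fun
      (ContinuousLinearMap.proj (R := ℝ) (φ := fun _ : Fin n => ℂ) i).fderiv v
  rw [wirt, h1, h1]
  by_cases hij : i = j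
  · subst hij
    simp
    ring
  · simp [hij]

/-- The squared Euclidean distance to `p`. -/
def sqDist (p z : Fin n → ℂ) : ℂ := ∑ i, (z i - p i) * conj (z i - p i)

theorem contDiff_coord (i : Fin n) : ContDiff ℝ ∞ fun z : Fin n → ℂ => z i - p i :=
  (contDiff_apply ℝ ℂ i).sub contDiff_const

theorem contDiff_conj_coord (i : Fin n) : ContDiff ℝ ∞ fun z : Fin n → ℂ => conj (z i - p i) :=
  Complex.conjCLE.contDiff.comp (contDiff_coord i)

theorem contDiff_sqDist : ContDiff ℝ ∞ (sqDist p) :=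
  ContDiff.sum fun i _ => (contDiff_coord i).mul (contDiff_conj_coord i)

theorem wirt_sqDist : wirt c j (sqDist p) z =
    (1 + c * Complex.I) / 2 * conj (z j - p j) + (1 - c * Complex.I) / 2 * (z j - p j) := by
  have h1 (i : Fin n) := (contDiff_coord (p := p) i).differentiable (by simp) z
  have h2 (i : Fin n) := (contDiff_conj_coord (p := p) i).differentiable (by simp) z
  change wirt c j (fun z => ∑ i, (z i - p i) * conj (z i - p i)) z = _
  rw [wirt_sum _ fun i _ => (h1 i).fun_mul (h2 i)]
  have h3 (i : Fin n) : wirt c j (fun z => (z i - p i) * conj (z i - p i)) z =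
      if i = j then (1 + c * Complex.I) / 2 * conj (z i - p i) +
        (1 - c * Complex.I) / 2 * (z i - p i) else 0 := by
    rw [wirt_mul (h1 i) (h2 i), wirt_conj (f := fun z : Fin n → ℂ => z i - p i), wirt_coord,
      wirt_coord]
    split_ifs
    · simp only [map_add, map_mul, map_div₀, map_one, map_ofNat, Complex.conj_conj, Complex.conj_I]
      ring
    · simp
  rw [Finset.sum_congr rfl fun i _ => h3 i]
  simp

/-- The Gaussian weight `exp (-a |z - p|²)`. -/
def gauss (a : ℝ) (p z : Fin n → ℂ) : ℂ := Complex.exp (-a * sqDist p z)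

variable {a : ℝ}

theorem contDiff_gauss : ContDiff ℝ ∞ (gauss a p) :=
  (contDiff_const.mul contDiff_sqDist).cexp

theorem sqDist_eq_ofReal : sqDist p z = ((∑ i, ‖z i - p i‖ ^ 2 : ℝ) : ℂ) := by
  simp only [sqDist, Complex.mul_conj']
  push_cast
  rfl

theorem gauss_eq_ofReal : gauss a p z = (Real.exp (-a * ∑ i, ‖z i - p i‖ ^ 2) : ℂ) := by
  rw [gauss, sqDist_eq_ofReal]
  push_cast
  rfl

theorem gauss_ne_zero : gauss a p z ≠ 0 := Complex.exp_ne_zero _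

theorem wirt_gauss : wirt c j (gauss a p) z = gauss a p z * (-a * wirt c j (sqDist p) z) := by
  have h1 : DifferentiableAt ℝ (sqDist p) z := contDiff_sqDist.differentiable (by simp) z
  have h2 := ((h1.hasFDerivAt.const_mul (-a : ℂ)).cexp).fderiv
  have h3 (v : Fin n → ℂ) : fderiv ℝ (gauss a p) z v =
      gauss a p z * (-a * fderiv ℝ (sqDist p) z v) := DFunLike.congr_fun h2 v
  rw [wirt, h3, h3, wirt]
  ring

/-- The exponent -a|z - p|² has complex Hessian -a δ_{jk}. The identity is arranged so that the
scalar term of `curvature_smul` becomes a δ_{jk} times the weight. -/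
theorem wirt_wirt_gauss : wirt (-Complex.I) j (wirt Complex.I k (gauss a p)) z =
    (gauss a p z)⁻¹ * wirt (-Complex.I) j (gauss a p) z * wirt Complex.I k (gauss a p) z -
      (if j = k then (a : ℂ) else 0) * gauss a p z := by
  have h1 : wirt Complex.I k (gauss a p) = fun z => gauss a p z * (-a * (z k - p k)) := by
    funext z
    rw [wirt_gauss, wirt_sqDist, Complex.I_mul_I]
    ring
  have h2 := contDiff_gauss (a := a) (p := p).differentiable (by simp) z
  have h3 := (contDiff_coord (p := p) k).differentiable (by simp) z
  rw [h1, wirt_mul h2 (h3.const_mul _), wirt_mul (differentiableAt_const _) h3, wirt_const,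
    wirt_coord]
  have h4 := gauss_ne_zero (a := a) (p := p) (z := z)
  by_cases hjk : j = k
  · subst hjk
    rw [if_pos rfl, if_pos rfl]
    field_simp
    linear_combination ((a : ℂ) * gauss a p z) * Complex.I_sq
  · rw [if_neg (Ne.symm hjk), if_neg hjk]
    field_simp
    ring

end GaussianWeight


/-! ### The Levi form and the real Hessian. -/

section Hessian

variable {n : ℕ}

/-- The Levi form in terms of the real Hessian. -/
theorem four_mul_sum_hessian (B : (Fin n → ℂ) →L[ℝ] (Fin n → ℂ) →L[ℝ] ℂ)
    (hB : ∀ v w, B v w = B w v) (ζ : Fin n → ℂ) :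
    B ζ ζ + B (Complex.I • ζ) (Complex.I • ζ) = ∑ j, ∑ k, ζ j * conj (ζ k) *
      (B (Pi.single j 1) (Pi.single k 1) + Complex.I * B (Pi.single j 1) (Pi.single k Complex.I)
        + -Complex.I * B (Pi.single j Complex.I) (Pi.single k 1)
        + -Complex.I * Complex.I * B (Pi.single j Complex.I) (Pi.single k Complex.I)) := by
  have hexp (ζ : Fin n → ℂ) : ζ = ∑ j, ((ζ j).re • (Pi.single j 1 : Fin n → ℂ) +
      (ζ j).im • (Pi.single j Complex.I : Fin n → ℂ)) := by
    funext i
    rw [Finset.sum_apply]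
    simp only [Pi.add_apply, Pi.smul_apply, Pi.single_apply, Complex.real_smul, smul_ite,
      smul_zero, mul_one]
    rw [Finset.sum_add_distrib]
    simp [Complex.re_add_im]
  have hBexp (ζ : Fin n → ℂ) : B ζ ζ = ∑ j, ∑ k,
      (((ζ j).re : ℂ) * (ζ k).re * B (Pi.single j 1) (Pi.single k 1) +
        ((ζ j).re : ℂ) * (ζ k).im * B (Pi.single j 1) (Pi.single k Complex.I) +
        ((ζ j).im : ℂ) * (ζ k).re * B (Pi.single j Complex.I) (Pi.single k 1) +
        ((ζ j).im : ℂ) * (ζ k).im * B (Pi.single j Complex.I) (Pi.single k Complex.I)) := by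
    conv_lhs => rw [hexp ζ]
    simp only [map_sum, map_add, map_smul, _root_.sum_apply, _root_.add_apply, _root_.smul_apply,
      Complex.real_smul]
    rw [Finset.sum_comm]
    refine Finset.sum_congr rfl fun j _ => ?_
    rw [Finset.mul_sum, Finset.mul_sum, ← Finset.sum_add_distrib]
    refine Finset.sum_congr rfl fun k _ => ?_
    ring
  -- The summands agree only after symmetrization in (j, k), which does not change the double sum.
  have hsymm (f g : Fin n → Fin n → ℂ) (h : ∀ j k, f j k + f k j = g j k + g k j) :
      ∑ j, ∑ k, f j k = ∑ j, ∑ k, g j k := by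
    have h1 (f : Fin n → Fin n → ℂ) :
        2 * ∑ j, ∑ k, f j k = ∑ j, ∑ k, (f j k + f k j) := by
      simp only [Finset.sum_add_distrib]
      rw [Finset.sum_comm (f := fun j k => f k j)]
      ring
    have h2 : (2 : ℂ) * ∑ j, ∑ k, f j k = 2 * ∑ j, ∑ k, g j k := by
      rw [h1, h1]
      simp only [h]
    exact mul_left_cancel₀ two_ne_zero h2
  rw [hBexp, hBexp, ← Finset.sum_add_distrib]
  simp only [← Finset.sum_add_distrib]
  refine hsymm _ _ fun j k => ?_
  simp only [Pi.smul_apply, smul_eq_mul, Complex.I_mul_re, Complex.I_mul_im]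
  rw [hB (Pi.single k 1) (Pi.single j 1), hB (Pi.single k 1) (Pi.single j Complex.I),
    hB (Pi.single k Complex.I) (Pi.single j 1),
    hB (Pi.single k Complex.I) (Pi.single j Complex.I)]
  have hz (i : Fin n) : ζ i = (ζ i).re + (ζ i).im * Complex.I := (Complex.re_add_im _).symm
  have hc (i : Fin n) : conj (ζ i) = (ζ i).re - (ζ i).im * Complex.I := by
    conv_lhs => rw [hz i]
    simp only [map_add, map_mul, Complex.conj_ofReal, Complex.conj_I]
    ring
  rw [hc j, hc k]
  generalize hxj : (ζ j).re = xj
  generalize hyj : (ζ j).im = yj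
  generalize hxk : (ζ k).re = xk
  generalize hyk : (ζ k).im = yk
  rw [hz j, hz k, hxj, hyj, hxk, hyk]
  push_cast
  ring_nf
  simp only [Complex.I_sq, Complex.I_pow_four]
  ring

theorem fderiv_fderiv_re {F : (Fin n → ℂ) → ℂ} (hF : ContDiff ℝ ∞ F) (z v w : Fin n → ℂ) :
    fderiv ℝ (fderiv ℝ fun z => (F z).re) z v w = (fderiv ℝ (fderiv ℝ F) z v w).re := by
  have h1 (G : (Fin n → ℂ) → ℂ) (hG : ContDiff ℝ ∞ G) (z v : Fin n → ℂ) :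
      fderiv ℝ (fun z => (G z).re) z v = (fderiv ℝ G z v).re :=
    DFunLike.congr_fun (Complex.reCLM.hasFDerivAt.comp z
      (hG.differentiable (by simp) z).hasFDerivAt).fderiv v
  have hre : ContDiff ℝ ∞ fun z => (F z).re := Complex.reCLM.contDiff.comp hF
  rw [← fderiv_fderiv_apply hre.contDiffAt, ← fderiv_fderiv_apply hF.contDiffAt]
  have h2 : (fun y => fderiv ℝ (fun z => (F z).re) y w) = fun y => (fderiv ℝ F y w).re :=
    funext fun y => h1 F hF y w
  rw [h2]
  exact h1 _ ((hF.fderiv_right (m := ∞) (by simp)).clm_apply contDiff_const) z v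

/-- This links the real condition in the sub-mean value inequality to Wirtinger derivatives; the 4
compensates the two factors 1/2 in ∂ and ∂̄. -/
theorem hessian_re_eq_levi {F : (Fin n → ℂ) → ℂ} (hF : ContDiff ℝ ∞ F) (z ζ : Fin n → ℂ) :
    fderiv ℝ (fderiv ℝ fun z => (F z).re) z ζ ζ +
      fderiv ℝ (fderiv ℝ fun z => (F z).re) z (Complex.I • ζ) (Complex.I • ζ) =
    4 * (∑ j, ∑ k, ζ j * conj (ζ k) *
      wirt (-Complex.I) j (wirt Complex.I k F) z).re := by
  rw [fderiv_fderiv_re hF, fderiv_fderiv_re hF, ← Complex.add_re,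
    four_mul_sum_hessian _ (fderiv_fderiv_symm hF.contDiffAt)]
  have h4 (x : ℂ) : 4 * x.re = ((4 : ℂ) * x).re := by simp
  rw [h4, Finset.mul_sum]
  congr 1
  refine Finset.sum_congr rfl fun j _ => ?_
  rw [Finset.mul_sum]
  refine Finset.sum_congr rfl fun k _ => ?_
  rw [wirt_wirt hF.contDiffAt]
  ring

end Hessian

/-! ### Plurisubharmonicity of the trace of the dual metric and its sub-mean value inequality. -/

section DualBound

variable {n r : ℕ} {Ω : Opens (Fin n → ℂ)} {h : (Fin n → ℂ) → Matrix (Fin r) (Fin r) ℂ} {a : ℝ}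
  {z p : Fin n → ℂ}

/-- The Gaussian weight turns semipositivity of the shifted curvature into true semipositivity of
the curvature of another metric. -/
theorem curvature_gauss_smul (H : IsMetricOn (Ω : Set (Fin n → ℂ)) h) (hz : z ∈ Ω)
    (j k : Fin n) : curvature (fun w => gauss a p w • h w) j k z =
      gauss a p z • shiftedCurvature h a z j k := by
  rw [curvature_smul Ω.isOpen hz contDiff_gauss.contDiffOn gauss_ne_zero H.smooth H.det_ne_zero,
    wirt_wirt_gauss, sub_sub_cancel, shiftedCurvature, smul_add, smul_smul, mul_comm (gauss a p z)]

theorem IsMetricOn.ofReal_smul (H : IsMetricOn (Ω : Set (Fin n → ℂ)) h) {f : (Fin n → ℂ) → ℂ}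
    (hf : ContDiffOn ℝ ∞ f Ω) (hpos : ∀ z ∈ Ω, 0 < f z) :
    IsMetricOn (Ω : Set (Fin n → ℂ)) fun w => f w • h w :=
  ⟨SmoothMatrixOn.smul hf H.smooth, fun z hz => (H.posDef z hz).smul (hpos z hz)⟩

theorem gauss_pos : 0 < gauss a p z := by
  rw [gauss_eq_ofReal]
  exact_mod_cast Real.exp_pos _

/-- The trace of the dual of a Griffiths semipositive metric is plurisubharmonic. -/
theorem IsMetricOn.levi_trace_inv_nonneg (H : IsMetricOn (Ω : Set (Fin n → ℂ)) h) (hz : z ∈ Ω)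
    (hG : GriffithsSemipos fun j k => curvature h j k z) (ζ : Fin n → ℂ) :
    0 ≤ (∑ j, ∑ k, ζ j * conj (ζ k) *
      wirt (-Complex.I) j (wirt Complex.I k fun w => ((h w)⁻¹).trace) z).re := by
  have h1 (k : Fin n) : wirt Complex.I k (fun w => ((h w)⁻¹).trace) =ᶠ[𝓝 z]
      fun w => (mwirt Complex.I k (fun w => (h w)⁻¹) w).trace := by
    filter_upwards [Ω.isOpen.mem_nhds hz] with w hw
    exact wirt_trace Ω.isOpen hw H.smooth_inv
  have h2 (j k : Fin n) : wirt (-Complex.I) j (wirt Complex.I k fun w => ((h w)⁻¹).trace) z =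
      ((h z)⁻¹ * curvature h j k z * (h z)⁻¹).trace +
      (mwirt Complex.I k (fun w => (h w)⁻¹) z * h z *
        (mwirt Complex.I j (fun w => (h w)⁻¹) z).conjTranspose).trace := by
    rw [wirt_congr (h1 k), wirt_trace Ω.isOpen hz (H.smooth_inv.mwirt Ω.isOpen),
      mwirt_mwirt_inv Ω.isOpen hz H.smooth H.det_ne_zero, H.conjTranspose_mwirt_inv hz,
      Matrix.trace_add]
  set D := fun k => mwirt Complex.I k (fun w => (h w)⁻¹) z with hD
  -- The first-order terms assemble into tr(X h Xᴴ) with X = ∑_k ζ̄_k D_k, which is nonnegative.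
  have h3 : ∑ j, ∑ k, ζ j * conj (ζ k) * (D k * h z * (D j).conjTranspose).trace =
      ((∑ k, conj (ζ k) • D k) * h z * (∑ k, conj (ζ k) • D k).conjTranspose).trace := by
    simp only [Matrix.conjTranspose_sum, Matrix.conjTranspose_smul, Finset.sum_mul, Finset.mul_sum,
      Matrix.trace_sum, Matrix.smul_mul, Matrix.mul_smul, Matrix.trace_smul, smul_eq_mul,
      RCLike.star_def, Complex.conj_conj, mul_assoc]
  have h4 : ∑ j, ∑ k, ζ j * conj (ζ k) * ((h z)⁻¹ * curvature h j k z * (h z)⁻¹).trace =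
      ∑ α : Fin r, sesq (Matrix.of fun j k => sesq ((h z)⁻¹ * curvature h j k z * (h z)⁻¹)
        (Pi.single α 1) (Pi.single α 1)) ζ ζ := by
    simp only [sesq_single]
    simp only [sesq, Matrix.of_apply, Matrix.trace, Matrix.diag, Finset.mul_sum]
    rw [Finset.sum_comm]
    rw [Finset.sum_comm (s := (Finset.univ : Finset (Fin r)))]
    rw [Finset.sum_comm]
    refine Finset.sum_congr rfl fun j _ => ?_
    rw [Finset.sum_comm]
    refine Finset.sum_congr rfl fun k _ => Finset.sum_congr rfl fun α _ => ?_
    ring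
  have h5 : GriffithsSemipos fun j k => (h z)⁻¹ * curvature h j k z * (h z)⁻¹ := by
    have := hG.congruence (h z)⁻¹
    rwa [H.conjTranspose_inv z hz] at this
  simp only [h2, mul_add, Finset.sum_add_distrib]
  rw [Complex.add_re, h3, h4, Complex.re_sum]
  exact add_nonneg (Finset.sum_nonneg fun α _ => h5 ζ _)
    (trace_mul_conjTranspose_nonneg (H.posDef z hz) _)

theorem GriffithsSemipos.smul_of_nonneg {P : Fin n → Fin n → Matrix (Fin r) (Fin r) ℂ}
    (hP : GriffithsSemipos P) {c : ℂ} (hc : 0 ≤ c) : GriffithsSemipos fun j k => c • P j k := by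
  intro u v
  have h1 : sesq (Matrix.of fun j k => sesq (c • P j k) v v) u u =
      c * sesq (Matrix.of fun j k => sesq (P j k) v v) u u := by
    rw [← sesq_smul]
    congr 1
    ext j k
    simp [sesq_smul]
  obtain ⟨hc1, hc2⟩ := Complex.le_def.1 hc
  rw [h1, Complex.mul_re, ← hc2]
  simpa using mul_nonneg hc1 (hP u v)

/-- The sub-mean value property, up to a constant, of the trace of the dual metric. -/
theorem IsMetricOn.trace_inv_le (H : IsMetricOn (Ω : Set (Fin n → ℂ)) h) {ρ : ℝ}
    (hball : Metric.closedBall p ρ ⊆ (Ω : Set (Fin n → ℂ))) (ha : 0 ≤ a)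
    (hG : ∀ z ∈ Metric.closedBall p ρ, GriffithsSemipos (shiftedCurvature h a z)) :
    volume.real (Metric.closedBall p ρ) * ((h p)⁻¹).trace.re ≤
      Real.exp (a * (n * ρ ^ 2)) * ∫ z in Metric.closedBall p ρ, ((h z)⁻¹).trace.re := by
  set g : (Fin n → ℂ) → Matrix (Fin r) (Fin r) ℂ := fun w => gauss a p w • h w with hg
  have Hg : IsMetricOn (Ω : Set (Fin n → ℂ)) g :=
    H.ofReal_smul contDiff_gauss.contDiffOn fun _ _ => gauss_pos
  -- Inversion flips the sign of the exponent. The resulting weight is 1 at p and at most exp(a n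
  -- ρ²) on the polydisc, since each of the n coordinates contributes at most ρ².
  have htr (z) (hz : z ∈ Ω) : ((g z)⁻¹).trace.re =
      Real.exp (a * ∑ i, ‖z i - p i‖ ^ 2) * ((h z)⁻¹).trace.re := by
    have h1 : (g z)⁻¹ = (gauss a p z)⁻¹ • (h z)⁻¹ := by
      have := Matrix.inv_smul' (h z) (Units.mk0 (gauss a p z) gauss_ne_zero) (H.isUnit_det hz)
      simpa [Units.smul_def] using this
    rw [h1, Matrix.trace_smul, gauss_eq_ofReal, smul_eq_mul, ← Complex.ofReal_inv,
      Complex.re_ofReal_mul, neg_mul, Real.exp_neg, inv_inv]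
  obtain ⟨χ, hχs, hχc, hχΩ, hχ01, hχ1⟩ :=
    exists_cutoff (Ω := Ω) (isCompact_closedBall p ρ) hball
  -- The mean value inequality is stated for globally smooth functions; the cutoff equals 1 near the
  -- polydisc, so no derivative changes there.
  set F : (Fin n → ℂ) → ℂ := fun z => χ z * ((g z)⁻¹).trace with hF
  have hFs : ContDiff ℝ ∞ F := by
    refine contDiff_iff_contDiffAt.2 fun z => ?_
    by_cases hz : z ∈ tsupport F
    swap
    · exact contDiffAt_const.congr_of_eventuallyEq (notMem_tsupport_iff_eventuallyEq.1 hz)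
    have hzΩ : z ∈ Ω := hχΩ (by
      have h1 : tsupport F ⊆ tsupport fun z => (χ z : ℂ) := tsupport_mul_subset_left
      have h2 : tsupport (fun z => (χ z : ℂ)) ⊆ tsupport χ :=
        closure_mono fun z hz => by simpa using hz
      exact h2 (h1 hz))
    exact (Complex.ofRealCLM.contDiff.comp hχs).contDiffAt.mul
      (Hg.smooth_inv.trace.contDiffAt (Ω.isOpen.mem_nhds hzΩ))
  have hFeq (z) (hz : z ∈ Metric.closedBall p ρ) : F =ᶠ[𝓝 z] fun z => ((g z)⁻¹).trace := by
    filter_upwards [hχ1.filter_mono (nhds_le_nhdsSet hz)] with w hw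
    simp [hF, hw]
  have key := sub_mean_value_closedBall (f := fun z => (F z).re)
    (Complex.reCLM.contDiff.comp hFs) p (ρ := ρ) fun z hz ζ => by
      have hzΩ : z ∈ Ω := hball hz
      rw [hessian_re_eq_levi hFs]
      refine mul_nonneg (by norm_num) ?_
      have h1 (j k : Fin n) : wirt (-Complex.I) j (wirt Complex.I k F) z =
          wirt (-Complex.I) j (wirt Complex.I k fun w => ((g w)⁻¹).trace) z :=
        wirt_congr ((hFeq z hz).eventually_nhds.mono fun w hw => wirt_congr hw)
      simp only [h1]
      refine Hg.levi_trace_inv_nonneg hzΩ ?_ ζ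
      simp only [hg, curvature_gauss_smul H hzΩ]
      exact (hG z hz).smul_of_nonneg gauss_pos.le
  by_cases hρ : ρ < 0
  · simp [Metric.closedBall_eq_empty.2 hρ]
  push Not at hρ
  have hFz (z) (hz : z ∈ Metric.closedBall p ρ) : (F z).re =
      Real.exp (a * ∑ i, ‖z i - p i‖ ^ 2) * ((h z)⁻¹).trace.re := by
    rw [(hFeq z hz).eq_of_nhds, htr z (hball hz)]
  have hFp : (F p).re = ((h p)⁻¹).trace.re := by
    rw [hFz p (Metric.mem_closedBall_self hρ)]
    simp
  rw [hFp, setIntegral_congr_fun Metric.isClosed_closedBall.measurableSet hFz] at key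
  refine key.trans ?_
  rw [← integral_const_mul]
  have hc : ContinuousOn (fun z => ((h z)⁻¹).trace.re) (Metric.closedBall p ρ) :=
    Complex.continuous_re.comp_continuousOn (H.smooth_inv.trace.continuousOn.mono hball)
  refine setIntegral_mono_on ?_ ?_ Metric.isClosed_closedBall.measurableSet fun z hz => ?_
  · refine ContinuousOn.integrableOn_compact (isCompact_closedBall p ρ) (ContinuousOn.mul ?_ hc)
    exact Continuous.continuousOn (by fun_prop)
  · exact (continuousOn_const.mul hc).integrableOn_compact (isCompact_closedBall p ρ)
  · refine mul_le_mul_of_nonneg_right (Real.exp_le_exp.2 (mul_le_mul_of_nonneg_left ?_ ha))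
      (H.trace_inv_nonneg (hball hz))
    calc ∑ i, ‖z i - p i‖ ^ 2 ≤ ∑ _i : Fin n, ρ ^ 2 := by
          refine Finset.sum_le_sum fun i _ => ?_
          have h1 : ‖z i - p i‖ ≤ ρ :=
            (norm_le_pi_norm (z - p) i).trans (mem_closedBall_iff_norm.1 hz)
          exact pow_le_pow_left₀ (norm_nonneg _) h1 2
      _ = n * ρ ^ 2 := by simp

end DualBound

/-! ## Limits of sequences of almost semipositive metrics on open subsets of `ℂⁿ` -/

section UniformConvergence

variable {n : ℕ} {Ω : Opens (Fin n → ℂ)} {F : ℕ → (Fin n → ℂ) → ℂ} {F₀ f : (Fin n → ℂ) → ℂ}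

theorem TendstoLocallyUniformlyOn.mul_isTest
    (hF : TendstoLocallyUniformlyOn F F₀ atTop (Ω : Set (Fin n → ℂ))) (hf : IsTest Ω f) :
    TendstoUniformlyOn (fun m z => F m z * f z) (fun z => F₀ z * f z) atTop (tsupport f) := by
  have h1 := (tendstoLocallyUniformlyOn_iff_forall_isCompact Ω.isOpen).1 hF _ hf.2.2 hf.2.1
  obtain ⟨B, hB⟩ := hf.1.bounded_above_of_compact_support hf.2.1
  rw [Metric.tendstoUniformlyOn_iff] at h1 ⊢
  intro δ hδ
  have hB' : 0 < |B| + 1 := by positivity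
  filter_upwards [h1 (δ / (|B| + 1)) (by positivity)] with m hm z hz
  have h2 := hm z hz
  rw [dist_eq_norm] at h2 ⊢
  rw [← sub_mul, norm_mul]
  calc ‖F₀ z - F m z‖ * ‖f z‖ ≤ ‖F₀ z - F m z‖ * (|B| + 1) := by
        refine mul_le_mul_of_nonneg_left ?_ (norm_nonneg _)
        linarith [hB z, le_abs_self B]
    _ < δ := by rwa [← lt_div_iff₀ hB']

variable {D : ℕ → (Fin n → ℂ) → ℂ}

theorem tendsto_setIntegral_mul_mul
    (hF : TendstoLocallyUniformlyOn F F₀ atTop (Ω : Set (Fin n → ℂ)))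
    (hFc : ∀ m, ContinuousOn (F m) Ω) (hF₀ : ContinuousOn F₀ Ω) (hD : ∀ m, ContinuousOn (D m) Ω)
    (hb : ∀ K : Set (Fin n → ℂ), IsCompact K → K ⊆ Ω → ∃ C : ℝ, ∀ m, ∫ z in K, ‖D m z‖ ≤ C)
    (hf : IsTest Ω f) {l : ℂ}
    (hl : Tendsto (fun m => ∫ z in (Ω : Set (Fin n → ℂ)), D m z * (F₀ z * f z)) atTop (𝓝 l)) :
    Tendsto (fun m => ∫ z in (Ω : Set (Fin n → ℂ)), D m z * (F m z * f z)) atTop (𝓝 l) :=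
  tendsto_setIntegral_mul hD hb (fun m => hf.mul_continuousOn (hFc m)) (hf.mul_continuousOn hF₀)
    hf.2.1 hf.2.2 (fun m z hz => by simp [image_eq_zero_of_notMem_tsupport hz])
    (fun z hz => by simp [image_eq_zero_of_notMem_tsupport hz])
    (TendstoLocallyUniformlyOn.mul_isTest hF hf) hl

theorem tendsto_setIntegral_of_tendstoLocallyUniformlyOn
    (hF : TendstoLocallyUniformlyOn F F₀ atTop (Ω : Set (Fin n → ℂ)))
    (hFc : ∀ m, ContinuousOn (F m) Ω) (hF₀ : ContinuousOn F₀ Ω) (hf : IsTest Ω f) :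
    Tendsto (fun m => ∫ z in (Ω : Set (Fin n → ℂ)), F m z * f z) atTop
      (𝓝 (∫ z in (Ω : Set (Fin n → ℂ)), F₀ z * f z)) := by
  have := tendsto_setIntegral_mul_mul (D := fun _ _ => 1) hF hFc hF₀ (fun _ => continuousOn_const)
    (fun K _ _ => ⟨∫ z in K, ‖(1 : ℂ)‖, fun _ => le_rfl⟩) hf
    (l := ∫ z in (Ω : Set (Fin n → ℂ)), F₀ z * f z)
    (by simp only [one_mul]; exact tendsto_const_nhds)
  simpa only [one_mul] using this

end UniformConvergence

/-! ### Semipositive forms on tensors, and positive matrices. -/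

section NakanoSemipos

variable {n r : ℕ} {P : Fin n → Fin n → Matrix (Fin r) (Fin r) ℂ}

/-- Semipositivity of the real part of a form on `ℂⁿ ⊗ ℂʳ`. -/
def NakanoSemipos (P : Fin n → Fin n → Matrix (Fin r) (Fin r) ℂ) : Prop :=
  ∀ w : Fin n → Fin r → ℂ, 0 ≤ (∑ j, ∑ k, sesq (P j k) (w j) (w k)).re

theorem sesq_of_sesq (u : Fin n → ℂ) (v : Fin r → ℂ) :
    sesq (Matrix.of fun j k => sesq (P j k) v v) u u =
      ∑ j, ∑ k, sesq (P j k) (u j • v) (u k • v) := by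
  simp only [sesq_smul_left, sesq_smul_right]
  rw [sesq]
  refine Finset.sum_congr rfl fun j _ => Finset.sum_congr rfl fun k _ => ?_
  rw [Matrix.of_apply]
  ring

theorem NakanoSemipos.griffithsSemipos (hP : NakanoSemipos P) : GriffithsSemipos P := by
  intro u v
  rw [sesq_of_sesq]
  exact hP _

theorem conj_sum_sesq (hP : ∀ j k, (P j k).conjTranspose = P k j) (w : Fin n → Fin r → ℂ) :
    conj (∑ j, ∑ k, sesq (P j k) (w j) (w k)) = ∑ j, ∑ k, sesq (P j k) (w j) (w k) := by
  simp only [map_sum, conj_sesq, hP]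
  exact Finset.sum_comm

theorem re_sesq_nonneg {A : Matrix (Fin r) (Fin r) ℂ} (hA : A.PosSemidef) (x : Fin r → ℂ) :
    0 ≤ (sesq A x x).re := by
  have h1 := (Complex.le_def.1 (hA.dotProduct_mulVec_nonneg (star x))).1
  rw [star_star] at h1
  simpa [sesq_eq_dotProduct] using h1

theorem re_sesq_pos {A : Matrix (Fin r) (Fin r) ℂ} (hA : A.PosDef) {x : Fin r → ℂ} (hx : x ≠ 0) :
    0 < (sesq A x x).re := by
  have h1 := (Complex.lt_def.1 (hA.dotProduct_mulVec_pos (star_ne_zero.2 hx))).1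
  rw [star_star] at h1
  simpa [sesq_eq_dotProduct] using h1

theorem norm_apply_le_trace {A : Matrix (Fin r) (Fin r) ℂ} (hA : A.PosSemidef) (α β : Fin r) :
    ‖A α β‖ ≤ A.trace.re := by
  have hpos := re_sesq_nonneg hA
  have hdiag (γ : Fin r) : 0 ≤ (A γ γ).re := by
    have := hpos (Pi.single γ 1)
    rwa [sesq_single] at this
  have hle (γ : Fin r) : (A γ γ).re ≤ A.trace.re := by
    rw [Matrix.trace, Complex.re_sum]
    exact Finset.single_le_sum (f := fun γ => (A γ γ).re) (fun γ _ => hdiag γ) (Finset.mem_univ γ)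
  have := norm_apply_le_of_sesq_nonneg hA.isHermitian hpos α β
  linarith [hle α, hle β]

end NakanoSemipos

/-! ### Pointwise bounds for the inverse of a metric from integral bounds. -/

section InverseBound

variable {n r : ℕ} {Ω : Opens (Fin n → ℂ)}

/-- Polydiscs of one fixed radius fit around all points of K. The constants (their volume and the
maximal weight) depend only on K and Ω, not on the metric. -/
theorem exists_norm_inv_le {K : Set (Fin n → ℂ)} (hK : IsCompact K) (hKΩ : K ⊆ Ω) :
    ∃ K' : Set (Fin n → ℂ), IsCompact K' ∧ K' ⊆ Ω ∧ ∃ c : ℝ, 0 < c ∧ ∃ N : ℝ,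
      ∀ (h : (Fin n → ℂ) → Matrix (Fin r) (Fin r) ℂ) (a : ℝ), IsMetricOn (Ω : Set _) h → 0 ≤ a →
        (∀ z ∈ K', GriffithsSemipos (shiftedCurvature h a z)) →
        ∀ p ∈ K, ∀ α β, c * ‖(h p)⁻¹ α β‖ ≤
          Real.exp (a * N) * ∫ z in K', ((h z)⁻¹).trace.re := by
  obtain ⟨ρ, hρ, hsub⟩ := hK.exists_cthickening_subset_open Ω.isOpen hKΩ
  refine ⟨Metric.cthickening ρ K, hK.cthickening, hsub,
    volume.real (Metric.closedBall (0 : Fin n → ℂ) ρ), ?_, n * ρ ^ 2,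
    fun h a H ha hG p hp α β => ?_⟩
  · exact ENNReal.toReal_pos (Metric.measure_closedBall_pos volume 0 hρ).ne'
      (isCompact_closedBall _ _).measure_lt_top.ne
  have hball : Metric.closedBall p ρ ⊆ Metric.cthickening ρ K :=
    Metric.closedBall_subset_cthickening hp ρ
  have h1 := H.trace_inv_le (hball.trans hsub) ha fun z hz => hG z (hball hz)
  have h2 : volume.real (Metric.closedBall p ρ) =
      volume.real (Metric.closedBall (0 : Fin n → ℂ) ρ) := by
    rw [Measure.real, Measure.real, Measure.addHaar_closedBall_center]
  rw [h2] at h1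
  refine (mul_le_mul_of_nonneg_left (norm_apply_le_trace (H.posDef p (hKΩ hp)).inv.posSemidef α β)
    measureReal_nonneg).trans (h1.trans (mul_le_mul_of_nonneg_left ?_ (Real.exp_pos _).le))
  refine setIntegral_mono_set ?_ ?_ hball.eventuallyLE
  · exact (Complex.continuous_re.comp_continuousOn
      (H.smooth_inv.trace.continuousOn.mono hsub)).integrableOn_compact hK.cthickening
  · filter_upwards [ae_restrict_mem Metric.isClosed_cthickening.measurableSet] with z hz
    exact H.trace_inv_nonneg (hsub hz)

end InverseBound

/-- A sequence of smooth metrics on `Ω` that converges locally uniformly, has locally uniformly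
bounded inverses, and whose curvature is almost Griffiths semipositive. -/
structure IsNefSequence {n r : ℕ} (Ω : Opens (Fin n → ℂ))
    (h : ℕ → (Fin n → ℂ) → Matrix (Fin r) (Fin r) ℂ) (h₀ : (Fin n → ℂ) → Matrix (Fin r) (Fin r) ℂ)
    (ε : ℕ → ℝ) : Prop where
  metric : ∀ m, IsMetricOn (Ω : Set (Fin n → ℂ)) (h m)
  tendsto : ∀ α β, TendstoLocallyUniformlyOn (fun m z => h m z α β) (fun z => h₀ z α β) atTop
    (Ω : Set (Fin n → ℂ))
  bdd : ∀ K : Set (Fin n → ℂ), IsCompact K → K ⊆ Ω → ∃ B : ℝ, ∀ m, ∀ z ∈ K, ∀ α β,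
    ‖h m z α β‖ ≤ B
  inv_bdd : ∀ K : Set (Fin n → ℂ), IsCompact K → K ⊆ Ω → ∃ B : ℝ, ∀ m, ∀ z ∈ K, ∀ α β,
    ‖(h m z)⁻¹ α β‖ ≤ B
  nonneg : ∀ m, 0 ≤ ε m
  le_one : ∀ m, ε m ≤ 1
  tendsto_zero : Tendsto ε atTop (𝓝 0)
  griffiths : ∀ K : Set (Fin n → ℂ), IsCompact K → K ⊆ Ω → ∃ C : ℝ, 0 ≤ C ∧ ∀ m, ∀ z ∈ K,
    GriffithsSemipos (shiftedCurvature (h m) (ε m * C) z)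

namespace IsNefSequence

variable {n r : ℕ} {Ω : Opens (Fin n → ℂ)} {h : ℕ → (Fin n → ℂ) → Matrix (Fin r) (Fin r) ℂ}
  {h₀ : (Fin n → ℂ) → Matrix (Fin r) (Fin r) ℂ} {ε : ℕ → ℝ} (S : IsNefSequence Ω h h₀ ε)

include S

theorem continuousOn (m : ℕ) (α β : Fin r) : ContinuousOn (fun z => h m z α β) Ω :=
  ((S.metric m).smooth α β).continuousOn

theorem continuousOn_inv (m : ℕ) (α β : Fin r) : ContinuousOn (fun z => (h m z)⁻¹ α β) Ω :=
  ((S.metric m).smooth_inv α β).continuousOn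

theorem continuousOn_limit (α β : Fin r) : ContinuousOn (fun z => h₀ z α β) Ω :=
  (S.tendsto α β).continuousOn (Frequently.of_forall fun m => S.continuousOn m α β)

theorem continuousOn_limit' : ContinuousOn h₀ Ω :=
  continuousOn_pi.2 fun α => continuousOn_pi.2 fun β => S.continuousOn_limit α β

theorem tendsto_apply {z : Fin n → ℂ} (hz : z ∈ Ω) :
    Tendsto (fun m => h m z) atTop (𝓝 (h₀ z)) :=
  tendsto_pi_nhds.2 fun α => tendsto_pi_nhds.2 fun β => (S.tendsto α β).tendsto_at hz

/-- The bound on the inverses gives |det h_m⁻¹| ≤ r! B^r, so |det h_m| stays away from zero. The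
limit is therefore nondegenerate at every point, not just almost everywhere. -/
theorem det_limit_ne_zero {z : Fin n → ℂ} (hz : z ∈ Ω) : (h₀ z).det ≠ 0 := by
  obtain ⟨B, hB⟩ := S.inv_bdd {z} isCompact_singleton (singleton_subset_iff.2 hz)
  have h1 : Tendsto (fun m => ‖(h m z).det‖) atTop (𝓝 ‖(h₀ z).det‖) :=
    ((continuous_id.matrix_det.tendsto _).comp (S.tendsto_apply hz)).norm
  intro h0
  rw [h0, norm_zero] at h1
  set C : ℝ := Nat.factorial r • B ^ r with hC
  have h2 (m : ℕ) : 1 ≤ C * ‖(h m z).det‖ := by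
    have h3 := Matrix.det_le (A := (h m z)⁻¹) (abv := NormedField.toAbsoluteValue ℂ) (x := B)
      fun α β => hB m z rfl α β
    rw [Fintype.card_fin] at h3
    have h4 : ‖((h m z)⁻¹).det‖ * ‖(h m z).det‖ = 1 := by
      rw [← norm_mul, ← Matrix.det_mul, Matrix.nonsing_inv_mul _ ((S.metric m).isUnit_det hz),
        Matrix.det_one, norm_one]
    rw [← h4]
    exact mul_le_mul_of_nonneg_right h3 (norm_nonneg _)
  have h5 := ge_of_tendsto' (h1.const_mul C) h2
  norm_num at h5

theorem continuousOn_limit_inv (α β : Fin r) : ContinuousOn (fun z => (h₀ z)⁻¹ α β) Ω := by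
  have h1 : ContinuousOn (fun z => (h₀ z)⁻¹) Ω := by
    simp only [Matrix.inv_def, Ring.inverse_eq_inv']
    exact ((continuous_id.matrix_det.comp_continuousOn S.continuousOn_limit').inv₀
      fun z hz => S.det_limit_ne_zero hz).smul
      (continuous_id.matrix_adjugate.comp_continuousOn S.continuousOn_limit')
  exact continuousOn_pi.1 (continuousOn_pi.1 h1 α) β

/-- Resolvent identity: h₀⁻¹ - h_m⁻¹ = h_m⁻¹ (h_m - h₀) h₀⁻¹, with both outer factors bounded on
compact sets. -/
theorem tendsto_inv (α β : Fin r) : TendstoLocallyUniformlyOn (fun m z => (h m z)⁻¹ α β)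
    (fun z => (h₀ z)⁻¹ α β) atTop (Ω : Set (Fin n → ℂ)) := by
  rw [tendstoLocallyUniformlyOn_iff_forall_isCompact Ω.isOpen]
  intro K hKΩ hK
  obtain ⟨B, hB⟩ := S.inv_bdd K hK hKΩ
  have h1 (α β : Fin r) : ∃ B₀ : ℝ, ∀ z ∈ K, ‖(h₀ z)⁻¹ α β‖ ≤ B₀ :=
    hK.exists_bound_of_continuousOn ((S.continuousOn_limit_inv α β).mono hKΩ)
  choose B₀ hB₀ using h1
  rw [Metric.tendstoUniformlyOn_iff]
  intro δ hδ
  set A : ℝ := ∑ _γ : Fin r, ∑ γ' : Fin r, |B| * |B₀ γ' β| with hA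
  have hA0 : 0 ≤ A := Finset.sum_nonneg fun _ _ => Finset.sum_nonneg fun _ _ => by positivity
  have h2 (α β : Fin r) := (tendstoLocallyUniformlyOn_iff_forall_isCompact Ω.isOpen).1
    (S.tendsto α β) K hKΩ hK
  simp only [Metric.tendstoUniformlyOn_iff] at h2
  have h3 : ∀ᶠ m in atTop, ∀ α β, ∀ z ∈ K, dist (h₀ z α β) (h m z α β) < δ / (A + 1) :=
    eventually_all.2 fun α => eventually_all.2 fun β => h2 α β _ (by positivity)
  filter_upwards [h3] with m hm z hz
  have h4 : (h₀ z)⁻¹ - (h m z)⁻¹ = (h m z)⁻¹ * (h m z - h₀ z) * (h₀ z)⁻¹ := by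
    rw [mul_sub, sub_mul, Matrix.nonsing_inv_mul _ ((S.metric m).isUnit_det (hKΩ hz)),
      Matrix.one_mul, Matrix.mul_nonsing_inv_cancel_right _ _
        (S.det_limit_ne_zero (hKΩ hz)).isUnit]
  rw [dist_eq_norm, ← Matrix.sub_apply, h4, Matrix.mul_assoc, Matrix.mul_apply]
  have h5 : ‖∑ γ, (h m z)⁻¹ α γ * ((h m z - h₀ z) * (h₀ z)⁻¹) γ β‖ ≤ δ / (A + 1) * A := by
    rw [hA, Finset.mul_sum]
    refine (norm_sum_le _ _).trans (Finset.sum_le_sum fun γ _ => ?_)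
    rw [Matrix.mul_apply, Finset.mul_sum, Finset.mul_sum]
    refine (norm_sum_le _ _).trans (Finset.sum_le_sum fun γ' _ => ?_)
    have e1 : ‖(h m z)⁻¹ α γ‖ ≤ |B| := (hB m z hz α γ).trans (le_abs_self _)
    have e2 : ‖(h m z - h₀ z) γ γ'‖ ≤ δ / (A + 1) := by
      rw [Matrix.sub_apply, ← dist_eq_norm, dist_comm]
      exact (hm γ γ' z hz).le
    have e3 : ‖(h₀ z)⁻¹ γ' β‖ ≤ |B₀ γ' β| := (hB₀ γ' β z hz).trans (le_abs_self _)
    rw [norm_mul, norm_mul]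
    calc ‖(h m z)⁻¹ α γ‖ * (‖(h m z - h₀ z) γ γ'‖ * ‖(h₀ z)⁻¹ γ' β‖)
        ≤ |B| * (δ / (A + 1) * |B₀ γ' β|) := by gcongr
      _ = δ / (A + 1) * (|B| * |B₀ γ' β|) := by ring
  refine h5.trans_lt ?_
  rw [div_mul_eq_mul_div, div_lt_iff₀ (by positivity)]
  nlinarith

/-- The densities `∂̄_k h_m⁻¹` and `h_m⁻¹ R_{j k̄}` are bounded in `L¹_loc`. -/
theorem exists_setIntegral_norm_le {K : Set (Fin n → ℂ)} (hK : IsCompact K) (hKΩ : K ⊆ Ω) :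
    ∃ C : ℝ, ∀ m, (∀ k α β, ∫ z in K, ‖mwirt Complex.I k (fun w => (h m w)⁻¹) z α β‖ ≤ C) ∧
      ∀ j k α β, ∫ z in K, ‖((h m z)⁻¹ * curvature (h m) j k z) α β‖ ≤ C := by
  obtain ⟨K', hK', hKK', hK'Ω, C, hC, hlap⟩ :=
    exists_setIntegral_dualLaplacian_le (r := r) hK hKΩ
  obtain ⟨B, hB⟩ := S.bdd K hK hKΩ
  obtain ⟨B', hB'⟩ := S.inv_bdd K' hK' hK'Ω
  obtain ⟨A, hA, hG⟩ := S.griffiths K' hK' hK'Ω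
  have htr (m) (z) (hz : z ∈ K') : ‖((h m z)⁻¹).trace‖ ≤ r * |B'| := by
    rw [Matrix.trace]
    refine (norm_sum_le _ _).trans ((Finset.sum_le_sum fun γ _ =>
      (hB' m z hz γ γ).trans (le_abs_self _)).trans_eq ?_)
    simp
  have hr : (0 : ℝ) ≤ r := Nat.cast_nonneg r
  have ha (m) : 0 ≤ ε m * A := mul_nonneg (S.nonneg m) hA
  -- The normalization ε_m ≤ 1 bounds the shifts by A, so that Λ below does not depend on m.
  have ha' (m) : ε m * A ≤ A := mul_le_of_le_one_left hA (S.le_one m)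
  set Λ : ℝ := C * (1 + A) * (r * |B'|) with hΛ
  have hlap' (m) (j) : ∫ z in K, dualLaplacian (h m) (ε m * A) j z ≤ Λ := by
    refine (hlap (h m) _ _ (S.metric m) (ha m) (htr m) (hG m) j).trans ?_
    rw [hΛ]
    gcongr
    exact ha' m
  have hint (m) (j) : IntegrableOn (dualLaplacian (h m) (ε m * A) j) K :=
    (((S.metric m).continuousOn_dualLaplacian j).mono hKΩ).integrableOn_compact hK
  have hpos (m) (z) (hz : z ∈ K) (j) : 0 ≤ dualLaplacian (h m) (ε m * A) j z :=
    (S.metric m).dualLaplacian_nonneg (hG m z (hKK' hz)) (hKΩ hz) j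
  have hconst (c : ℝ) : IntegrableOn (fun _ : Fin n → ℂ => c) K :=
    continuousOn_const.integrableOn_compact hK
  have hD (m) (k) (α β) : ContinuousOn (fun z => mwirt Complex.I k (fun w => (h m w)⁻¹) z α β) Ω :=
    ((S.metric m).smooth_inv.mwirt Ω.isOpen α β).continuousOn
  have hΘ (m) (j k) (α β) : ContinuousOn (fun z => ((h m z)⁻¹ * curvature (h m) j k z) α β) Ω :=
    (((S.metric m).smooth_inv.mul (smoothMatrixOn_curvature Ω.isOpen (S.metric m).smooth
      (S.metric m).det_ne_zero j k)) α β).continuousOn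
  set V : ℝ := volume.real K with hV
  -- The two entries are the integrals over K of the pointwise bounds for ∂̄_k h_m⁻¹ and for h_m⁻¹
  -- R.
  refine ⟨max (V + r * |B'| * Λ) (A * V + 2 * r * |B| * ∑ _j : Fin n, Λ), fun m =>
    ⟨fun k α β => le_max_of_le_left ?_, fun j k α β => le_max_of_le_right ?_⟩⟩
  · calc ∫ z in K, ‖mwirt Complex.I k (fun w => (h m w)⁻¹) z α β‖
        ≤ ∫ z in K, (1 + r * |B'| * dualLaplacian (h m) (ε m * A) k z) := by
          refine setIntegral_mono_on (((hD m k α β).mono hKΩ).norm.integrableOn_compact hK)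
            ((hconst 1).add ((hint m k).const_mul _)) hK.measurableSet fun z hz => ?_
          refine ((S.metric m).norm_mwirt_inv_le (hG m z (hKK' hz)) (hKΩ hz) k α β).trans ?_
          rw [mul_comm (r * |B'|)]
          refine add_le_add_right (mul_le_mul_of_nonneg_left ?_ (hpos m z hz k)) 1
          exact (Complex.re_le_norm _).trans (htr m z (hKK' hz))
      _ = V + r * |B'| * ∫ z in K, dualLaplacian (h m) (ε m * A) k z := by
          rw [integral_add (hconst 1) ((hint m k).const_mul _), integral_const_mul]
          simp [hV]
      _ ≤ V + r * |B'| * Λ := by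
          gcongr
          exact hlap' m k
  · calc ∫ z in K, ‖((h m z)⁻¹ * curvature (h m) j k z) α β‖
        ≤ ∫ z in K, (A + 2 * r * |B| * ∑ j, dualLaplacian (h m) (ε m * A) j z) := by
          refine setIntegral_mono_on (((hΘ m j k α β).mono hKΩ).norm.integrableOn_compact hK)
            ((hconst A).add ((integrable_finsetSum _ fun j _ => hint m j).const_mul _))
            hK.measurableSet fun z hz => ?_
          refine ((S.metric m).norm_inv_mul_curvature_le (hG m z (hKK' hz)) (hKΩ hz) (ha m) j k α β
            (B := |B|) fun α β => (hB m z hz α β).trans (le_abs_self _)).trans ?_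
          exact add_le_add_left (ha' m) _
      _ = A * V + 2 * r * |B| * ∑ j, ∫ z in K, dualLaplacian (h m) (ε m * A) j z := by
          rw [integral_add (hconst A) ((integrable_finsetSum _ fun j _ => hint m j).const_mul _),
            integral_const_mul, integral_finsetSum _ fun j _ => hint m j]
          simp [hV, mul_comm]
      _ ≤ A * V + 2 * r * |B| * ∑ _j : Fin n, Λ := by
          gcongr with j
          exact hlap' m j

end IsNefSequence

namespace IsNefSequence

variable {n r : ℕ} {Ω : Opens (Fin n → ℂ)} {h : ℕ → (Fin n → ℂ) → Matrix (Fin r) (Fin r) ℂ}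
  {h₀ : (Fin n → ℂ) → Matrix (Fin r) (Fin r) ℂ} {ε : ℕ → ℝ} (S : IsNefSequence Ω h h₀ ε)

include S

theorem continuousOn_mwirt_inv (m : ℕ) (k : Fin n) (α β : Fin r) :
    ContinuousOn (fun z => mwirt Complex.I k (fun w => (h m w)⁻¹) z α β) Ω :=
  ((S.metric m).smooth_inv.mwirt Ω.isOpen α β).continuousOn

theorem smoothMatrixOn_curvature (m : ℕ) (j k : Fin n) :
    SmoothMatrixOn (Ω : Set (Fin n → ℂ)) (curvature (h m) j k) :=
  NefBundle.smoothMatrixOn_curvature Ω.isOpen (S.metric m).smooth (S.metric m).det_ne_zero j k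

theorem continuousOn_inv_mul_curvature (m : ℕ) (j k : Fin n) (α β : Fin r) :
    ContinuousOn (fun z => ((h m z)⁻¹ * curvature (h m) j k z) α β) Ω :=
  (((S.metric m).smooth_inv.mul (S.smoothMatrixOn_curvature m j k)) α β).continuousOn

/-- The distributions `∂̄_k h_m⁻¹` converge weakly. -/
theorem exists_dbarInv (k : Fin n) (α β : Fin r) : ∃ T : ZeroOrderDistribution Ω,
    (∀ f, IsTest Ω f → Tendsto (fun m => ∫ z in (Ω : Set (Fin n → ℂ)),
      mwirt Complex.I k (fun w => (h m w)⁻¹) z α β * f z) atTop (𝓝 (pair T f))) ∧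
    ∀ ψ : 𝓓(Ω, ℂ), pair T ψ = - ∫ z in (Ω : Set (Fin n → ℂ)), (h₀ z)⁻¹ α β * dzbar k ψ z := by
  have hlim (ψ : 𝓓(Ω, ℂ)) : Tendsto (fun m => ∫ z in (Ω : Set (Fin n → ℂ)),
      mwirt Complex.I k (fun w => (h m w)⁻¹) z α β * ψ z) atTop
      (𝓝 (- ∫ z in (Ω : Set (Fin n → ℂ)), (h₀ z)⁻¹ α β * dzbar k ψ z)) := by
    have hs : ContDiff ℝ ∞ ψ := ψ.contDiff
    refine (tendsto_setIntegral_of_tendstoLocallyUniformlyOn (S.tendsto_inv α β)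
      (fun m => S.continuousOn_inv m α β) (S.continuousOn_limit_inv α β)
      ((isTest_coe ψ).wirt hs Complex.I k)).neg.congr fun m => ?_
    exact (setIntegral_wirt_mul ((S.metric m).smooth_inv α β) (isTest_coe ψ) hs _ k).symm
  obtain ⟨T, hT⟩ := exists_zeroOrderDistribution_limit
    (fun m => S.continuousOn_mwirt_inv m k α β)
    (fun K hK hKΩ => (S.exists_setIntegral_norm_le hK hKΩ).imp fun C hC m => (hC m).1 k α β)
    fun ψ => ⟨_, hlim ψ⟩
  exact ⟨T, hT, fun ψ => tendsto_nhds_unique (hT ψ (isTest_coe ψ)) (hlim ψ)⟩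

/-- The distributions `h_m⁻¹ R_{j k̄}` converge weakly. -/
theorem exists_coeff {T : Fin n → Fin r → Fin r → ZeroOrderDistribution Ω}
    (hT : ∀ k α β f, IsTest Ω f → Tendsto (fun m => ∫ z in (Ω : Set (Fin n → ℂ)),
      mwirt Complex.I k (fun w => (h m w)⁻¹) z α β * f z) atTop (𝓝 (pair (T k α β) f)))
    (j k : Fin n) (α β : Fin r) : ∃ T' : ZeroOrderDistribution Ω,
    (∀ f, IsTest Ω f → Tendsto (fun m => ∫ z in (Ω : Set (Fin n → ℂ)),
      ((h m z)⁻¹ * curvature (h m) j k z) α β * f z) atTop (𝓝 (pair T' f))) ∧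
    ∀ ψ : 𝓓(Ω, ℂ), pair T' ψ = - ∑ γ, pair (T k α γ) (fun z => h₀ z γ β * dz j ψ z) := by
  have hlim (ψ : 𝓓(Ω, ℂ)) : Tendsto (fun m => ∫ z in (Ω : Set (Fin n → ℂ)),
      ((h m z)⁻¹ * curvature (h m) j k z) α β * ψ z) atTop
      (𝓝 (- ∑ γ, pair (T k α γ) (fun z => h₀ z γ β * dz j ψ z))) := by
    have hs : ContDiff ℝ ∞ ψ := ψ.contDiff
    have hψ : IsTest Ω (dz j ψ) := by
      rw [dz_eq_wirt]
      exact (isTest_coe ψ).wirt hs _ j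
    -- The densities ∂̄_k h_m⁻¹ converge weakly with L¹_loc bounds and the h_m converge locally
    -- uniformly, so their product converges weakly.
    have h1 (γ : Fin r) : Tendsto (fun m => ∫ z in (Ω : Set (Fin n → ℂ)),
        mwirt Complex.I k (fun w => (h m w)⁻¹) z α γ * (h m z γ β * dz j ψ z)) atTop
        (𝓝 (pair (T k α γ) (fun z => h₀ z γ β * dz j ψ z))) :=
      tendsto_setIntegral_mul_mul (S.tendsto γ β) (fun m => S.continuousOn m γ β)
        (S.continuousOn_limit γ β) (fun m => S.continuousOn_mwirt_inv m k α γ)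
        (fun K hK hKΩ => (S.exists_setIntegral_norm_le hK hKΩ).imp fun C hC m => (hC m).1 k α γ)
        hψ (hT k α γ _ (hψ.mul_continuousOn (S.continuousOn_limit γ β)))
    refine (tendsto_finsetSum Finset.univ fun γ _ => h1 γ).neg.congr fun m => ?_
    have hsm : SmoothMatrixOn (Ω : Set (Fin n → ℂ))
        fun w => mwirt Complex.I k (fun w => (h m w)⁻¹) w * h m w :=
      ((S.metric m).smooth_inv.mwirt Ω.isOpen).mul (S.metric m).smooth
    have h2 := setIntegral_wirt_mul (hsm α β) (isTest_coe ψ) hs (-Complex.I) j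
    -- Since h_m⁻¹ R is ∂_j of (∂̄_k h_m⁻¹) h_m, integration by parts reduces its limit to the one
    -- just found.
    have h3 : ∫ z in (Ω : Set (Fin n → ℂ)), ((h m z)⁻¹ * curvature (h m) j k z) α β * ψ z =
        ∫ z in (Ω : Set (Fin n → ℂ)), wirt (-Complex.I) j (fun w =>
          (mwirt Complex.I k (fun w => (h m w)⁻¹) w * h m w) α β) z * ψ z := by
      refine setIntegral_congr_fun Ω.isOpen.measurableSet fun z hz => ?_
      have h4 := mwirt_mwirt_inv_mul (j := j) (k := k) Ω.isOpen hz (S.metric m).smooth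
        (S.metric m).det_ne_zero
      exact congrArg (· * ψ z) (congrFun (congrFun h4.symm α) β)
    rw [h3, h2, ← dz_eq_wirt, ← integral_finsetSum]
    · congr 1
      refine integral_congr_ae (ae_of_all _ fun z => ?_)
      simp only [Matrix.mul_apply, Finset.sum_mul, mul_assoc]
    · intro γ _
      exact ((hψ.mul_continuousOn (S.continuousOn m γ β)).mul_continuousOn
        (S.continuousOn_mwirt_inv m k α γ)).integrable.integrableOn
  obtain ⟨T', hT'⟩ := exists_zeroOrderDistribution_limit
    (fun m => S.continuousOn_inv_mul_curvature m j k α β)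
    (fun K hK hKΩ => (S.exists_setIntegral_norm_le hK hKΩ).imp fun C hC m => (hC m).2 j k α β)
    fun ψ => ⟨_, hlim ψ⟩
  exact ⟨T', hT', fun ψ => tendsto_nhds_unique (hT' ψ (isTest_coe ψ)) (hlim ψ)⟩

/-- The limit metric has a curvature current, the weak limit of the curvatures. -/
theorem exists_localCurvature : ∃ L : LocalCurvature Ω h₀, ∀ j k α β f, IsTest Ω f →
    Tendsto (fun m => ∫ z in (Ω : Set (Fin n → ℂ)), curvature (h m) j k z α β * f z) atTop
      (𝓝 (L.lowered j k α β f)) := by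
  choose T hT hTeq using S.exists_dbarInv
  choose T' hT' hTeq' using S.exists_coeff hT
  refine ⟨⟨T, hTeq, T', hTeq'⟩, fun j k α β f hf => ?_⟩
  -- The lowered curvature is R = h_m (h_m⁻¹ R), again a locally uniform limit times a weak one.
  have h1 (γ : Fin r) : Tendsto (fun m => ∫ z in (Ω : Set (Fin n → ℂ)),
      ((h m z)⁻¹ * curvature (h m) j k z) γ β * (h m z α γ * f z)) atTop
      (𝓝 (pair (T' j k γ β) (fun z => h₀ z α γ * f z))) :=
    tendsto_setIntegral_mul_mul (S.tendsto α γ) (fun m => S.continuousOn m α γ)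
      (S.continuousOn_limit α γ) (fun m => S.continuousOn_inv_mul_curvature m j k γ β)
      (fun K hK hKΩ => (S.exists_setIntegral_norm_le hK hKΩ).imp fun C hC m => (hC m).2 j k γ β)
      hf (hT' j k γ β _ (hf.mul_continuousOn (S.continuousOn_limit α γ)))
  refine (tendsto_finsetSum Finset.univ fun γ _ => h1 γ).congr fun m => ?_
  rw [← integral_finsetSum]
  · refine setIntegral_congr_fun Ω.isOpen.measurableSet fun z hz => ?_
    have h2 := Matrix.mul_nonsing_inv_cancel_left (h m z) (curvature (h m) j k z)
      ((S.metric m).isUnit_det hz)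
    have h3 := congrFun (congrFun h2 α) β
    rw [Matrix.mul_apply] at h3
    rw [← h3, Finset.sum_mul]
    exact Finset.sum_congr rfl fun γ _ => by ring
  · intro γ _
    exact ((hf.mul_continuousOn (S.continuousOn m α γ)).mul_continuousOn
      (S.continuousOn_inv_mul_curvature m j k γ β)).integrable.integrableOn

variable {L : LocalCurvature Ω h₀}
  (hL : ∀ j k α β f, IsTest Ω f → Tendsto (fun m => ∫ z in (Ω : Set (Fin n → ℂ)),
    curvature (h m) j k z α β * f z) atTop (𝓝 (L.lowered j k α β f)))

include hL

theorem isHermitian : L.IsHermitian := by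
  intro j k α β f
  have hf := isTest_coe f
  have hf' : IsTest Ω fun z => conj (f z) :=
    ⟨Complex.continuous_conj.comp hf.1, hf.2.1.comp_left (map_zero _),
      (closure_mono fun z hz => by
        rw [Function.mem_support] at hz ⊢
        exact fun h0 => hz (by rw [h0, map_zero])).trans hf.2.2⟩
  refine tendsto_nhds_unique ((Complex.continuous_conj.tendsto _).comp (hL j k α β f hf))
    ((hL k j β α _ hf').congr fun m => ?_)
  rw [Function.comp_apply, ← integral_conj]
  refine setIntegral_congr_fun Ω.isOpen.measurableSet fun z hz => ?_
  have h1 := conjTranspose_curvature (j := j) (k := k) Ω.isOpen hz (S.metric m).smooth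
    (S.metric m).conjTranspose
  have h2 := congrFun (congrFun h1 β) α
  rw [← h2, map_mul]
  rfl

/-- For every m the shifted curvature pairs to a nonnegative number, and the shift contributes ε_m C
times a convergent integral, hence nothing in the limit. Griffiths positivity is the case of
decomposable w, Nakano positivity the general one. -/
theorem sum_lowered_nonneg (w : Fin n → Fin r → (Fin n → ℂ) → ℂ) (hw : ∀ j α, Continuous (w j α))
    (χ : 𝓓(Ω, ℝ)) (hχ : ∀ z, 0 ≤ χ z)
    (hpos : ∃ C : ℝ, ∀ m, ∀ z ∈ tsupport χ,
      0 ≤ (∑ j, ∑ k, sesq (shiftedCurvature (h m) (ε m * C) z j k)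
      (fun α => w j α z) (fun β => w k β z)).re) :
    0 ≤ ∑ j, ∑ k, ∑ α, ∑ β, L.lowered j k α β
      (fun z => (χ z : ℂ) * (w j α z * conj (w k β z))) := by
  obtain ⟨C, hC⟩ := hpos
  set f : Fin n → Fin n → Fin r → Fin r → (Fin n → ℂ) → ℂ := fun j k α β z =>
    (χ z : ℂ) * (w j α z * conj (w k β z)) with hf
  have hft (j k α β) : IsTest Ω (f j k α β) := by
    have h1 : IsTest Ω fun z => (χ z : ℂ) :=
      ⟨Complex.continuous_ofReal.comp χ.continuous,
        χ.hasCompactSupport.comp_left Complex.ofReal_zero,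
        (closure_mono fun z hz => by simpa using hz).trans χ.tsupport_subset⟩
    exact h1.continuousOn_mul ((hw j α).mul (Complex.continuous_conj.comp (hw k β))).continuousOn
  have hshift (m j k α β) : ContinuousOn
      (fun z => shiftedCurvature (h m) (ε m * C) z j k α β) Ω :=
    (S.smoothMatrixOn_curvature m j k α β).continuousOn.add
      (continuousOn_const.mul (S.continuousOn m α β))
  have hlim (j k α β) : Tendsto (fun m => ∫ z in (Ω : Set (Fin n → ℂ)),
      shiftedCurvature (h m) (ε m * C) z j k α β * f j k α β z) atTop
      (𝓝 (L.lowered j k α β (f j k α β))) := by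
    have h1 := tendsto_setIntegral_of_tendstoLocallyUniformlyOn
      (S.tendsto α β) (fun m => S.continuousOn m α β) (S.continuousOn_limit α β) (hft j k α β)
    have h2 : Tendsto (fun m => if j = k then ((ε m * C : ℝ) : ℂ) else 0) atTop (𝓝 0) := by
      by_cases hjk : j = k
      · simp only [if_pos hjk]
        have h3 := (Complex.continuous_ofReal.tendsto _).comp (S.tendsto_zero.mul_const C)
        simpa [Function.comp_def] using h3
      · simp only [if_neg hjk]
        exact tendsto_const_nhds
    have h3 := (hL j k α β _ (hft j k α β)).add (h2.mul h1)
    rw [zero_mul, add_zero] at h3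
    refine h3.congr fun m => ?_
    rw [← integral_const_mul, ← integral_add]
    · refine integral_congr_ae (ae_of_all _ fun z => ?_)
      simp only [shiftedCurvature, Matrix.add_apply, Matrix.smul_apply, smul_eq_mul]
      ring
    · exact ((hft j k α β).mul_continuousOn
        (S.smoothMatrixOn_curvature m j k α β).continuousOn).integrable.integrableOn
    · exact (((hft j k α β).mul_continuousOn (S.continuousOn m α β)).integrable.const_mul
        _).integrableOn
  refine ge_of_tendsto' (tendsto_finsetSum _ fun j _ => tendsto_finsetSum _ fun k _ =>
    tendsto_finsetSum _ fun α _ => tendsto_finsetSum _ fun β _ => hlim j k α β) fun m => ?_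
  have hI (j k α β) : IntegrableOn (fun z => shiftedCurvature (h m) (ε m * C) z j k α β *
      f j k α β z) Ω :=
    ((hft j k α β).mul_continuousOn (hshift m j k α β)).integrable.integrableOn
  set Q : (Fin n → ℂ) → ℂ := fun z => ∑ j, ∑ k, sesq (shiftedCurvature (h m) (ε m * C) z j k)
    (fun α => w j α z) (fun β => w k β z) with hQ
  have hsum : ∑ j, ∑ k, ∑ α, ∑ β, ∫ z in (Ω : Set (Fin n → ℂ)),
      shiftedCurvature (h m) (ε m * C) z j k α β * f j k α β z =
      ∫ z in (Ω : Set (Fin n → ℂ)), (χ z : ℂ) * Q z := by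
    have h1 (z) : (χ z : ℂ) * Q z = ∑ j, ∑ k, ∑ α, ∑ β,
        shiftedCurvature (h m) (ε m * C) z j k α β * f j k α β z := by
      simp only [hQ, hf, sesq, Finset.mul_sum]
      refine Finset.sum_congr rfl fun j _ => Finset.sum_congr rfl fun k _ =>
        Finset.sum_congr rfl fun α _ => Finset.sum_congr rfl fun β _ => ?_
      ring
    simp only [h1]
    rw [integral_finsetSum _ fun j _ => integrable_finsetSum _ fun k _ =>
      integrable_finsetSum _ fun α _ => integrable_finsetSum _ fun β _ => hI j k α β]
    refine Finset.sum_congr rfl fun j _ => ?_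
    rw [integral_finsetSum _ fun k _ =>
      integrable_finsetSum _ fun α _ => integrable_finsetSum _ fun β _ => hI j k α β]
    refine Finset.sum_congr rfl fun k _ => ?_
    rw [integral_finsetSum _ fun α _ => integrable_finsetSum _ fun β _ => hI j k α β]
    refine Finset.sum_congr rfl fun α _ => ?_
    rw [integral_finsetSum _ fun β _ => hI j k α β]
  -- Nonnegativity in ℂ also asserts that the value is real; this comes from Hermitian symmetry,
  -- since the hypotheses concern real parts only.
  have hQreal (z) (hz : z ∈ Ω) : Q z = ((Q z).re : ℂ) := by
    refine (Complex.conj_eq_iff_re.1 (conj_sum_sesq (fun j k => ?_) _)).symm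
    rw [shiftedCurvature, shiftedCurvature, Matrix.conjTranspose_add, Matrix.conjTranspose_smul,
      conjTranspose_curvature Ω.isOpen hz (S.metric m).smooth (S.metric m).conjTranspose,
      (S.metric m).conjTranspose z hz]
    by_cases hjk : j = k
    · simp [hjk]
    · simp [hjk, Ne.symm hjk]
  rw [hsum, setIntegral_congr_fun (g := fun z => ((χ z * (Q z).re : ℝ) : ℂ)) Ω.isOpen.measurableSet
    fun z hz => by
      beta_reduce
      rw [Complex.ofReal_mul, ← hQreal z hz], integral_complex_ofReal]
  refine Complex.zero_le_real.2 (integral_nonneg fun z => ?_)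
  by_cases hz : z ∈ tsupport χ
  · exact mul_nonneg (hχ z) (hC m z hz)
  · simp [image_eq_zero_of_notMem_tsupport hz]

theorem griffithsNonneg : L.GriffithsNonneg := by
  intro u lam hlam χ hχ
  obtain ⟨C, -, hC⟩ := S.griffiths _ χ.hasCompactSupport χ.tsupport_subset
  have := S.sum_lowered_nonneg hL (fun j α z => lam j z * u α z)
    (fun j α => (hlam j).continuous.mul (u α).continuous) χ hχ ⟨C, fun m z hz => by
      have h1 := hC m z hz (fun j => lam j z) (fun α => u α z)
      rw [sesq_of_sesq] at h1
      exact h1⟩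
  refine this.trans_eq (Finset.sum_congr rfl fun j _ => Finset.sum_congr rfl fun k _ =>
    Finset.sum_congr rfl fun α _ => Finset.sum_congr rfl fun β _ =>
    congrArg (L.lowered j k α β) (funext fun z => ?_))
  simp only [map_mul]
  ring

theorem nakanoNonneg (hN : ∀ K : Set (Fin n → ℂ), IsCompact K → K ⊆ Ω → ∃ C : ℝ, ∀ m, ∀ z ∈ K,
    NakanoSemipos (shiftedCurvature (h m) (ε m * C) z)) : L.NakanoNonneg := by
  intro v χ hχ
  obtain ⟨C, hC⟩ := hN _ χ.hasCompactSupport χ.tsupport_subset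
  exact S.sum_lowered_nonneg hL (fun j α z => v j α z) (fun j α => (v j α).continuous) χ hχ
    ⟨C, fun m z hz => hC m z hz _⟩

end IsNefSequence

/-! ### Passage from h to det h · h. -/

section DetTwist

variable {n r : ℕ} {Ω : Opens (Fin n → ℂ)}

theorem IsMetricOn.det_smul {h : (Fin n → ℂ) → Matrix (Fin r) (Fin r) ℂ}
    (H : IsMetricOn (Ω : Set (Fin n → ℂ)) h) :
    IsMetricOn (Ω : Set (Fin n → ℂ)) fun z => (h z).det • h z :=
  H.ofReal_smul H.smooth.det fun z hz => (H.posDef z hz).det_pos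

/-- Demailly-Skoda: almost Griffiths semipositivity of `h` gives almost Nakano semipositivity of
`det h • h`. -/
theorem IsMetricOn.nakanoSemipos_det_smul {h : (Fin n → ℂ) → Matrix (Fin r) (Fin r) ℂ} {a : ℝ}
    {z : Fin n → ℂ} (H : IsMetricOn (Ω : Set (Fin n → ℂ)) h) (hz : z ∈ Ω)
    (hG : GriffithsSemipos (shiftedCurvature h a z)) :
    NakanoSemipos (shiftedCurvature (fun z => (h z).det • h z) (a * (r + 1)) z) := by
  intro w
  -- The shift a is seen once by h itself and r times by the trace of h⁻¹ h = 1, hence a (r + 1).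
  have h1 (j k) : shiftedCurvature (fun z => (h z).det • h z) (a * (r + 1)) z j k =
      (h z).det • (shiftedCurvature h a z j k +
        ((h z)⁻¹ * shiftedCurvature h a z j k).trace • h z) := by
    simp only [shiftedCurvature]
    rw [curvature_det_smul Ω.isOpen hz H.smooth H.det_ne_zero, Matrix.mul_add, Matrix.mul_smul,
      Matrix.nonsing_inv_mul _ (H.isUnit_det hz), Matrix.trace_add, Matrix.trace_smul,
      Matrix.trace_one, Fintype.card_fin]
    ext α β
    simp only [Matrix.add_apply, Matrix.smul_apply, smul_eq_mul]
    split_ifs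
    · push_cast
      ring
    · ring
  have h2 := hG.nakano (H.posDef z hz) w
  obtain ⟨hd1, hd2⟩ := Complex.lt_def.1 (H.posDef z hz).det_pos
  simp only [h1, sesq_smul, ← Finset.mul_sum]
  rw [Complex.mul_re, ← hd2]
  simpa using mul_nonneg hd1.le h2

theorem norm_det_smul_apply_le {A : Matrix (Fin r) (Fin r) ℂ} {B : ℝ} (hB : ∀ α β, ‖A α β‖ ≤ B)
    (α β : Fin r) : ‖(A.det • A) α β‖ ≤ Nat.factorial r * B ^ r * B := by
  have h1 := Matrix.det_le (A := A) (abv := NormedField.toAbsoluteValue ℂ) (x := B) hB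
  rw [Fintype.card_fin, nsmul_eq_mul] at h1
  rw [Matrix.smul_apply, norm_smul]
  exact mul_le_mul h1 (hB α β) (norm_nonneg _) ((norm_nonneg A.det).trans h1)

/-- The inverse has the same shape as the twisted matrix, so the same entry bound applies to it. -/
theorem inv_det_smul {A : Matrix (Fin r) (Fin r) ℂ} (hA : IsUnit A.det) :
    (A.det • A)⁻¹ = A⁻¹.det • A⁻¹ := by
  have h1 := Matrix.inv_smul' A hA.unit hA
  rw [Units.smul_def, hA.unit_spec] at h1
  rw [h1, Units.smul_def, Matrix.det_nonsing_inv, Ring.inverse_eq_inv', Units.val_inv_eq_inv_val,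
    hA.unit_spec]

variable {h : ℕ → (Fin n → ℂ) → Matrix (Fin r) (Fin r) ℂ}
  {h₀ : (Fin n → ℂ) → Matrix (Fin r) (Fin r) ℂ} {ε : ℕ → ℝ}

theorem IsNefSequence.nakano_det_smul (S : IsNefSequence Ω h h₀ ε)
    {K : Set (Fin n → ℂ)} (hK : IsCompact K) (hKΩ : K ⊆ Ω) :
    ∃ C : ℝ, 0 ≤ C ∧ ∀ m, ∀ z ∈ K,
      NakanoSemipos (shiftedCurvature (fun z => (h m z).det • h m z) (ε m * C) z) := by
  obtain ⟨C, hC0, hC⟩ := S.griffiths K hK hKΩ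
  refine ⟨C * (r + 1), by positivity, fun m z hz => ?_⟩
  rw [← mul_assoc]
  exact (S.metric m).nakanoSemipos_det_smul (hKΩ hz) (hC m z hz)

theorem IsNefSequence.det_smul (S : IsNefSequence Ω h h₀ ε)
    (htend : ∀ α β, TendstoLocallyUniformlyOn (fun m z => ((h m z).det • h m z) α β)
      (fun z => ((h₀ z).det • h₀ z) α β) atTop (Ω : Set (Fin n → ℂ))) :
    IsNefSequence Ω (fun m z => (h m z).det • h m z) (fun z => (h₀ z).det • h₀ z) ε where
  metric m := (S.metric m).det_smul
  tendsto := htend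
  bdd K hK hKΩ := (S.bdd K hK hKΩ).elim fun B hB =>
    ⟨_, fun m z hz => norm_det_smul_apply_le (hB m z hz)⟩
  inv_bdd K hK hKΩ := (S.inv_bdd K hK hKΩ).elim fun B hB =>
    ⟨_, fun m z hz => by
      rw [inv_det_smul ((S.metric m).isUnit_det (hKΩ hz))]
      exact norm_det_smul_apply_le (hB m z hz)⟩
  nonneg := S.nonneg
  le_one := S.le_one
  tendsto_zero := S.tendsto_zero
  griffiths K hK hKΩ := (S.nakano_det_smul hK hKΩ).imp fun C hC =>
    ⟨hC.1, fun m z hz => (hC.2 m z hz).griffithsSemipos⟩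

end DetTwist

/-! ## Metrics on vector bundles in charts and frames -/

theorem apply_apply_eq_sesq {m : ℕ} {V : Type*} [AddCommGroup V] [Module ℂ V]
    (B : V →ₗ[ℂ] V →ₗ⋆[ℂ] ℂ) (l : (Fin m → ℂ) →ₗ[ℂ] V) (v w : Fin m → ℂ) :
    B (l v) (l w) =
      sesq (Matrix.of fun α β => B (l (Pi.single α 1)) (l (Pi.single β 1))) v w := by
  have hv (v : Fin m → ℂ) : l v = ∑ α, v α • l (Pi.single α 1) := by
    conv_lhs => rw [pi_eq_sum_univ' v]
    simp only [map_sum, map_smul]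
  rw [hv v, hv w]
  simp only [map_sum, map_smul, LinearMap.map_smulₛₗ, LinearMap.sum_apply, LinearMap.smul_apply,
    smul_eq_mul, sesq, Matrix.of_apply, Finset.mul_sum]
  rw [Finset.sum_comm]
  refine Finset.sum_congr rfl fun α _ => Finset.sum_congr rfl fun β _ => ?_
  ring

theorem posSemidef_of_sesq {r : ℕ} {A : Matrix (Fin r) (Fin r) ℂ} (hA : A.conjTranspose = A)
    (hpos : ∀ v, 0 ≤ (sesq A v v).re) : A.PosSemidef := by
  refine Matrix.PosSemidef.of_dotProduct_mulVec_nonneg hA fun v => ?_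
  have h1 : star v ⬝ᵥ A.mulVec v = sesq A (star v) (star v) := by
    rw [sesq_eq_dotProduct, star_star]
  rw [h1, Complex.le_def]
  refine ⟨hpos _, ?_⟩
  have h2 := conj_sesq (M := A) (star v) (star v)
  rw [hA] at h2
  exact (Complex.conj_eq_iff_im.1 h2).symm

theorem posDef_of_sesq {r : ℕ} {A : Matrix (Fin r) (Fin r) ℂ} (hA : A.conjTranspose = A)
    (hpos : ∀ v, v ≠ 0 → 0 < (sesq A v v).re) : A.PosDef := by
  refine Matrix.PosDef.of_dotProduct_mulVec_pos hA fun v hv => ?_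
  have h1 : star v ⬝ᵥ A.mulVec v = sesq A (star v) (star v) := by
    rw [sesq_eq_dotProduct, star_star]
  rw [h1, Complex.lt_def]
  refine ⟨hpos _ (star_ne_zero.2 hv), ?_⟩
  have h2 := conj_sesq (M := A) (star v) (star v)
  rw [hA] at h2
  exact (Complex.conj_eq_iff_im.1 h2).symm

set_option linter.unusedSectionVars false

section BundleMetric

variable {n r : ℕ} {M : Type*} [TopologicalSpace M] [ChartedSpace (Fin n → ℂ) M]
  [IsManifold 𝓘(ℂ, Fin n → ℂ) ω M]
  {E : M → Type*} [∀ x, AddCommGroup (E x)] [∀ x, Module ℂ (E x)]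
  [∀ x, TopologicalSpace (E x)] [TopologicalSpace (TotalSpace (Fin r → ℂ) E)]
  [FiberBundle (Fin r → ℂ) E]

variable (r E) in
/-- The chart and the trivialization at a point. -/
def patchAt (x : M) : Patch n r E where
  chart := chartAt (Fin n → ℂ) x
  chart_mem := IsManifold.chart_mem_maximalAtlas x
  triv := trivializationAt (Fin r → ℂ) E x
  triv_mem := ⟨trivialization_mem_atlas _ E x⟩

theorem mem_domain_patchAt (x : M) : chartAt (Fin n → ℂ) x x ∈ (patchAt (n := n) r E x).domain := by
  refine ⟨mem_chart_target _ x, ?_⟩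
  change (chartAt (Fin n → ℂ) x).symm (chartAt (Fin n → ℂ) x x) ∈
    (trivializationAt (Fin r → ℂ) E x).baseSet
  rw [(chartAt (Fin n → ℂ) x).left_inv (mem_chart_source _ x)]
  exact mem_baseSet_trivializationAt _ E x

variable [VectorBundle ℂ (Fin r → ℂ) E]

/-- The frame of a trivialization, as a linear equivalence. -/
def Patch.frame (P : Patch n r E) {z : Fin n → ℂ} (hz : z ∈ P.domain) :
    (Fin r → ℂ) ≃ₗ[ℂ] E (P.chart.symm z) :=
  haveI := P.triv_mem
  (P.triv.linearEquivAt ℂ (P.chart.symm z) hz.2).symm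

namespace HermitianField

variable (H : HermitianField E) (P : Patch n r E) {z : Fin n → ℂ} (hz : z ∈ P.domain)

include hz

theorem form_frame (v w : Fin r → ℂ) :
    H.form (P.chart.symm z) (P.frame hz v) (P.frame hz w) = sesq (H.matrix P z) v w :=
  apply_apply_eq_sesq _ (P.frame hz : (Fin r → ℂ) →ₗ[ℂ] E (P.chart.symm z)) v w

theorem form_eq_sesq (v w : E (P.chart.symm z)) : H.form (P.chart.symm z) v w =
    sesq (H.matrix P z) ((P.frame hz).symm v) ((P.frame hz).symm w) := by
  rw [← H.form_frame P hz, LinearEquiv.apply_symm_apply, LinearEquiv.apply_symm_apply]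

omit [VectorBundle ℂ (Fin r → ℂ) E] hz in
theorem conjTranspose_matrix : (H.matrix P z).conjTranspose = H.matrix P z := by
  ext α β
  exact H.conj_symm _ _ _

theorem re_sesq_matrix_nonneg (v : Fin r → ℂ) : 0 ≤ (sesq (H.matrix P z) v v).re := by
  rw [← H.form_frame P hz]
  exact H.nonneg _ _

end HermitianField

namespace HermitianField

theorem IsSmoothMetric.isMetricOn {H : HermitianField E} (hH : H.IsSmoothMetric n r)
    (P : Patch n r E) : IsMetricOn (P.domain : Set (Fin n → ℂ)) (H.matrix P) where
  smooth := hH.2 P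
  posDef z hz := posDef_of_sesq (H.conjTranspose_matrix P) fun v hv => by
    rw [← H.form_frame P hz]
    exact hH.1 _ _ ((LinearEquiv.map_ne_zero_iff _).2 hv)

end HermitianField

end BundleMetric

/-! ## Bounds for the metric on the tangent bundle -/

section Tangent

variable {n r : ℕ} {M : Type*} [TopologicalSpace M] [ChartedSpace (Fin n → ℂ) M]
  [IsManifold 𝓘(ℂ, Fin n → ℂ) ω M]
  (G : HermitianField (fun x : M => TangentSpace 𝓘(ℂ, Fin n → ℂ) x))

theorem re_sesq_tangentMatrix_nonneg (φ : OpenPartialHomeomorph M (Fin n → ℂ)) (z u : Fin n → ℂ) :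
    0 ≤ (sesq (tangentMatrix G φ z) u u).re := by
  have h1 := apply_apply_eq_sesq (G.form (φ.symm z))
    (show (Fin n → ℂ) →L[ℂ] TangentSpace 𝓘(ℂ, Fin n → ℂ) (φ.symm z) from
      mfderiv 𝓘(ℂ, Fin n → ℂ) 𝓘(ℂ, Fin n → ℂ) φ.symm z).toLinearMap u u
  exact (G.nonneg _ _).trans_eq (congrArg Complex.re h1)

variable {G}

/-- Smoothness of G refers to the trivializations of the tangent bundle, whereas `tangentMatrix`
uses coordinate vectors. Near each point these vectors are expressed in a trivialization, with
continuous coefficients because the tangent map of the inverse chart is continuous. -/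
theorem continuousOn_tangentMatrix (hG : G.IsSmoothMetric n n)
    {φ : OpenPartialHomeomorph M (Fin n → ℂ)}
    (hφ : φ ∈ IsManifold.maximalAtlas 𝓘(ℂ, Fin n → ℂ) ω M) (j k : Fin n) :
    ContinuousOn (fun z => tangentMatrix G φ z j k) φ.target := by
  have hsmooth : ContMDiffOn 𝓘(ℂ, Fin n → ℂ) 𝓘(ℂ, Fin n → ℂ) ω φ.symm φ.target :=
    contMDiffOn_symm_of_mem_maximalAtlas hφ
  have hmap := hsmooth.continuousOn_tangentMapWithin (by simp) φ.open_target.uniqueMDiffOn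
  intro z₀ hz₀
  let Q : Patch n n (fun x : M => TangentSpace 𝓘(ℂ, Fin n → ℂ) x) :=
    ⟨φ, hφ, trivializationAt (Fin n → ℂ) _ (φ.symm z₀), ⟨trivialization_mem_atlas _ _ _⟩⟩
  have hz₀Q : z₀ ∈ Q.domain := ⟨hz₀, show φ.symm z₀ ∈ (trivializationAt (Fin n → ℂ)
    (fun x : M => TangentSpace 𝓘(ℂ, Fin n → ℂ) x) (φ.symm z₀)).baseSet from
    mem_baseSet_trivializationAt _ _ _⟩
  let V (j : Fin n) (z : Fin n → ℂ) : TangentSpace 𝓘(ℂ, Fin n → ℂ) (φ.symm z) :=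
    mfderiv 𝓘(ℂ, Fin n → ℂ) 𝓘(ℂ, Fin n → ℂ) φ.symm z (Pi.single j (1 : ℂ) : Fin n → ℂ)
  let c (j : Fin n) (z : Fin n → ℂ) : Fin n → ℂ := (Q.triv ⟨φ.symm z, V j z⟩).2
  have hc (j : Fin n) : ContinuousOn (c j) Q.domain := by
    have h1 : ContinuousOn (fun z : Fin n → ℂ =>
        (⟨φ.symm z, V j z⟩ : TangentBundle 𝓘(ℂ, Fin n → ℂ) M)) φ.target := by
      have h2 : Continuous fun z : Fin n → ℂ =>
          (⟨z, (Pi.single j (1 : ℂ) : Fin n → ℂ)⟩ : TangentBundle 𝓘(ℂ, Fin n → ℂ) (Fin n → ℂ)) :=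
        (tangentBundleModelSpaceHomeomorph 𝓘(ℂ, Fin n → ℂ)).symm.continuous.comp
          (Continuous.prodMk_left (Pi.single j (1 : ℂ) : Fin n → ℂ))
      refine (hmap.comp h2.continuousOn fun z hz => hz).congr fun z hz => ?_
      rw [Function.comp_apply, tangentMapWithin, mfderivWithin_of_isOpen φ.open_target hz]
    have h3 : ContinuousOn (fun z => Q.triv ⟨φ.symm z, V j z⟩) Q.domain :=
      Q.triv.continuousOn.comp (h1.mono inter_subset_left) fun z hz => 
        (Q.triv.mem_source).2 hz.2
    exact continuous_snd.comp_continuousOn h3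
  have heq : EqOn (fun z => tangentMatrix G φ z j k)
      (fun z => sesq (G.matrix Q z) (c j z) (c k z)) Q.domain := fun z hz =>
    G.form_eq_sesq Q hz (V j z) (V k z)
  have hcont : ContinuousOn (fun z => sesq (G.matrix Q z) (c j z) (c k z)) Q.domain := by
    refine continuousOn_finsetSum _ fun α _ => continuousOn_finsetSum _ fun β _ => ?_
    exact (hG.2 Q α β).continuousOn.mul (((continuous_apply α).comp_continuousOn (hc j)).mul
      (Complex.continuous_conj.comp_continuousOn ((continuous_apply β).comp_continuousOn (hc k))))
  exact ((hcont.congr heq).continuousAt (Q.domain.isOpen.mem_nhds hz₀Q)).continuousWithinAt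

theorem exists_tangentMatrix_le (hG : G.IsSmoothMetric n n)
    {φ : OpenPartialHomeomorph M (Fin n → ℂ)}
    (hφ : φ ∈ IsManifold.maximalAtlas 𝓘(ℂ, Fin n → ℂ) ω M) {K : Set (Fin n → ℂ)} (hK : IsCompact K)
    (hKφ : K ⊆ φ.target) : ∃ C : ℝ, 0 ≤ C ∧ ∀ z ∈ K, ∀ u : Fin n → ℂ,
      (sesq (tangentMatrix G φ z) u u).re ≤ C * ∑ j, ‖u j‖ ^ 2 := by
  have h1 (j k : Fin n) : ∃ B : ℝ, ∀ z ∈ K, ‖tangentMatrix G φ z j k‖ ≤ B :=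
    hK.exists_bound_of_continuousOn ((continuousOn_tangentMatrix hG hφ j k).mono hKφ)
  choose B hB using h1
  refine ⟨∑ j, ∑ k, |B j k|, Finset.sum_nonneg fun _ _ => Finset.sum_nonneg fun _ _ => abs_nonneg _,
    fun z hz u => ?_⟩
  refine (Complex.re_le_norm _).trans ?_
  rw [sesq, Finset.sum_mul]
  refine (norm_sum_le _ _).trans (Finset.sum_le_sum fun j _ => ?_)
  rw [Finset.sum_mul]
  refine (norm_sum_le _ _).trans (Finset.sum_le_sum fun k _ => ?_)
  rw [norm_mul, norm_mul, RCLike.norm_conj]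
  refine mul_le_mul ((hB j k z hz).trans (le_abs_self _)) ?_ (by positivity) (abs_nonneg _)
  have h2 (i : Fin n) : ‖u i‖ ^ 2 ≤ ∑ j, ‖u j‖ ^ 2 :=
    Finset.single_le_sum (f := fun j => ‖u j‖ ^ 2) (fun _ _ => by positivity) (Finset.mem_univ i)
  nlinarith [h2 j, h2 k, sq_nonneg (‖u j‖ - ‖u k‖)]

end Tangent

/-! ## Uniform bounds for the inverses -/

section InverseBounds

variable {n r : ℕ} {M : Type*} [TopologicalSpace M] [ChartedSpace (Fin n → ℂ) M]
  [IsManifold 𝓘(ℂ, Fin n → ℂ) ω M]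
  {E : M → Type*} [∀ x, AddCommGroup (E x)] [∀ x, Module ℂ (E x)]
  [∀ x, TopologicalSpace (E x)] [TopologicalSpace (TotalSpace (Fin r → ℂ) E)]
  [FiberBundle (Fin r → ℂ) E] [VectorBundle ℂ (Fin r → ℂ) E]
  {G : HermitianField (fun x : M => TangentSpace 𝓘(ℂ, Fin n → ℂ) x)}

theorem sesq_of_shiftedCurvature (h : (Fin n → ℂ) → Matrix (Fin r) (Fin r) ℂ) (a : ℝ)
    (z u : Fin n → ℂ) (v : Fin r → ℂ) :
    sesq (Matrix.of fun j k => sesq (shiftedCurvature h a z j k) v v) u u =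
      sesq (Matrix.of fun j k => sesq (curvature h j k z) v v) u u +
        ((a * ∑ j, ‖u j‖ ^ 2 : ℝ) : ℂ) * sesq (h z) v v := by
  have h1 : (Matrix.of fun j k => sesq (shiftedCurvature h a z j k) v v) =
      Matrix.of (fun j k => sesq (curvature h j k z) v v) +
        ((a : ℂ) * sesq (h z) v v) • (1 : Matrix (Fin n) (Fin n) ℂ) := by
    ext j k
    simp only [shiftedCurvature, sesq_add, sesq_smul, Matrix.of_apply, Matrix.add_apply,
      Matrix.smul_apply, Matrix.one_apply, smul_eq_mul]
    split_ifs <;> ring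
  rw [h1, sesq_add, sesq_smul, sesq_one]
  simp only [Complex.mul_conj']
  push_cast
  ring

/-- On a compact set G is at most C times the Euclidean metric, so the defect ε becomes a shift by ε
C, with C independent of the metric and of ε. -/
theorem GriffithsBound.exists_griffithsSemipos (hG : G.IsSmoothMetric n n) (P : Patch n r E)
    {K : Set (Fin n → ℂ)} (hK : IsCompact K) (hKP : K ⊆ P.domain) :
    ∃ C : ℝ, 0 ≤ C ∧ ∀ (H : HermitianField E) (ε : ℝ), 0 ≤ ε → GriffithsBound (r := r) G H ε →
      ∀ z ∈ K, GriffithsSemipos (shiftedCurvature (H.matrix P) (ε * C) z) := by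
  obtain ⟨C, hC0, hC⟩ := exists_tangentMatrix_le hG P.chart_mem hK (hKP.trans inter_subset_left)
  refine ⟨C, hC0, fun H ε hε hH z hz u v => ?_⟩
  have h1 := hH P z (hKP hz) u v
  have h2 := hC z hz u
  have h3 : 0 ≤ (sesq (H.matrix P z) v v).re := H.re_sesq_matrix_nonneg P (hKP hz) v
  rw [sum_griffiths_eq (fun j k => curvature (H.matrix P) j k z)] at h1
  rw [sesq_of_shiftedCurvature, Complex.add_re, Complex.re_ofReal_mul]
  change -ε * (sesq (tangentMatrix G P.chart z) u u).re * (sesq (H.matrix P z) v v).re ≤ _ at h1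
  have h4 := mul_le_mul_of_nonneg_right (mul_le_mul_of_nonneg_left h2 hε) h3
  nlinarith

/-- Hölder's inequality on a set of finite measure reduces L^p to L¹, the input of the sub-mean
value estimate. -/
theorem InverseBoundedInLp.exists_setIntegral_trace_le {H : ℝ → HermitianField E} {p : ℝ}
    (hp : (r : ℝ) < p) (hH : InverseBoundedInLp n r H p) (hs : ∀ ε > 0, (H ε).IsSmoothMetric n r)
    (P : Patch n r E) {K : Set (Fin n → ℂ)} (hK : IsCompact K) (hKP : K ⊆ P.domain) :
    ∃ C : ℝ, ∀ ε > 0, ∫ z in K, (((H ε).matrix P z)⁻¹).trace.re ≤ C := by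
  obtain ⟨C, hC⟩ := hH P K hK hKP
  have hcont (ε : ℝ) (hε : 0 < ε) (α β : Fin r) :
      ContinuousOn (fun z => ((H ε).matrix P z)⁻¹ α β) K :=
    (((hs ε hε).isMetricOn P).smooth_inv α β).continuousOn.mono hKP
  set c : ENNReal := C * volume.restrict K univ ^
    (1 / (1 : ENNReal).toReal - 1 / (ENNReal.ofReal p).toReal)
    with hc
  have : IsFiniteMeasure (volume.restrict K) := ⟨by
    rw [Measure.restrict_apply_univ]
    exact hK.measure_lt_top⟩
  have hentry (ε : ℝ) (hε : 0 < ε) (α : Fin r) :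
      ∫ z in K, ‖((H ε).matrix P z)⁻¹ α α‖ ≤ c.toReal := by
    -- The existence of the index α forces r ≥ 1, hence p > 1; for r = 0 the trace is an empty sum.
    have hr : (1 : ℝ) ≤ r := by exact_mod_cast (Fin.pos α)
    have hp1 : (1 : ENNReal) ≤ ENNReal.ofReal p := by
      rw [← ENNReal.ofReal_one]
      exact ENNReal.ofReal_le_ofReal (by linarith)
    have h1 := eLpNorm_le_eLpNorm_mul_rpow_measure_univ hp1
      ((hcont ε hε α α).aestronglyMeasurable (μ := volume) hK.measurableSet)
    have hc_top : c ≠ ⊤ := by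
      refine ENNReal.mul_ne_top ENNReal.coe_ne_top (ENNReal.rpow_ne_top_of_nonneg ?_
        (measure_ne_top _ _))
      rw [ENNReal.toReal_ofReal (by linarith), ENNReal.toReal_one, div_one, sub_nonneg,
        div_le_one (by linarith)]
      linarith
    have h2 : eLpNorm (fun z => ((H ε).matrix P z)⁻¹ α α) 1 (volume.restrict K) ≤ c :=
      h1.trans (mul_le_mul_left (hC ε hε α α) _)
    rw [eLpNorm_one_eq_lintegral_enorm] at h2
    rw [integral_norm_eq_lintegral_enorm
      ((hcont ε hε α α).aestronglyMeasurable hK.measurableSet)]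
    exact ENNReal.toReal_mono hc_top h2
  refine ⟨r * c.toReal, fun ε hε => ?_⟩
  have hint (α : Fin r) : IntegrableOn (fun z => ‖((H ε).matrix P z)⁻¹ α α‖) K :=
    (hcont ε hε α α).norm.integrableOn_compact hK
  calc ∫ z in K, (((H ε).matrix P z)⁻¹).trace.re
      ≤ ∫ z in K, ∑ α, ‖((H ε).matrix P z)⁻¹ α α‖ := by
        refine setIntegral_mono_on ?_ (integrable_finsetSum _ fun α _ => hint α) hK.measurableSet
          fun z hz => ?_
        · exact (Complex.continuous_re.comp_continuousOn
            (((hs ε hε).isMetricOn P).smooth_inv.trace.continuousOn.mono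
              hKP)).integrableOn_compact hK
        · exact (Complex.re_le_norm _).trans (norm_sum_le _ _)
    _ = ∑ α, ∫ z in K, ‖((H ε).matrix P z)⁻¹ α α‖ := integral_finsetSum _ fun α _ => hint α
    _ ≤ ∑ _α : Fin r, c.toReal := Finset.sum_le_sum fun α _ => hentry ε hε α
    _ = r * c.toReal := by simp

/-- The inverses of the metrics of a strong Griffiths nef family are locally uniformly bounded. -/
theorem IsStrongGriffithsNefFamily.exists_norm_inv_le (hG : G.IsSmoothMetric n n)
    {H : ℝ → HermitianField E} (hH : IsStrongGriffithsNefFamily (r := r) G H)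
    (P : Patch n r E) {K : Set (Fin n → ℂ)} (hK : IsCompact K) (hKP : K ⊆ P.domain) :
    ∃ B : ℝ, ∀ ε > 0, ε ≤ 1 → ∀ z ∈ K, ∀ α β, ‖((H ε).matrix P z)⁻¹ α β‖ ≤ B := by
  obtain ⟨hs, ⟨p, hp, hpH⟩, -⟩ := hH
  obtain ⟨K', hK', hK'P, c, hc, N, hN⟩ := NefBundle.exists_norm_inv_le (r := r) hK hKP
  obtain ⟨A, hA0, hA⟩ := GriffithsBound.exists_griffithsSemipos hG P hK' hK'P
  obtain ⟨B, hB⟩ := hpH.exists_setIntegral_trace_le hp (fun ε hε => (hs ε hε).1) P hK' hK'P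
  refine ⟨Real.exp (A * |N|) * |B| / c, fun ε hε hε1 z hz α β => ?_⟩
  have h1 := hN _ _ ((hs ε hε).1.isMetricOn P) (mul_nonneg hε.le hA0)
    (hA _ ε hε.le (hs ε hε).2) z hz α β
  rw [le_div_iff₀ hc, mul_comm]
  refine h1.trans (mul_le_mul (Real.exp_le_exp.2 ?_) ((hB ε hε).trans (le_abs_self _)) ?_
    (Real.exp_pos _).le)
  · calc ε * A * N ≤ ε * A * |N| := mul_le_mul_of_nonneg_left (le_abs_self _) (by positivity)
      _ ≤ 1 * A * |N| := by gcongr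
      _ = A * |N| := by rw [one_mul]
  · refine integral_nonneg_of_ae ?_
    filter_upwards [ae_restrict_mem hK'.measurableSet] with w hw
    exact ((hs ε hε).1.isMetricOn P).trace_inv_nonneg (hK'P hw)

end InverseBounds

/-! ## Limits of almost semipositive metrics on vector bundles -/

section GlobalLimit

variable {n r : ℕ} {M : Type*} [TopologicalSpace M] [ChartedSpace (Fin n → ℂ) M]
  [IsManifold 𝓘(ℂ, Fin n → ℂ) ω M]
  {E : M → Type*} [∀ x, AddCommGroup (E x)] [∀ x, Module ℂ (E x)]
  [∀ x, TopologicalSpace (E x)] [TopologicalSpace (TotalSpace (Fin r → ℂ) E)]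
  [FiberBundle (Fin r → ℂ) E]
  {Hs : ℕ → HermitianField E} {H₀ : HermitianField E} {ε : ℕ → ℝ}
  (S : ∀ P : Patch n r E, IsNefSequence P.domain (fun m => (Hs m).matrix P) (H₀.matrix P) ε)

include S

theorem isSingularMetric_limit : H₀.IsSingularMetric n r := fun P =>
  ⟨(S P).continuousOn_limit, by
    filter_upwards [ae_restrict_mem P.domain.isOpen.measurableSet] with z hz
    exact (S P).det_limit_ne_zero hz,
    fun α β => ((S P).continuousOn_limit_inv α β).locallyIntegrableOn
      P.domain.isOpen.measurableSet⟩

theorem convergesTo_limit : HermitianField.ConvergesTo n r Hs H₀ := fun P α β =>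
  ⟨(S P).tendsto α β, fun ψ => tendsto_setIntegral_of_tendstoLocallyUniformlyOn
    ((S P).tendsto_inv α β) (fun m => (S P).continuousOn_inv m α β)
    ((S P).continuousOn_limit_inv α β) (isTest_coe ψ)⟩

/-- The Nakano clause is conditional so that one construction of the limit current serves E and E ⊗
det E. -/
theorem exists_curvatureCurrent : ∃ Θ : CurvatureCurrent n r H₀, Θ.IsWeakLimit Hs ∧
    Θ.IsGriffithsPseudoeffective ∧
    ((∀ (P : Patch n r E) (K : Set (Fin n → ℂ)), IsCompact K → K ⊆ P.domain →
      ∃ C : ℝ, ∀ m, ∀ z ∈ K, NakanoSemipos (shiftedCurvature ((Hs m).matrix P) (ε m * C) z)) →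
      Θ.IsNakanoPseudoeffective) := by
  choose L hL using fun P => (S P).exists_localCurvature
  exact ⟨⟨L⟩, fun P j k α β ψ => hL P j k α β ψ (isTest_coe ψ),
    fun P => ⟨(S P).isHermitian (hL P), (S P).griffithsNonneg (hL P)⟩,
    fun hN P => ⟨(S P).isHermitian (hL P), (S P).nakanoNonneg (hL P) (hN P)⟩⟩

end GlobalLimit

/-! ## Extraction of convergent subsequences -/

section Equicontinuity

variable {X : Type*} [TopologicalSpace X] {F : ℕ → X → ℂ} {F₀ : X → ℂ} {s : Set X}

/-- Compare F m z with F m x and the limit at z with the limit at x: equicontinuity bounds both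
differences, the second by passing to the limit. -/
theorem tendstoLocallyUniformlyOn_of_equicontinuousOn (hF : EquicontinuousOn F s)
    (hlim : ∀ x ∈ s, Tendsto (fun m => F m x) atTop (𝓝 (F₀ x))) :
    TendstoLocallyUniformlyOn F F₀ atTop s := by
  rw [Metric.tendstoLocallyUniformlyOn_iff]
  intro δ hδ x hx
  have h1 := hF x hx _ (Metric.dist_mem_uniformity (show 0 < δ / 4 by positivity))
  refine ⟨{z | z ∈ s ∧ ∀ m, (F m x, F m z) ∈ {p : ℂ × ℂ | dist p.1 p.2 < δ / 4}},
    Filter.inter_mem self_mem_nhdsWithin h1, ?_⟩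
  filter_upwards [Metric.tendsto_nhds.1 (hlim x hx) (δ / 4) (by positivity)] with m hm z hz
  have h2 : dist (F₀ x) (F₀ z) ≤ δ / 4 :=
    le_of_tendsto' ((hlim x hx).dist (hlim z hz.1)) fun m => (hz.2 m).le
  have h3 : dist (F m x) (F m z) < δ / 4 := hz.2 m
  have h4 := dist_triangle4 (F₀ z) (F₀ x) (F m x) (F m z)
  rw [dist_comm] at h2 hm
  linarith

/-- Equicontinuity transfers the Cauchy property from a nearby point of D to x. -/
theorem exists_tendsto_of_equicontinuousWithinAt {x : X} (hF : EquicontinuousWithinAt F s x)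
    {D : Set X} (hD : ∃ᶠ z in 𝓝[s] x, z ∈ D)
    (hlim : ∀ x ∈ D, ∃ l, Tendsto (fun m => F m x) atTop (𝓝 l)) :
    ∃ l, Tendsto (fun m => F m x) atTop (𝓝 l) := by
  refine cauchySeq_tendsto_of_complete (Metric.cauchySeq_iff'.2 fun δ hδ => ?_)
  have h1 := hF _ (Metric.dist_mem_uniformity (show 0 < δ / 4 by positivity))
  obtain ⟨z, hzD, hz⟩ := (hD.and_eventually h1).exists
  obtain ⟨l, hl⟩ := hlim z hzD
  obtain ⟨N, hN⟩ := Metric.cauchySeq_iff'.1 hl.cauchySeq (δ / 4) (by positivity)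
  refine ⟨N, fun m hm => ?_⟩
  have h2 : dist (F m x) (F m z) < δ / 4 := hz m
  have h3 : dist (F N x) (F N z) < δ / 4 := hz N
  have h4 := dist_triangle4 (F m x) (F m z) (F N z) (F N x)
  rw [dist_comm] at h3
  linarith [hN m hm]

end Equicontinuity

/-- The pointwise limit of a sequence of fields of Hermitian forms. -/
theorem HermitianField.exists_limit {M : Type*} {E : M → Type*} [∀ x, AddCommGroup (E x)]
    [∀ x, Module ℂ (E x)] {Hs : ℕ → HermitianField E}
    (hlim : ∀ x (v w : E x), ∃ l, Tendsto (fun m => (Hs m).form x v w) atTop (𝓝 l)) :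
    ∃ H₀ : HermitianField E, ∀ x (v w : E x),
      Tendsto (fun m => (Hs m).form x v w) atTop (𝓝 (H₀.form x v w)) := by
  choose l hl using hlim
  refine ⟨{
    form := fun x => LinearMap.mk₂'ₛₗ (RingHom.id ℂ) (starRingEnd ℂ) (l x)
      (fun v v' w => tendsto_nhds_unique (hl x (v + v') w)
        (((hl x v w).add (hl x v' w)).congr fun m => by simp))
      (fun c v w => tendsto_nhds_unique (hl x (c • v) w)
        (((hl x v w).const_mul c).congr fun m => by simp))
      (fun v w w' => tendsto_nhds_unique (hl x v (w + w'))
        (((hl x v w).add (hl x v w')).congr fun m => by simp))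
      (fun c v w => tendsto_nhds_unique (hl x v (c • w))
        (((hl x v w).const_mul (conj c)).congr fun m => by simp))
    conj_symm := fun x v w => tendsto_nhds_unique
      (((Complex.continuous_conj.tendsto _).comp (hl x v w)).congr fun m => (Hs m).conj_symm x v w)
      (hl x w v)
    nonneg := fun x v => ge_of_tendsto' ((Complex.continuous_re.tendsto _).comp (hl x v v))
      fun m => (Hs m).nonneg x v }, hl⟩

section Subsequence

variable {n r : ℕ} {M : Type*} [TopologicalSpace M] [ChartedSpace (Fin n → ℂ) M]
  [IsManifold 𝓘(ℂ, Fin n → ℂ) ω M]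
  {E : M → Type*} [∀ x, AddCommGroup (E x)] [∀ x, Module ℂ (E x)]
  [∀ x, TopologicalSpace (E x)] [TopologicalSpace (TotalSpace (Fin r → ℂ) E)]
  [FiberBundle (Fin r → ℂ) E] [VectorBundle ℂ (Fin r → ℂ) E]
  {Hs : ℕ → HermitianField E}

theorem exists_tendsto_form (P : Patch n r E) {z : Fin n → ℂ} (hz : z ∈ P.domain)
    (hlim : ∀ α β, ∃ l, Tendsto (fun m => (Hs m).matrix P z α β) atTop (𝓝 l))
    (v w : E (P.chart.symm z)) :
    ∃ l, Tendsto (fun m => (Hs m).form (P.chart.symm z) v w) atTop (𝓝 l) := by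
  choose l hl using hlim
  refine ⟨_, (tendsto_finsetSum Finset.univ fun α _ => tendsto_finsetSum Finset.univ fun β _ =>
    (hl α β).mul_const ((P.frame hz).symm v α * conj ((P.frame hz).symm w β))).congr fun m => ?_⟩
  rw [(Hs m).form_eq_sesq P hz]
  rfl

theorem chart_symm_patchAt (x : M) :
    (patchAt (n := n) r E x).chart.symm (chartAt (Fin n → ℂ) x x) = x :=
  (chartAt (Fin n → ℂ) x).left_inv (mem_chart_source _ x)

theorem forall_exists_tendsto_form
    (hlim : ∀ (P : Patch n r E) (z : Fin n → ℂ), z ∈ P.domain →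
      ∀ α β, ∃ l, Tendsto (fun m => (Hs m).matrix P z α β) atTop (𝓝 l)) (x : M) :
    ∀ v w : E x, ∃ l, Tendsto (fun m => (Hs m).form x v w) atTop (𝓝 l) := by
  have h1 := exists_tendsto_form (Hs := Hs) (patchAt r E x) (mem_domain_patchAt x)
    (hlim _ _ (mem_domain_patchAt x))
  rwa [chart_symm_patchAt] at h1

/-- Diagonal extraction: on a countable dense set the matrices lie in a countable product of compact
balls, which is sequentially compact, and equicontinuity then gives convergence at every point.
Convergence is stated for the forms on the fibres, so that one subsequence works in all charts and
frames. -/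
theorem exists_subseq_form_tendsto [T2Space M] [CompactSpace M]
    (hequi : ∀ (P : Patch n r E) α β,
      EquicontinuousOn (fun m z => (Hs m).matrix P z α β) P.domain)
    (hbdd : ∀ (P : Patch n r E), ∀ z ∈ P.domain, ∃ C : ℝ, ∀ m α β, ‖(Hs m).matrix P z α β‖ ≤ C) :
    ∃ φ : ℕ → ℕ, StrictMono φ ∧ ∃ H₀ : HermitianField E, ∀ x (v w : E x),
      Tendsto (fun m => (Hs (φ m)).form x v w) atTop (𝓝 (H₀.form x v w)) := by
  -- A compact manifold is second countable, which provides the countable dense set.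
  have := ChartedSpace.secondCountable_of_sigmaCompact (Fin n → ℂ) M
  obtain ⟨D, hDc, hD⟩ := TopologicalSpace.exists_countable_dense M
  have : Countable D := hDc
  let A (m : ℕ) (x : D) (α β : Fin r) : ℂ :=
    (Hs m).matrix (patchAt r E (x : M)) (chartAt (Fin n → ℂ) (x : M) x) α β
  choose B hB using fun x : D => hbdd (patchAt r E (x : M)) _ (mem_domain_patchAt (x : M))
  obtain ⟨l, -, φ, hφ, hl⟩ := IsCompact.tendsto_subseq (x := A)
    (s := Set.pi univ fun x : D => Set.pi univ fun _ : Fin r => Set.pi univ fun _ : Fin r =>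
      Metric.closedBall (0 : ℂ) (B x))
    (isCompact_univ_pi fun x => isCompact_univ_pi fun _ => isCompact_univ_pi fun _ =>
      isCompact_closedBall _ _)
    fun m x _ α _ β _ => by
      rw [mem_closedBall_zero_iff]
      exact hB x m α β
  refine ⟨φ, hφ, HermitianField.exists_limit (forall_exists_tendsto_form (n := n) (r := r)
    fun P z hz α β => ?_)⟩
  have hform (x : M) (hx : x ∈ D) :
      ∀ v w : E x, ∃ l, Tendsto (fun m => (Hs (φ m)).form x v w) atTop (𝓝 l) := by
    have h1 := exists_tendsto_form (Hs := fun m => Hs (φ m)) (patchAt r E x) (mem_domain_patchAt x)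
      fun α β => ⟨_, tendsto_pi_nhds.1 (tendsto_pi_nhds.1 (tendsto_pi_nhds.1 hl ⟨x, hx⟩) α) β⟩
    rwa [chart_symm_patchAt] at h1
  refine exists_tendsto_of_equicontinuousWithinAt (D := {z | P.chart.symm z ∈ D})
    (F := fun m z => (Hs (φ m)).matrix P z α β)
    (((hequi P α β).comp φ) z hz) ?_ fun w hw => hform _ hw _ _
  -- The inverse chart maps open sets to open sets, so points of D occur arbitrarily close to z in
  -- the coordinates.
  rw [frequently_iff]
  intro U hU
  rw [P.domain.isOpen.nhdsWithin_eq hz] at hU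
  obtain ⟨V, hVU, hVo, hzV⟩ := mem_nhds_iff.1 (Filter.inter_mem hU (P.domain.isOpen.mem_nhds hz))
  have hVt : V ⊆ P.chart.target := fun w hw => (hVU hw).2.1
  obtain ⟨_, ⟨w, hwV, rfl⟩, hwD⟩ := hD.inter_open_nonempty _
    (P.chart.isOpen_image_symm_of_subset_target hVo hVt) (Set.Nonempty.image _ ⟨z, hzV⟩)
  exact ⟨w, (hVU hwV).1, hwD⟩

theorem IsStrongGriffithsNefFamily.isNefSequence
    {G : HermitianField (fun x : M => TangentSpace 𝓘(ℂ, Fin n → ℂ) x)} (hG : G.IsSmoothMetric n n)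
    {H : ℝ → HermitianField E} (hH : IsStrongGriffithsNefFamily (r := r) G H) {ε : ℕ → ℝ}
    (hpos : ∀ m, 0 < ε m) (hle : ∀ m, ε m ≤ 1) (hε : Tendsto ε atTop (𝓝 0))
    {H₀ : HermitianField E} (hlim : ∀ x (v w : E x),
      Tendsto (fun m => (H (ε m)).form x v w) atTop (𝓝 (H₀.form x v w))) (P : Patch n r E) :
    IsNefSequence P.domain (fun m => (H (ε m)).matrix P) (H₀.matrix P) ε where
  metric m := (hH.1 _ (hpos m)).1.isMetricOn P
  tendsto α β := tendstoLocallyUniformlyOn_of_equicontinuousOn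
    (((hH.2.2 P).1 α β).comp fun m => (⟨ε m, hpos m⟩ : Ioi (0 : ℝ))) fun _ _ => hlim _ _ _
  bdd _ hK hKP := ((hH.2.2 P).2 _ hK hKP).imp fun _ hC m => hC _ (hpos m)
  inv_bdd _ hK hKP := (hH.exists_norm_inv_le hG P hK hKP).imp fun _ hB m => hB _ (hpos m) (hle m)
  nonneg m := (hpos m).le
  le_one := hle
  tendsto_zero := hε
  griffiths _ hK hKP := (GriffithsBound.exists_griffithsSemipos hG P hK hKP).imp fun _ hC =>
    ⟨hC.1, fun m => hC.2 _ _ (hpos m).le (hH.1 _ (hpos m)).2⟩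

end Subsequence

/-! ## The induced metric on `E ⊗ det E` -/

/-- The sesquilinear form on `ℂʳ` with matrix `A`. -/
def sesqForm {r : ℕ} (A : Matrix (Fin r) (Fin r) ℂ) : (Fin r → ℂ) →ₗ[ℂ] (Fin r → ℂ) →ₗ⋆[ℂ] ℂ :=
  LinearMap.mk₂'ₛₗ (RingHom.id ℂ) (starRingEnd ℂ) (fun v w => sesq A v w)
    (fun _ _ _ => sesq_add_left) (fun c _ _ => sesq_smul_left c)
    (fun _ _ _ => sesq_add_right) (fun c _ _ => sesq_smul_right c)

section TensorDetMetric

variable {n r : ℕ} {M : Type*} [TopologicalSpace M] [ChartedSpace (Fin n → ℂ) M]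
  [IsManifold 𝓘(ℂ, Fin n → ℂ) ω M]
  {E : M → Type*} [∀ x, AddCommGroup (E x)] [∀ x, Module ℂ (E x)]
  [∀ x, TopologicalSpace (E x)] [TopologicalSpace (TotalSpace (Fin r → ℂ) E)]
  [FiberBundle (Fin r → ℂ) E] [VectorBundle ℂ (Fin r → ℂ) E]

/-- The matrix of a Hermitian form on a fibre, in the frame of a trivialization. -/
def fibreMatrix (H : HermitianField E) (t : Trivialization (Fin r → ℂ) (π (Fin r → ℂ) E)) (x : M) :
    Matrix (Fin r) (Fin r) ℂ :=
  Matrix.of fun α β => H.form x (t.symm x (Pi.single α 1)) (t.symm x (Pi.single β 1))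

theorem form_symm_eq_sesq (H : HermitianField E)
    (t : Trivialization (Fin r → ℂ) (π (Fin r → ℂ) E)) [MemTrivializationAtlas t] {x : M}
    (hx : x ∈ t.baseSet) (v w : Fin r → ℂ) :
    H.form x (t.symm x v) (t.symm x w) = sesq (fibreMatrix H t x) v w :=
  apply_apply_eq_sesq (H.form x) ((t.linearEquivAt ℂ x hx).symm : (Fin r → ℂ) →ₗ[ℂ] E x) v w

theorem posSemidef_fibreMatrix (H : HermitianField E)
    (t : Trivialization (Fin r → ℂ) (π (Fin r → ℂ) E)) [MemTrivializationAtlas t] {x : M}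
    (hx : x ∈ t.baseSet) : (fibreMatrix H t x).PosSemidef :=
  posSemidef_of_sesq (by
    ext α β
    exact H.conj_symm _ _ _) fun v => by
      rw [← form_symm_eq_sesq H t hx]
      exact H.nonneg _ _

/-- The metric on `E ⊗ det E` that is induced by a metric on `E`. -/
def HermitianField.tensorDet (H : HermitianField E) : HermitianField (TensorDet (r := r) E) where
  form x := sesqForm ((fibreMatrix H (trivializationAt (Fin r → ℂ) E x) x).det •
    fibreMatrix H (trivializationAt (Fin r → ℂ) E x) x)
  conj_symm x v w := by
    have h1 := posSemidef_fibreMatrix H (trivializationAt (Fin r → ℂ) E x)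
      (mem_baseSet_trivializationAt _ E x)
    have h2 := (h1.smul h1.det_nonneg).isHermitian
    refine (conj_sesq (M := _) v w).trans ?_
    rw [h2]
    rfl
  nonneg x v := by
    have h1 := posSemidef_fibreMatrix H (trivializationAt (Fin r → ℂ) E x)
      (mem_baseSet_trivializationAt _ E x)
    exact re_sesq_nonneg (h1.smul h1.det_nonneg) v

/-- The trivializations of E ⊗ det E are indexed by those of E. A change of frame replaces h by C h
Cᴴ, and det(C h Cᴴ) C h Cᴴ is the congruence of det h · h by det C · C, the transition matrix of the
twisted bundle. -/
theorem exists_patch_tensorDet (P' : Patch n r (TensorDet (r := r) E)) :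
    ∃ P : Patch n r E, P.chart = P'.chart ∧ P.domain = P'.domain ∧
      ∀ (H : HermitianField E), ∀ z ∈ P.domain,
        H.tensorDet.matrix P' z = (H.matrix P z).det • H.matrix P z := by
  obtain ⟨φ, hφ, t', ht'⟩ := P'
  obtain ⟨i, rfl⟩ := ht'.out
  have hi : MemTrivializationAtlas i.1 := ⟨i.2⟩
  refine ⟨⟨φ, hφ, i.1, hi⟩, rfl, rfl, fun H z hz => ?_⟩
  set x : M := φ.symm z with hx
  have hxi : x ∈ i.1.baseSet := hz.2
  set t := trivializationAt (Fin r → ℂ) E x with ht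
  have hxt : x ∈ t.baseSet := mem_baseSet_trivializationAt _ E x
  set g : (Fin r → ℂ) →L[ℂ] (Fin r → ℂ) :=
    (i.1.coordChangeL ℂ t x : (Fin r → ℂ) →L[ℂ] (Fin r → ℂ)) with hg
  -- The rows of C are the images of the basis vectors, so C is the transpose of the usual matrix of
  -- g, with the same determinant.
  set C : Matrix (Fin r) (Fin r) ℂ := Matrix.of fun α => g (Pi.single α 1) with hC
  have hdetC : C.det = g.det := by
    rw [ContinuousLinearMap.det, ← LinearMap.det_toMatrix', ← Matrix.det_transpose]
    congr 1
  have hsymm (v : Fin r → ℂ) : i.1.symm x v = t.symm x (g v) := by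
    have h1 := i.1.coordChangeL_apply (R := ℂ) t ⟨hxi, hxt⟩ v
    have h2 : g v = (t ⟨x, i.1.symm x v⟩).2 := h1
    rw [h2, t.symm_apply_apply_mk hxt]
  have hmat : H.matrix ⟨φ, hφ, i.1, hi⟩ z = C * fibreMatrix H t x * C.conjTranspose := by
    ext α β
    rw [← sesq_single (M := C * fibreMatrix H t x * C.conjTranspose), sesq_congruence,
      Matrix.single_one_vecMul, Matrix.single_one_vecMul]
    refine Eq.trans ?_ (form_symm_eq_sesq H t hxt _ _)
    change H.form x (i.1.symm x _) (i.1.symm x _) = _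
    rw [hsymm, hsymm]
    rfl
  ext α β
  have hloc (v : Fin r → ℂ) : ((tensorDetCore (r := r) E).localTriv i).symm x v = g.det • g v :=
    (tensorDetCore (r := r) E).localTriv_symm_apply i hxi v
  have hform : H.tensorDet.matrix ⟨φ, hφ, _, ht'⟩ z α β =
      sesq ((fibreMatrix H t x).det • fibreMatrix H t x) (g.det • g (Pi.single α 1))
        (g.det • g (Pi.single β 1)) := by
    change sesq ((fibreMatrix H t x).det • fibreMatrix H t x)
      (((tensorDetCore (r := r) E).localTriv i).symm x (Pi.single α 1))
      (((tensorDetCore (r := r) E).localTriv i).symm x (Pi.single β 1)) = _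
    rw [hloc, hloc]
  rw [hform, Matrix.smul_apply, ← sesq_single (M := H.matrix _ z), hmat, sesq_congruence,
    Matrix.single_one_vecMul, Matrix.single_one_vecMul, sesq_smul, sesq_smul_left,
    sesq_smul_right, Matrix.det_mul, Matrix.det_mul, Matrix.det_conjTranspose, hdetC]
  simp only [smul_eq_mul, RCLike.star_def]
  change _ * (_ * (_ * sesq _ (C α) (C β))) = _ * sesq _ (C α) (C β)
  ring

end TensorDetMetric

/-! ## `E ⊗ det E` is strong Nakano nef -/

section Congruence

variable {n r : ℕ} {Ω : Opens (Fin n → ℂ)}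

theorem curvature_congr {h h' : (Fin n → ℂ) → Matrix (Fin r) (Fin r) ℂ} {z : Fin n → ℂ}
    (hh : h =ᶠ[𝓝 z] h') (j k : Fin n) : curvature h j k z = curvature h' j k z := by
  have h1 : mwirt Complex.I k h =ᶠ[𝓝 z] mwirt Complex.I k h' :=
    hh.eventually_nhds.mono fun w hw => mwirt_congr hw
  rw [curvature_eq, curvature_eq, mwirt_congr h1, mwirt_congr hh, mwirt_congr hh, hh.eq_of_nhds]

theorem shiftedCurvature_congr {h h' : (Fin n → ℂ) → Matrix (Fin r) (Fin r) ℂ} {z : Fin n → ℂ}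
    (hh : h =ᶠ[𝓝 z] h') (a : ℝ) : shiftedCurvature h a z = shiftedCurvature h' a z := by
  funext j k
  rw [shiftedCurvature, shiftedCurvature, curvature_congr hh, hh.eq_of_nhds]

theorem IsMetricOn.congr {h h' : (Fin n → ℂ) → Matrix (Fin r) (Fin r) ℂ}
    (H : IsMetricOn (Ω : Set (Fin n → ℂ)) h) (hh : ∀ z ∈ Ω, h' z = h z) :
    IsMetricOn (Ω : Set (Fin n → ℂ)) h' :=
  ⟨fun α β => (H.smooth α β).congr fun z hz => by rw [hh z hz],
    fun z hz => by rw [hh z hz]; exact H.posDef z hz⟩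

theorem IsNefSequence.congr {h h' : ℕ → (Fin n → ℂ) → Matrix (Fin r) (Fin r) ℂ}
    {h₀ h₀' : (Fin n → ℂ) → Matrix (Fin r) (Fin r) ℂ} {ε : ℕ → ℝ} (S : IsNefSequence Ω h h₀ ε)
    (hh : ∀ m, ∀ z ∈ Ω, h' m z = h m z) (hh₀ : ∀ z ∈ Ω, h₀' z = h₀ z) :
    IsNefSequence Ω h' h₀' ε where
  metric m := (S.metric m).congr (hh m)
  tendsto α β := ((S.tendsto α β).congr fun m z hz => by rw [hh m z hz]).congr_right
    fun z hz => by rw [hh₀ z hz]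
  bdd K hK hKΩ := (S.bdd K hK hKΩ).imp fun B hB m z hz => by
    rw [hh m z (hKΩ hz)]
    exact hB m z hz
  inv_bdd K hK hKΩ := (S.inv_bdd K hK hKΩ).imp fun B hB m z hz => by
    rw [hh m z (hKΩ hz)]
    exact hB m z hz
  nonneg := S.nonneg
  le_one := S.le_one
  tendsto_zero := S.tendsto_zero
  griffiths K hK hKΩ := (S.griffiths K hK hKΩ).imp fun C hC => ⟨hC.1, fun m z hz => by
    rw [shiftedCurvature_congr (h' := h m)
      (Filter.eventually_of_mem (Ω.isOpen.mem_nhds (hKΩ hz)) (hh m))]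
    exact hC.2 m z hz⟩

end Congruence

section Kronecker

variable {n r : ℕ}

theorem sum_kronecker_eq (g : Matrix (Fin n) (Fin n) ℂ) (h : Matrix (Fin r) (Fin r) ℂ)
    (u : Fin n → Fin r → ℂ) :
    ∑ j, ∑ k, ∑ α, ∑ β, g j k * h α β * (u j α * conj (u k β)) =
      ∑ j, ∑ k, g j k * sesq h (u j) (u k) := by
  simp only [sesq, Finset.mul_sum, mul_assoc]

/-- Writing h = C Cᴴ splits the tensor product form into a sum over γ of values of the form g. -/
theorem re_sum_kronecker_nonneg {g : Matrix (Fin n) (Fin n) ℂ} (hg : ∀ u, 0 ≤ (sesq g u u).re)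
    {h : Matrix (Fin r) (Fin r) ℂ} (hh : h.PosDef) (u : Fin n → Fin r → ℂ) :
    0 ≤ (∑ j, ∑ k, g j k * sesq h (u j) (u k)).re := by
  obtain ⟨C, -, rfl⟩ := exists_mul_conjTranspose_eq hh
  have h1 (x y : Fin r → ℂ) : sesq (C * C.conjTranspose) x y =
      ∑ γ, Matrix.vecMul x C γ * conj (Matrix.vecMul y C γ) := by
    rw [← sesq_one, ← sesq_congruence, Matrix.mul_one]
  have h2 : ∑ j, ∑ k, g j k * sesq (C * C.conjTranspose) (u j) (u k) =
      ∑ γ, sesq g (fun j => Matrix.vecMul (u j) C γ) (fun j => Matrix.vecMul (u j) C γ) := by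
    simp only [h1, Finset.mul_sum]
    simp only [sesq]
    rw [Finset.sum_comm (s := (Finset.univ : Finset (Fin r)))]
    refine Finset.sum_congr rfl fun j _ => ?_
    rw [Finset.sum_comm]
  rw [h2, Complex.re_sum]
  exact Finset.sum_nonneg fun γ _ => hg _

end Kronecker

section DetSmulEquicontinuous

variable {r : ℕ} {ι X : Type*} [TopologicalSpace X] {F : ι → X → Matrix (Fin r) (Fin r) ℂ}
  {s : Set X}

/-- The map A ↦ det A · A is uniformly continuous on compact sets of matrices, and near x the family
takes its values in one such set. -/
theorem equicontinuousOn_det_smul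
    (hF : ∀ α β, EquicontinuousOn (fun i z => F i z α β) s)
    (hb : ∀ x ∈ s, ∃ C : ℝ, ∀ i α β, ‖F i x α β‖ ≤ C) (α β : Fin r) :
    EquicontinuousOn (fun i z => ((F i z).det • F i z) α β) s := by
  intro x hx U hU
  obtain ⟨δ, hδ, hδU⟩ := Metric.mem_uniformity_dist.1 hU
  obtain ⟨C, hC⟩ := hb x hx
  let g : (Fin r → Fin r → ℂ) → ℂ := fun A => ((Matrix.of A).det • Matrix.of A) α β
  have hg : Continuous g := by
    have h1 : Continuous fun A : Fin r → Fin r → ℂ => (Matrix.of A).det :=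
      Continuous.matrix_det continuous_id
    exact h1.mul ((continuous_apply β).comp (continuous_apply α))
  have hK : IsCompact (Set.pi univ fun _ : Fin r => Set.pi univ fun _ : Fin r =>
      Metric.closedBall (0 : ℂ) (C + 1)) :=
    isCompact_univ_pi fun _ => isCompact_univ_pi fun _ => isCompact_closedBall _ _
  obtain ⟨η, hη, hgη⟩ := Metric.uniformContinuousOn_iff.1
    (hK.uniformContinuousOn_of_continuous hg.continuousOn) δ hδ
  -- Distance below 1 keeps the matrices in the polydisc of radius C + 1; distance below η is what
  -- uniform continuity asks for.
  have h1 : ∀ᶠ z in 𝓝[s] x, ∀ α β i, dist (F i x α β) (F i z α β) < min η 1 :=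
    eventually_all.2 fun α => eventually_all.2 fun β =>
      hF α β x hx _ (Metric.dist_mem_uniformity (lt_min hη one_pos))
  filter_upwards [h1] with z hz i
  refine hδU (hgη _ (fun α _ β _ => ?_) _ (fun α _ β _ => ?_) ?_)
  · rw [mem_closedBall_zero_iff]
    exact (hC i α β).trans (by linarith)
  · rw [mem_closedBall_zero_iff]
    have h2 := (hz α β i).trans_le (min_le_right _ _)
    rw [dist_eq_norm, norm_sub_rev] at h2
    linarith [norm_sub_norm_le (F i z α β) (F i x α β), hC i α β]
  · refine (dist_pi_lt_iff hη).2 fun α => (dist_pi_lt_iff hη).2 fun β => ?_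
    exact (hz α β i).trans_le (min_le_left _ _)

end DetSmulEquicontinuous

section TensorDetNef

variable {n r : ℕ} {M : Type*} [TopologicalSpace M] [ChartedSpace (Fin n → ℂ) M]
  [IsManifold 𝓘(ℂ, Fin n → ℂ) ω M]
  {E : M → Type*} [∀ x, AddCommGroup (E x)] [∀ x, Module ℂ (E x)]
  [∀ x, TopologicalSpace (E x)] [TopologicalSpace (TotalSpace (Fin r → ℂ) E)]
  [FiberBundle (Fin r → ℂ) E] [VectorBundle ℂ (Fin r → ℂ) E]
  {G : HermitianField (fun x : M => TangentSpace 𝓘(ℂ, Fin n → ℂ) x)}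

theorem HermitianField.IsSmoothMetric.tensorDet {H : HermitianField E}
    (hH : H.IsSmoothMetric n r) : (H.tensorDet (r := r)).IsSmoothMetric n r := by
  refine ⟨fun x v hv => ?_, fun P' α β => ?_⟩
  · have hx := mem_baseSet_trivializationAt (Fin r → ℂ) E x
    have h1 : (fibreMatrix H (trivializationAt (Fin r → ℂ) E x) x).PosDef :=
      posDef_of_sesq (posSemidef_fibreMatrix H _ hx).isHermitian fun w hw => by
        rw [← form_symm_eq_sesq H _ hx]
        exact hH.1 _ _ ((LinearEquiv.map_ne_zero_iff
          ((trivializationAt (Fin r → ℂ) E x).linearEquivAt ℂ x hx).symm).2 hw)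
    exact re_sesq_pos (h1.smul h1.det_pos) hv
  · obtain ⟨P, -, hdom, hP⟩ := exists_patch_tensorDet P'
    rw [← hdom]
    exact ((hH.isMetricOn P).det_smul.smooth α β).congr fun z hz => by rw [hP H z hz]

/-- Demailly-Skoda is applied to R + ε g ⊗ h with the given metric g rather than a Euclidean one, so
the bound is intrinsic. The trace of h⁻¹ h adds r ε to the defect ε. -/
theorem GriffithsBound.nakanoBound_tensorDet {H : HermitianField E} (hs : H.IsSmoothMetric n r)
    {ε : ℝ} (hH : GriffithsBound (r := r) G H ε) :
    NakanoBound (r := r) G (H.tensorDet (r := r)) ((r + 1) * ε) := by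
  intro P' z hz w
  obtain ⟨P, hchart, hdom, hP⟩ := exists_patch_tensorDet P'
  rw [← hdom] at hz
  rw [← hchart]
  have hm := hs.isMetricOn P
  set h := H.matrix P with hh
  set g := tangentMatrix G P.chart z with hg
  have hgherm : g.conjTranspose = g := by
    ext j k
    exact G.conj_symm _ _ _
  have hgreal (u : Fin n → ℂ) : sesq g u u = ((sesq g u u).re : ℂ) := by
    refine (Complex.conj_eq_iff_re.1 ?_).symm
    rw [conj_sesq, hgherm]
  have hgr : GriffithsSemipos fun j k => curvature h j k z + ((ε : ℂ) * g j k) • h z := by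
    intro u v
    have h1 := hH P z hz u v
    rw [sum_griffiths_eq (fun j k => curvature h j k z)] at h1
    change -ε * (sesq g u u).re * (sesq (h z) v v).re ≤ _ at h1
    have h2 : (Matrix.of fun j k => sesq (curvature h j k z + ((ε : ℂ) * g j k) • h z) v v) =
        Matrix.of (fun j k => sesq (curvature h j k z) v v) +
          ((ε : ℂ) * sesq (h z) v v) • g := by
      ext j k
      simp only [sesq_add, sesq_smul, Matrix.of_apply, Matrix.add_apply, Matrix.smul_apply,
        smul_eq_mul]
      ring
    rw [h2, sesq_add, sesq_smul, hgreal, Complex.add_re, mul_assoc, Complex.re_ofReal_mul,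
      mul_comm (sesq (h z) v v), Complex.re_ofReal_mul]
    linarith
  have hcurv (j k : Fin n) : curvature ((H.tensorDet (r := r)).matrix P') j k z = (h z).det •
      (curvature h j k z + ((h z)⁻¹ * curvature h j k z).trace • h z) := by
    rw [curvature_congr (h' := fun z => (h z).det • h z)
      (Filter.eventually_of_mem (P.domain.isOpen.mem_nhds hz) fun y hy => hP H y hy),
      curvature_det_smul P.domain.isOpen hz hm.smooth hm.det_ne_zero]
  have h3 := hgr.nakano (hm.posDef z hz) w
  have h4 (j k : Fin n) : (h z).det • (curvature h j k z + ((ε : ℂ) * g j k) • h z +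
      ((h z)⁻¹ * (curvature h j k z + ((ε : ℂ) * g j k) • h z)).trace • h z) =
      curvature ((H.tensorDet (r := r)).matrix P') j k z +
        (((r + 1) * ε : ℝ) * g j k) • (H.tensorDet (r := r)).matrix P' z := by
    rw [hcurv, hP H z hz, Matrix.mul_add, Matrix.mul_smul,
      Matrix.nonsing_inv_mul _ (hm.isUnit_det hz), Matrix.trace_add, Matrix.trace_smul,
      Matrix.trace_one, Fintype.card_fin]
    ext α β
    simp only [Matrix.add_apply, Matrix.smul_apply, smul_eq_mul]
    push_cast
    ring
  obtain ⟨hd1, hd2⟩ := Complex.lt_def.1 (hm.posDef z hz).det_pos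
  have h5 : 0 ≤ (∑ j, ∑ k, sesq (curvature ((H.tensorDet (r := r)).matrix P') j k z +
        (((r + 1) * ε : ℝ) * g j k) • (H.tensorDet (r := r)).matrix P' z) (w j) (w k)).re := by
    simp only [← h4, sesq_smul (h z).det, ← Finset.mul_sum]
    rw [Complex.mul_re, ← hd2]
    simpa using mul_nonneg hd1.le h3
  rw [sum_kronecker_eq]
  simp only [sesq_add, sesq_smul, Finset.sum_add_distrib, mul_assoc, ← Finset.mul_sum] at h5
  rw [Complex.add_re, Complex.re_ofReal_mul] at h5
  change _ ≤ (∑ j, ∑ k, sesq (curvature ((H.tensorDet (r := r)).matrix P') j k z) (w j) (w k)).re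
  rw [hg, hchart] at h5 ⊢
  linarith

end TensorDetNef

section TensorDetFamily

variable {n r : ℕ} {M : Type*} [TopologicalSpace M] [ChartedSpace (Fin n → ℂ) M]
  [IsManifold 𝓘(ℂ, Fin n → ℂ) ω M]
  {E : M → Type*} [∀ x, AddCommGroup (E x)] [∀ x, Module ℂ (E x)]
  [∀ x, TopologicalSpace (E x)] [TopologicalSpace (TotalSpace (Fin r → ℂ) E)]
  [FiberBundle (Fin r → ℂ) E] [VectorBundle ℂ (Fin r → ℂ) E]
  {G : HermitianField (fun x : M => TangentSpace 𝓘(ℂ, Fin n → ℂ) x)}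

theorem NakanoBound.mono {H : HermitianField E} (hs : H.IsSmoothMetric n r) {ε ε' : ℝ}
    (hH : NakanoBound (r := r) G H ε) (hε : ε ≤ ε') : NakanoBound (r := r) G H ε' := by
  intro P z hz u
  refine le_trans ?_ (hH P z hz u)
  have h1 := re_sum_kronecker_nonneg (re_sesq_tangentMatrix_nonneg G P.chart z)
    ((hs.isMetricOn P).posDef z hz) u
  rw [sum_kronecker_eq]
  nlinarith

/-- The rescaled parameter: the metric with parameter `ε` on `E ⊗ det E` is induced by the metric
with parameter `min ε 1 / (r + 1)` on `E`. -/
def rescale (r : ℕ) (ε : ℝ) : ℝ := min ε 1 / (r + 1)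

theorem rescale_pos {ε : ℝ} (hε : 0 < ε) : 0 < rescale r ε :=
  div_pos (lt_min hε one_pos) (by positivity)

theorem rescale_le_one {ε : ℝ} : rescale r ε ≤ 1 :=
  div_le_one_of_le₀ ((min_le_right _ _).trans (by linarith [Nat.cast_nonneg (α := ℝ) r]))
    (by positivity)

theorem mul_rescale_le {ε : ℝ} : (r + 1) * rescale r ε ≤ ε := by
  rw [rescale, mul_div_cancel₀ _ (by positivity)]
  exact min_le_left _ _

variable {H : ℝ → HermitianField E} (hH : IsStrongGriffithsNefFamily (r := r) G H)

include hH

theorem equicontinuousOn_tensorDet {ι : Type*} {ε : ι → ℝ} (hε : ∀ i, 0 < ε i)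
    (P' : Patch n r (TensorDet (r := r) E)) (α β : Fin r) :
    EquicontinuousOn (fun i z => ((H (ε i)).tensorDet (r := r)).matrix P' z α β) P'.domain := by
  obtain ⟨P, -, hdom, hP⟩ := exists_patch_tensorDet P'
  rw [← hdom]
  have h1 := equicontinuousOn_det_smul (F := fun i => (H (ε i)).matrix P)
    (s := (P.domain : Set (Fin n → ℂ)))
    (fun α β => ((hH.2.2 P).1 α β).comp fun i => (⟨ε i, hε i⟩ : Ioi (0 : ℝ)))
    (fun z hz => ((hH.2.2 P).2 {z} isCompact_singleton (singleton_subset_iff.2 hz)).imp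
      fun C hC i => hC _ (hε i) z rfl) α β
  intro z hz U hU
  filter_upwards [h1 z hz U hU, self_mem_nhdsWithin] with w hw hwP i
  rw [hP _ z hz, hP _ w hwP]
  exact hw i

/-- The inverses are bounded in the sup norm on compact sets, so any exponent above 1 would do; 2 is
chosen. The minimum with 1 in `rescale` keeps the parameter in the range where this bound holds. -/
theorem isStrongNakanoNefFamily_tensorDet (hG : G.IsSmoothMetric n n) :
    IsStrongNakanoNefFamily (r := r) G
      fun ε => (H (rescale r ε)).tensorDet (r := r) := by
  refine ⟨fun ε hε => ?_, ⟨2, one_lt_two, fun P' K hK hKP => ?_⟩, fun P' => ⟨fun α β => ?_,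
    fun K hK hKP => ?_⟩⟩
  · obtain ⟨hs, hb⟩ := hH.1 _ (rescale_pos (r := r) hε)
    exact ⟨hs.tensorDet, (hb.nakanoBound_tensorDet hs).mono hs.tensorDet mul_rescale_le⟩
  · obtain ⟨P, -, hdom, hP⟩ := exists_patch_tensorDet P'
    rw [← hdom] at hKP
    obtain ⟨B, hB⟩ := hH.exists_norm_inv_le hG P hK hKP
    have hfin : volume.restrict K univ ^ (ENNReal.ofReal 2).toReal⁻¹ *
        ENNReal.ofReal (Nat.factorial r * B ^ r * B) ≠ ⊤ := by
      refine ENNReal.mul_ne_top (ENNReal.rpow_ne_top_of_nonneg (by positivity) ?_)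
        ENNReal.ofReal_ne_top
      rw [Measure.restrict_apply_univ]
      exact hK.measure_lt_top.ne
    refine ⟨ENNReal.toNNReal _, fun ε hε α β => (eLpNorm_le_of_ae_bound ?_).trans_eq
      (ENNReal.coe_toNNReal hfin).symm⟩
    filter_upwards [ae_restrict_mem hK.measurableSet] with z hz
    rw [hP _ z (hKP hz), inv_det_smul
      (((hH.1 _ (rescale_pos hε)).1.isMetricOn P).isUnit_det (hKP hz))]
    exact norm_det_smul_apply_le (hB _ (rescale_pos hε) rescale_le_one z hz) α β
  · exact equicontinuousOn_tensorDet hH (fun ε : Ioi (0 : ℝ) => rescale_pos (r := r) ε.2) P' α β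
  · obtain ⟨P, -, hdom, hP⟩ := exists_patch_tensorDet P'
    rw [← hdom] at hKP
    obtain ⟨B, hB⟩ := (hH.2.2 P).2 K hK hKP
    refine ⟨Nat.factorial r * B ^ r * B, fun ε hε z hz α β => ?_⟩
    rw [hP _ z (hKP hz)]
    exact norm_det_smul_apply_le (hB _ (rescale_pos hε) z hz) α β

variable {ε : ℕ → ℝ} {H₀ : HermitianField E}

theorem isNefSequence_tensorDet (hpos : ∀ m, 0 < ε m)
    (S : ∀ P : Patch n r E, IsNefSequence P.domain (fun m => (H (ε m)).matrix P) (H₀.matrix P) ε)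
    (P' : Patch n r (TensorDet (r := r) E)) :
    IsNefSequence P'.domain (fun m => ((H (ε m)).tensorDet (r := r)).matrix P')
      ((H₀.tensorDet (r := r)).matrix P') ε := by
  have hequi (α β) := equicontinuousOn_tensorDet hH hpos P' α β
  obtain ⟨P, -, hdom, hP⟩ := exists_patch_tensorDet P'
  rw [← hdom] at hequi ⊢
  refine ((S P).det_smul fun α β => ?_).congr (fun m z hz => hP _ z hz) fun z hz => hP _ z hz
  refine (tendstoLocallyUniformlyOn_of_equicontinuousOn (hequi α β) fun z hz => ?_).congr
    fun m z hz => congrFun (congrFun (hP _ z hz) α) β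
  have h1 := (S P).tendsto_apply hz
  have h2 : Continuous fun A : Matrix (Fin r) (Fin r) ℂ => (A.det • A) α β :=
    ((continuous_id.matrix_det).smul continuous_id).matrix_elem α β
  exact ((h2.tendsto _).comp h1).congr fun m => by rw [hP _ z hz, Function.comp_apply]

omit hH in
theorem exists_nakanoSemipos_tensorDet
    (S : ∀ P : Patch n r E, IsNefSequence P.domain (fun m => (H (ε m)).matrix P) (H₀.matrix P) ε)
    (P' : Patch n r (TensorDet (r := r) E)) {K : Set (Fin n → ℂ)} (hK : IsCompact K)
    (hKP : K ⊆ P'.domain) : ∃ C : ℝ, ∀ m, ∀ z ∈ K, NakanoSemipos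
      (shiftedCurvature (((H (ε m)).tensorDet (r := r)).matrix P') (ε m * C) z) := by
  obtain ⟨P, -, hdom, hP⟩ := exists_patch_tensorDet P'
  rw [← hdom] at hKP
  refine ((S P).nakano_det_smul hK hKP).imp fun C hC m z hz => ?_
  rw [shiftedCurvature_congr (h' := fun z => ((H (ε m)).matrix P z).det • (H (ε m)).matrix P z)
    (Filter.eventually_of_mem (P.domain.isOpen.mem_nhds (hKP hz)) fun w hw => hP _ w hw)]
  exact hC.2 m z hz

end TensorDetFamily

end NefBundle

end

open NefBundle in
theorem proposition3p13 {n r : ℕ}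
    {M : Type*} [TopologicalSpace M] [T2Space M] [CompactSpace M]
    [ChartedSpace (Fin n → ℂ) M] [IsManifold 𝓘(ℂ, Fin n → ℂ) ω M]
    (E : M → Type*) [∀ x, AddCommGroup (E x)] [∀ x, Module ℂ (E x)]
    [∀ x, TopologicalSpace (E x)] [TopologicalSpace (TotalSpace (Fin r → ℂ) E)]
    [FiberBundle (Fin r → ℂ) E] [VectorBundle ℂ (Fin r → ℂ) E]
    [ContMDiffVectorBundle ω (Fin r → ℂ) E 𝓘(ℂ, Fin n → ℂ)]
    (G : HermitianField (fun x : M => TangentSpace 𝓘(ℂ, Fin n → ℂ) x))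
    (hG : G.IsSmoothMetric n n)
    (H : ℝ → HermitianField E) (hH : IsStrongGriffithsNefFamily (r := r) G H) :
    (∃ (ε : ℕ → ℝ) (H₀ : HermitianField E) (Θ : CurvatureCurrent n r H₀),
      (∀ m, 0 < ε m) ∧ StrictAnti ε ∧ Tendsto ε atTop (𝓝 0) ∧
      H₀.IsSingularMetric n r ∧
      HermitianField.ConvergesTo n r (fun m => H (ε m)) H₀ ∧
      Θ.IsWeakLimit (fun m => H (ε m)) ∧
      Θ.IsGriffithsPseudoeffective) ∧
    ∃ H' : ℝ → HermitianField (TensorDet (r := r) E),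
      IsStrongNakanoNefFamily (r := r) G H' ∧
      ∃ (ε : ℕ → ℝ) (H₀ : HermitianField (TensorDet (r := r) E)) (Θ : CurvatureCurrent n r H₀),
        (∀ m, 0 < ε m) ∧ StrictAnti ε ∧ Tendsto ε atTop (𝓝 0) ∧
        H₀.IsSingularMetric n r ∧
        HermitianField.ConvergesTo n r (fun m => H' (ε m)) H₀ ∧
        Θ.IsWeakLimit (fun m => H' (ε m)) ∧
        Θ.IsNakanoPseudoeffective := by
  let δ (m : ℕ) : ℝ := 1 / ((m : ℝ) + 1)
  have hδpos (m : ℕ) : 0 < δ m := Nat.one_div_pos_of_nat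
  have hδle (m : ℕ) : δ m ≤ 1 :=
    div_le_one_of_le₀ (by linarith [Nat.cast_nonneg (α := ℝ) m]) (by positivity)
  have hδanti : StrictAnti δ := fun a b hab => Nat.one_div_lt_one_div hab
  have hδlim : Tendsto δ atTop (𝓝 0) := tendsto_one_div_add_atTop_nhds_zero_nat
  have hr : (0 : ℝ) < r + 1 := by positivity
  have hres (m : ℕ) : rescale r (δ m) = δ m / (r + 1) := by
    rw [rescale, min_eq_left (hδle m)]
  -- Extracting along the rescaled parameters lets one subsequence serve both claims: the twisted
  -- metric with parameter δ is induced by the metric on E with parameter `rescale r δ`.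
  obtain ⟨φ, hφ, H₀, hlim⟩ := exists_subseq_form_tendsto (n := n) (r := r)
    (Hs := fun m => H (rescale r (δ m)))
    (fun P α β => ((hH.2.2 P).1 α β).comp
      fun m => (⟨rescale r (δ m), rescale_pos (hδpos m)⟩ : Ioi (0 : ℝ)))
    (fun P z hz => ((hH.2.2 P).2 {z} isCompact_singleton (singleton_subset_iff.2 hz)).imp
      fun C hC m => hC _ (rescale_pos (hδpos m)) z rfl)
  have hanti : StrictAnti fun m => δ (φ m) := hδanti.comp_strictMono hφ
  have hto : Tendsto (fun m => δ (φ m)) atTop (𝓝 0) := hδlim.comp hφ.tendsto_atTop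
  have hto' : Tendsto (fun m => rescale r (δ (φ m))) atTop (𝓝 0) := by
    simp only [hres]
    simpa using hto.div_const ((r : ℝ) + 1)
  have S := hH.isNefSequence hG (fun m => rescale_pos (r := r) (hδpos (φ m)))
    (fun _ => rescale_le_one) hto' hlim
  have S' := isNefSequence_tensorDet hH (fun m => rescale_pos (r := r) (hδpos (φ m))) S
  obtain ⟨Θ, hΘlim, hΘ, -⟩ := exists_curvatureCurrent S
  obtain ⟨Θ', hΘ'lim, -, hΘ'⟩ := exists_curvatureCurrent S'
  refine ⟨⟨fun m => rescale r (δ (φ m)), H₀, Θ, fun m => rescale_pos (hδpos _), fun a b hab => ?_,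
    hto', isSingularMetric_limit S, convergesTo_limit S, hΘlim, hΘ⟩, _,
    isStrongNakanoNefFamily_tensorDet hH hG, fun m => δ (φ m), H₀.tensorDet, Θ',
    fun m => hδpos _, hanti, hto, isSingularMetric_limit S', convergesTo_limit S', hΘ'lim,
    hΘ' fun P K hK hKP => exists_nakanoSemipos_tensorDet S P hK hKP⟩
  simp only [hres]
  exact div_lt_div_of_pos_right (hanti hab) hr
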